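/- Let $n\ge 2$ and let $\overline g=\frac{dr^2}{1+r^2}+r^2d\Omega^2$, $r=|x|$, be the hyperbolic metric on $\mathbb R^n$, where $d\Omega^2$ is the round metric of the unit sphere; in Cartesian coordinates $\overline g_{ij}=\delta_{ij}-\frac{x_ix_j}{1+r^2}$. Let $\overline\nabla$ be its Levi-Civita connection, $|\cdot|$ its norm on tensors (full contraction), $d\mu=\sqrt{\det\overline g}\,d^nx$ its volume measure; indices are raised with $\overline g$. Let $A^0\in\mathbb R$ and $\vec A\in\mathbb R^n$ with $|\vec A|\le A^0$, and $$V=A^0\sqrt{1+r^2}+\sum_i A^ix^i .$$ For a symmetric 2-tensor field $\hat h$ put $$(\overline{\mathcal D}\hat h)_{ijk}=\tfrac1{\sqrt2}(\overline\nabla_i\hat h_{jk}-\overline\nabla_j\hat h_{ik}),\qquad (\overline{\mathrm{div}}\,\hat h)_j=-\overline\nabla_i\hat h^i{}_j,\qquad (\hat h_{dV})_i=V^{-1}\hat h_{ij}\overline\nabla^jV$$ (with $\hat h_{dV}:=0$ in the degenerate case $V\equiv0$). Let $\hat h$ be a $C^2$ symmetric 2-tensor field on $\mathbb R^n$ with $\overline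 g^{ij}\hat h_{ij}=0$ such that $$|\hat h|=O(r^{-n/2})\ \text{ as } r\to\infty,\qquad |\overline\nabla\hat h|^2V\in L^1(d\mu).$$ Then $|\hat h|^2V$, $|\overline{\mathcal D}\hat h|^2V$, $|\overline{\mathrm{div}}\,\hat h-\hat h_{dV}|^2V$ and $\overline\nabla_j(\hat h_{ik}\overline\nabla^iV\,\hat h^{jk})$ are in $L^1(d\mu)$, $$\int|\hat h|^2V\,d\mu\le\frac1n\int\Big[\big(|\overline\nabla\hat h|^2-|\overline{\mathcal D}\hat h|^2-|\overline{\mathrm{div}}\,\hat h-\hat h_{dV}|^2\big)V+\overline\nabla_j(\hat h_{ik}\overline\nabla^iV\,\hat h^{jk})\Big]d\mu,$$ the divergence term integrates to zero, $\int\overline\nabla_j(\hat h_{ik}\overline\nabla^iV\,\hat h^{jk})\,d\mu=0$, and consequently $$\int|\hat h|^2V\,d\mu\le\frac1n\int|\overline\nabla\hat h|^2V\,d\mu .$$ -/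

import Mathlib

open MeasureTheory Filter Asymptotics

noncomputable section

namespace HypPoincare

/-! Tensor calculus on `ℝⁿ` for a Riemannian metric given by its components `g x i j` in the
standard (global, Cartesian) coordinates `x = (x¹, …, xⁿ)`. -/

/-- A field of `2`-index objects `x ↦ h x i j` on `ℝⁿ` (covariant components of a `2`-tensor). -/
abbrev Field2 (n : ℕ) := EuclideanSpace ℝ (Fin n) → Matrix (Fin n) (Fin n) ℝ

/-- Partial derivative `∂ᵢ f` at `x`. -/
def pderiv {n : ℕ} (i : Fin n) (f : EuclideanSpace ℝ (Fin n) → ℝ)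
    (x : EuclideanSpace ℝ (Fin n)) : ℝ :=
  fderiv ℝ f x (EuclideanSpace.single i 1)

/-- Christoffel symbols of the Levi-Civita connection,
`Γᵏᵢⱼ = ½ gᵏˡ (∂ᵢ gⱼₗ + ∂ⱼ gᵢₗ - ∂ₗ gᵢⱼ)`. -/
def christoffel {n : ℕ} (g : Field2 n) (x : EuclideanSpace ℝ (Fin n)) (k i j : Fin n) : ℝ :=
  1 / 2 * ∑ l, (g x)⁻¹ k l *
    (pderiv i (fun y => g y j l) x + pderiv j (fun y => g y i l) x
      - pderiv l (fun y => g y i j) x)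

/-- Covariant derivative of a covariant `2`-tensor: `cov g h x i j k` is
`∇ᵢ hⱼₖ = ∂ᵢ hⱼₖ - Γˡᵢⱼ hₗₖ - Γˡᵢₖ hⱼₗ`. -/
def cov {n : ℕ} (g h : Field2 n) (x : EuclideanSpace ℝ (Fin n)) (i j k : Fin n) : ℝ :=
  pderiv i (fun y => h y j k) x - ∑ l, christoffel g x l i j * h x l k
    - ∑ l, christoffel g x l i k * h x j l

/-- Divergence of a vector field `X`: `∇ⱼ Xʲ = ∂ⱼ Xʲ + Γʲⱼₖ Xᵏ`. -/
def vecDiv {n : ℕ} (g : Field2 n) (X : EuclideanSpace ℝ (Fin n) → Fin n → ℝ)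
    (x : EuclideanSpace ℝ (Fin n)) : ℝ :=
  ∑ j, (pderiv j (fun y => X y j) x + ∑ k, christoffel g x j j k * X x k)

/-- Gradient `∇ⁱ f = gⁱʲ ∂ⱼ f`. -/
def grad {n : ℕ} (g : Field2 n) (f : EuclideanSpace ℝ (Fin n) → ℝ)
    (x : EuclideanSpace ℝ (Fin n)) (i : Fin n) : ℝ :=
  ∑ j, (g x)⁻¹ i j * pderiv j f x

/-- `|α|²` for a covector `α` at a point where the metric is `G`. -/
def normSq1 {n : ℕ} (G : Matrix (Fin n) (Fin n) ℝ) (α : Fin n → ℝ) : ℝ :=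
  ∑ i, ∑ j, G⁻¹ i j * α i * α j

/-- `|h|² = gⁱᵃ gʲᵇ hᵢⱼ hₐᵦ` for a covariant `2`-tensor. -/
def normSq2 {n : ℕ} (G : Matrix (Fin n) (Fin n) ℝ) (h : Fin n → Fin n → ℝ) : ℝ :=
  ∑ i, ∑ j, ∑ a, ∑ b, G⁻¹ i a * G⁻¹ j b * h i j * h a b

/-- `|T|²`, the full contraction `gⁱᵃ gʲᵇ gᵏᶜ Tᵢⱼₖ Tₐᵦ꜀`, for a covariant `3`-tensor. -/
def normSq3 {n : ℕ} (G : Matrix (Fin n) (Fin n) ℝ) (T : Fin n → Fin n → Fin n → ℝ) : ℝ :=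
  ∑ i, ∑ j, ∑ k, ∑ a, ∑ b, ∑ c,
    G⁻¹ i a * G⁻¹ j b * G⁻¹ k c * T i j k * T a b c

/-- `(𝒟h)ᵢⱼₖ = (1/√2) (∇ᵢ hⱼₖ - ∇ⱼ hᵢₖ)`. -/
def curlOp {n : ℕ} (g h : Field2 n) (x : EuclideanSpace ℝ (Fin n)) (i j k : Fin n) : ℝ :=
  1 / Real.sqrt 2 * (cov g h x i j k - cov g h x j i k)

/-- `(div h)ⱼ = -∇ᵢ hⁱⱼ = -gⁱᵏ ∇ᵢ hₖⱼ` (note the sign). -/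
def tensorDiv {n : ℕ} (g h : Field2 n) (x : EuclideanSpace ℝ (Fin n)) (j : Fin n) : ℝ :=
  -∑ i, ∑ k, (g x)⁻¹ i k * cov g h x i k j

/-- `(h_{dV})ᵢ = V⁻¹ hᵢⱼ ∇ʲV`. -/
def contractDV {n : ℕ} (g h : Field2 n) (V : EuclideanSpace ℝ (Fin n) → ℝ)
    (x : EuclideanSpace ℝ (Fin n)) (i : Fin n) : ℝ :=
  (V x)⁻¹ * ∑ j, h x i j * grad g V x j

/-- The vector field `Xʲ = hᵢₖ ∇ⁱV hʲᵏ`, with `hʲᵏ = gʲᵃ gᵏᵇ hₐᵦ`. -/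
def fluxField {n : ℕ} (g h : Field2 n) (V : EuclideanSpace ℝ (Fin n) → ℝ)
    (x : EuclideanSpace ℝ (Fin n)) (j : Fin n) : ℝ :=
  ∑ i, ∑ k, h x i k * grad g V x i * ∑ a, ∑ b, (g x)⁻¹ j a * (g x)⁻¹ k b * h x a b

/-- Riemannian measure `√(det g) dⁿx`. -/
def riemVol {n : ℕ} (g : Field2 n) : Measure (EuclideanSpace ℝ (Fin n)) :=
  volume.withDensity fun x => ENNReal.ofReal (Real.sqrt (g x).det)

/-- The hyperbolic metric `dr²/(1+r²) + r² dΩ²` on `ℝⁿ`, with `r = |x|`, in Cartesian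
coordinates: since `r² dΩ² = |dx|² - dr²` and `r dr = x · dx`, its components are
`δᵢⱼ - xᵢ xⱼ / (1+r²)`, which are smooth across the origin; `hypMetric_polar` is the polar form. -/
def hypMetric (n : ℕ) : Field2 n := fun x =>
  Matrix.of fun i j => (if i = j then 1 else 0) - x i * x j / (1 + ‖x‖ ^ 2)

/-- The function `V = A⁰ √(1+r²) + ∑ᵢ Aⁱ xⁱ`. -/
def staticKID {n : ℕ} (A0 : ℝ) (A : EuclideanSpace ℝ (Fin n))
    (x : EuclideanSpace ℝ (Fin n)) : ℝ :=
  A0 * Real.sqrt (1 + ‖x‖ ^ 2) + ∑ i, A i * x i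

/-- Away from the origin `hypMetric` is `dr²/(1+r²) + r² dΩ²`, where `dΩ²` is the pull-back of the
Euclidean metric under `x ↦ x/|x|`. -/
theorem hypMetric_polar {n : ℕ} (x v w : EuclideanSpace ℝ (Fin n)) (hx : x ≠ 0) :
    ∑ i, ∑ j, hypMetric n x i j * v i * w j =
      fderiv ℝ (fun y : EuclideanSpace ℝ (Fin n) => ‖y‖) x v *
          fderiv ℝ (fun y : EuclideanSpace ℝ (Fin n) => ‖y‖) x w / (1 + ‖x‖ ^ 2) +
        ‖x‖ ^ 2 * inner ℝ
          (fderiv ℝ (fun y : EuclideanSpace ℝ (Fin n) => ‖y‖⁻¹ • y) x v)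
          (fderiv ℝ (fun y : EuclideanSpace ℝ (Fin n) => ‖y‖⁻¹ • y) x w) := by
  have hr : ‖x‖ ≠ 0 := norm_ne_zero_iff.mpr hx
  have hd : DifferentiableAt ℝ (fun y : EuclideanSpace ℝ (Fin n) => ‖y‖) x :=
    (contDiffAt_norm ℝ hx (n := 1)).differentiableAt (by norm_num)
  have hn : ∀ u, fderiv ℝ (fun y : EuclideanSpace ℝ (Fin n) => ‖y‖) x u = inner ℝ x u / ‖x‖ := by
    intro u
    have h1 := (hasStrictFDerivAt_norm_sq x).hasFDerivAt.fderiv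
    have h2 := (hd.hasFDerivAt.pow 2).fderiv
    have h3 := congrArg (fun L => L u) (h1.symm.trans h2)
    simp at h3
    field_simp
    linarith
  have hw : ∀ u, fderiv ℝ (fun y : EuclideanSpace ℝ (Fin n) => ‖y‖⁻¹ • y) x u =
      ‖x‖⁻¹ • u - (inner ℝ x u / ‖x‖ ^ 3) • x := by
    intro u
    have h1 : HasFDerivAt (fun y : EuclideanSpace ℝ (Fin n) => ‖y‖⁻¹)
        ((-(‖x‖ ^ 2)⁻¹) • fderiv ℝ (fun y : EuclideanSpace ℝ (Fin n) => ‖y‖) x) x :=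
      (hasDerivAt_inv hr).comp_hasFDerivAt x hd.hasFDerivAt
    have h2 := (h1.smul (hasFDerivAt_id x)).fderiv
    have h3 : fderiv ℝ (fun y : EuclideanSpace ℝ (Fin n) => ‖y‖⁻¹ • y) x = _ := h2
    rw [h3]
    simp [hn]
    rw [sub_eq_add_neg, ← neg_smul, ← neg_smul]
    congr 2
    field_simp
  have hs : ∑ i, ∑ j, hypMetric n x i j * v i * w j =
      inner ℝ v w - inner ℝ x v * inner ℝ x w / (1 + ‖x‖ ^ 2) := by
    simp only [hypMetric, Matrix.of_apply, sub_mul, Finset.sum_sub_distrib, ite_mul, one_mul,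
      zero_mul, Finset.sum_ite_eq, Finset.mem_univ, if_true, PiLp.inner_apply, RCLike.inner_apply,
      conj_trivial]
    rw [Finset.sum_mul_sum, Finset.sum_div]
    congr 1
    · exact Finset.sum_congr rfl fun i _ => mul_comm _ _
    · refine Finset.sum_congr rfl fun i _ => ?_
      rw [Finset.sum_div]
      exact Finset.sum_congr rfl fun j _ => by ring
  have hxx : inner ℝ x x = ‖x‖ ^ 2 := real_inner_self_eq_norm_sq x
  have hp : (1 + ‖x‖ ^ 2) ≠ 0 := by positivity
  rw [hs, hn, hn, hw, hw]
  simp only [inner_sub_left, inner_sub_right, real_inner_smul_left, real_inner_smul_right, hxx,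
    real_inner_comm x v]
  field_simp
  ring

end HypPoincare

end

/-!
The inequality is a weighted Bochner (Weitzenböck) formula on hyperbolic space, with the static
potential `V`, which satisfies `Hess V = V g`, as the weight. Write `T = ∇ᵢhⱼₖ ∇ʲhⁱᵏ`, which is
`|∇h|² - |𝒟h|²` (`normSq3_curlOp`), and let `U` be the vector field
`Uᵃ = hᵇᶜ ∇_b hᵃ_c - hᵃᶜ ∇ᵇ h_bc`. In `div U` the second derivatives of `h` occur only through a
commutator, the curvature is constant, and `h` is traceless, so
`div U = T - |div h|² - n |h|²` (`frameDiv_bochnerField`). For the flux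
`Xʲ = h_ik ∇ⁱV hʲᵏ` the equation `Hess V = V g` gives `div X = ∇h·h·∇V`-terms `+ V |h|²`
(`frameDiv_frameFlux`). With `Z = X - V U` these combine to
`div Z = (n+1) V |h|² - |h(∇V)|²/V + V |div h - h_dV|² - V T` (`frameDiv_boundaryField`). Since
`|∇V|² = V² - ((A⁰)² - |A|²) ≤ V²`, the term `|h(∇V)|²/V` is at most `V |h|²`, and pointwise
`n V |h|² ≤ V (T - |div h - h_dV|²) + div Z` (`mul_normSq2_le`).

Both `|X|` and `|Z|` are bounded by a multiple of `V (|h|² + |∇h|²)`. The hyperbolic gradients of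
the cutoffs `χ_R`, equal to `1` on `r ≤ R` and to `0` on `r ≥ 2R`, are bounded uniformly in `R`,
and the decay rate of `h` is exactly the one for which `∫ V |h|² dμ` over the annuli
`R ≤ r ≤ 2R` stays bounded. Testing the pointwise estimate against `χ_R` therefore bounds
`∫ χ_R V |h|² dμ`, and monotone convergence gives `V |h|² ∈ L¹` (`integrable_normSq2_mul`). Now
`X` and `Z` and their divergences are integrable, so both divergences have integral zero by Gaffney's
argument (`integral_frameDiv_eq_zero`), and integrating the pointwise estimate finishes the proof.

All tensor calculus is done in the orthonormal frame `e_a` of the ball model with coordinates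
`y = x / (1 + √(1 + r²))`, expressed in the coordinates `x`. In this frame contractions are plain
sums, the connection is `∇_{e_a} e_b = y_b e_a - δ_ab y_c e_c`, and `[e_a, e_b] = y_b e_a - y_a e_b`;
hence the divergence formulas reduce to identities between finite sums.
-/

namespace HypPoincare

variable {n : ℕ}

/-! ### The orthonormal frame of the ball model and its derivatives -/

/-- The factor `φ = 1 / (1 + √(1 + r²))` relating `x` to the ball coordinates `y = φ x`. -/
noncomputable def ballFactor (x : EuclideanSpace ℝ (Fin n)) : ℝ := (1 + √(1 + ‖x‖ ^ 2))⁻¹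

/-- The coordinates `y = x / (1 + √(1 + r²))` of the Poincaré ball, as functions of `x`. -/
noncomputable def ballCoord (x : EuclideanSpace ℝ (Fin n)) (a : Fin n) : ℝ := ballFactor x * x a

/-- The coefficients `e_aⁱ = δ_ia + y_i x_a` of the orthonormal frame `e_a = ((1 - |y|²)/2) ∂/∂y_a`:
`frame x i a` is the `i`-th component of `e_a` in the coordinates `x`. It is a symmetric matrix. -/
noncomputable def frame (x : EuclideanSpace ℝ (Fin n)) (i a : Fin n) : ℝ :=
  (if i = a then 1 else 0) + ballCoord x i * x a

/-- The derivative `e_a f`. -/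
noncomputable def frameDeriv (a : Fin n) (f : EuclideanSpace ℝ (Fin n) → ℝ)
    (x : EuclideanSpace ℝ (Fin n)) : ℝ :=
  ∑ i, frame x i a * pderiv i f x

theorem sum_coord_mul_self (x : EuclideanSpace ℝ (Fin n)) : ∑ i, x i * x i = ‖x‖ ^ 2 := by
  rw [EuclideanSpace.real_norm_sq_eq]
  exact Finset.sum_congr rfl fun i _ => (sq _).symm

theorem sq_lapse (x : EuclideanSpace ℝ (Fin n)) : √(1 + ‖x‖ ^ 2) ^ 2 = 1 + ‖x‖ ^ 2 :=
  Real.sq_sqrt (by positivity)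

theorem ballFactor_mul (x : EuclideanSpace ℝ (Fin n)) :
    ballFactor x * (1 + √(1 + ‖x‖ ^ 2)) = 1 :=
  inv_mul_cancel₀ (by positivity)

theorem ballFactor_mul_normSq (x : EuclideanSpace ℝ (Fin n)) :
    ballFactor x * ‖x‖ ^ 2 = √(1 + ‖x‖ ^ 2) - 1 := by
  have h1 := sq_lapse x
  have h2 := ballFactor_mul x
  linear_combination (-ballFactor x) * h1 + (√(1 + ‖x‖ ^ 2) - 1) * h2

theorem frame_comm (x : EuclideanSpace ℝ (Fin n)) (i a : Fin n) : frame x i a = frame x a i := by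
  simp only [frame, ballCoord, eq_comm (a := i)]
  ring

theorem sum_frame_mul (x : EuclideanSpace ℝ (Fin n)) (a : Fin n) (v : Fin n → ℝ) :
    ∑ i, frame x i a * v i = v a + (∑ i, ballCoord x i * v i) * x a := by
  simp only [frame, add_mul, ite_mul, one_mul, zero_mul, Finset.sum_add_distrib,
    Finset.sum_ite_eq', Finset.mem_univ, if_true, Finset.sum_mul]
  congr 1
  exact Finset.sum_congr rfl fun i _ => by ring

theorem sum_frame_mul_coord (x : EuclideanSpace ℝ (Fin n)) (a : Fin n) :
    ∑ i, frame x i a * x i = √(1 + ‖x‖ ^ 2) * x a := by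
  rw [sum_frame_mul]
  simp only [ballCoord, mul_assoc, ← Finset.mul_sum, sum_coord_mul_self]
  linear_combination x a * ballFactor_mul_normSq x

theorem hypMetric_mulVec_frame (x : EuclideanSpace ℝ (Fin n)) (i b : Fin n) :
    ∑ j, hypMetric n x i j * frame x j b =
      (if i = b then 1 else 0) + x i * x b * (ballFactor x - (√(1 + ‖x‖ ^ 2))⁻¹) := by
  have h0 : √(1 + ‖x‖ ^ 2) ≠ 0 := by positivity
  have h1 := sq_lapse x
  simp only [hypMetric, Matrix.of_apply, sub_mul, Finset.sum_sub_distrib, ite_mul, one_mul,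
    zero_mul, Finset.sum_ite_eq, Finset.mem_univ, if_true]
  have : ∑ j, x i * x j / (1 + ‖x‖ ^ 2) * frame x j b
      = x i / (1 + ‖x‖ ^ 2) * ∑ j, frame x j b * x j := by
    rw [Finset.mul_sum]; exact Finset.sum_congr rfl fun j _ => by ring
  rw [this, sum_frame_mul_coord]
  have h2 : x i / (1 + ‖x‖ ^ 2) = x i * (√(1 + ‖x‖ ^ 2))⁻¹ ^ 2 := by
    rw [inv_pow, h1, div_eq_mul_inv]
  rw [h2]
  simp only [frame, ballCoord]
  generalize √(1 + ‖x‖ ^ 2) = t at h0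
  field_simp
  ring

/-- The frame is orthonormal: `g(e_a, e_b) = δ_ab`. -/
theorem frame_orthonormal (x : EuclideanSpace ℝ (Fin n)) (a b : Fin n) :
    ∑ i, ∑ j, hypMetric n x i j * (frame x i a * frame x j b) = if a = b then 1 else 0 := by
  have h0 : √(1 + ‖x‖ ^ 2) ≠ 0 := by positivity
  have : ∀ i, ∑ j, hypMetric n x i j * (frame x i a * frame x j b) =
      frame x i a * ((if i = b then 1 else 0)
        + x i * x b * (ballFactor x - (√(1 + ‖x‖ ^ 2))⁻¹)) := fun i => by
    rw [← hypMetric_mulVec_frame, Finset.mul_sum]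
    exact Finset.sum_congr rfl fun j _ => by ring
  simp only [this, mul_add, Finset.sum_add_distrib, mul_ite, mul_one, mul_zero,
    Finset.sum_ite_eq', Finset.mem_univ, if_true]
  have h2 : ∑ i, frame x i a * (x i * x b * (ballFactor x - (√(1 + ‖x‖ ^ 2))⁻¹)) =
      (x b * (ballFactor x - (√(1 + ‖x‖ ^ 2))⁻¹)) * ∑ i, frame x i a * x i := by
    rw [Finset.mul_sum]; exact Finset.sum_congr rfl fun j _ => by ring
  rw [h2, sum_frame_mul_coord, frame]
  simp only [eq_comm (a := b), ballCoord]
  have h3 := ballFactor_mul x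
  field_simp
  linear_combination x a * x b * h3

/-- The inverse metric is `δ + x xᵀ`. -/
theorem hypMetric_inv (x : EuclideanSpace ℝ (Fin n)) :
    (hypMetric n x)⁻¹ = Matrix.of fun i j => (if i = j then 1 else 0) + x i * x j := by
  refine Matrix.inv_eq_right_inv ?_
  ext i k
  have h1 : (1 + ‖x‖ ^ 2) ≠ 0 := by positivity
  simp only [Matrix.mul_apply, hypMetric, Matrix.of_apply, sub_mul, mul_add, mul_ite, mul_one,
    mul_zero, Finset.sum_sub_distrib, Finset.sum_add_distrib, ite_mul, one_mul, zero_mul,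
    Finset.sum_ite_eq, Finset.sum_ite_eq', Finset.mem_univ, if_true, Matrix.one_apply]
  have : ∑ j, x i * x j / (1 + ‖x‖ ^ 2) * (x j * x k)
      = x i * x k / (1 + ‖x‖ ^ 2) * ∑ j, x j * x j := by
    rw [Finset.mul_sum]; exact Finset.sum_congr rfl fun j _ => by ring
  rw [this, sum_coord_mul_self]
  field_simp
  ring

theorem hypMetric_inv_eq_frame (x : EuclideanSpace ℝ (Fin n)) (i j : Fin n) :
    (hypMetric n x)⁻¹ i j = ∑ a, frame x i a * frame x j a := by
  rw [hypMetric_inv, Matrix.of_apply]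
  have h1 : ∀ a, frame x i a * frame x j a = frame x a i * frame x j a := fun a => by
    rw [frame_comm x a]
  simp only [h1]
  rw [sum_frame_mul]
  have : ∑ a, ballCoord x a * frame x j a = ballFactor x * ∑ a, frame x a j * x a := by
    rw [Finset.mul_sum]
    exact Finset.sum_congr rfl fun a _ => by rw [ballCoord, frame_comm x j]; ring
  rw [this, sum_frame_mul_coord]
  simp only [frame, ballCoord, eq_comm (a := j)]
  have h3 := ballFactor_mul x
  linear_combination (- x i * x j) * h3

theorem hypMetric_det (x : EuclideanSpace ℝ (Fin n)) :
    (hypMetric n x).det = (1 + ‖x‖ ^ 2)⁻¹ := by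
  have h1 : (1 + ‖x‖ ^ 2) ≠ 0 := by positivity
  have : hypMetric n x = 1 + Matrix.replicateCol Unit (fun i => - (1 + ‖x‖ ^ 2)⁻¹ * x i) *
      Matrix.replicateRow Unit (fun i => x i) := by
    ext i j
    simp only [hypMetric, Matrix.of_apply, Matrix.add_apply, Matrix.one_apply, Matrix.mul_apply,
      Matrix.replicateCol_apply, Matrix.replicateRow_apply, Finset.univ_unique, Finset.sum_const,
      Finset.card_singleton, one_smul]
    ring
  rw [this, Matrix.det_one_add_replicateCol_mul_replicateRow]
  simp only [dotProduct]
  have : ∑ j, x j * (- (1 + ‖x‖ ^ 2)⁻¹ * x j)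
      = - (1 + ‖x‖ ^ 2)⁻¹ * ∑ j, x j * x j := by
    rw [Finset.mul_sum]; exact Finset.sum_congr rfl fun j _ => by ring
  rw [this, sum_coord_mul_self]
  field_simp
  ring

theorem hasFDerivAt_coord (i : Fin n) (x : EuclideanSpace ℝ (Fin n)) :
    HasFDerivAt (fun y : EuclideanSpace ℝ (Fin n) => y i)
      (EuclideanSpace.proj i : EuclideanSpace ℝ (Fin n) →L[ℝ] ℝ) x :=
  (EuclideanSpace.proj i : EuclideanSpace ℝ (Fin n) →L[ℝ] ℝ).hasFDerivAt

theorem pderiv_coord (i j : Fin n) (x : EuclideanSpace ℝ (Fin n)) :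
    pderiv i (fun y => y j) x = if i = j then 1 else 0 := by
  rw [pderiv, (hasFDerivAt_coord j x).fderiv]
  simp [eq_comm]

theorem pderiv_normSq (i : Fin n) (x : EuclideanSpace ℝ (Fin n)) :
    pderiv i (fun y => ‖y‖ ^ 2) x = 2 * x i := by
  rw [pderiv, (hasStrictFDerivAt_norm_sq x).hasFDerivAt.fderiv]
  simp [EuclideanSpace.inner_single_right]

section rules
variable {f g : EuclideanSpace ℝ (Fin n) → ℝ} {x : EuclideanSpace ℝ (Fin n)} (i : Fin n)

theorem pderiv_add (hf : DifferentiableAt ℝ f x) (hg : DifferentiableAt ℝ g x) :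
    pderiv i (fun y => f y + g y) x = pderiv i f x + pderiv i g x := by
  simp only [pderiv, fderiv_fun_add hf hg, add_apply]

theorem pderiv_sub (hf : DifferentiableAt ℝ f x) (hg : DifferentiableAt ℝ g x) :
    pderiv i (fun y => f y - g y) x = pderiv i f x - pderiv i g x := by
  simp only [pderiv, fderiv_fun_sub hf hg, sub_apply]

theorem pderiv_mul (hf : DifferentiableAt ℝ f x) (hg : DifferentiableAt ℝ g x) :
    pderiv i (fun y => f y * g y) x = f x * pderiv i g x + pderiv i f x * g x := by
  simp only [pderiv, fderiv_fun_mul hf hg, add_apply, smul_apply,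
    smul_eq_mul]
  ring

theorem pderiv_const (c : ℝ) : pderiv i (fun _ : EuclideanSpace ℝ (Fin n) => c) x = 0 := by
  simp [pderiv]

theorem pderiv_sum {ι : Type*} (s : Finset ι) {F : ι → EuclideanSpace ℝ (Fin n) → ℝ}
    (hF : ∀ k ∈ s, DifferentiableAt ℝ (F k) x) :
    pderiv i (fun y => ∑ k ∈ s, F k y) x = ∑ k ∈ s, pderiv i (F k) x := by
  simp only [pderiv, fderiv_fun_sum hF, sum_apply]

theorem pderiv_comp {p : ℝ → ℝ} {p' : ℝ} (hp : HasDerivAt p p' (f x))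
    (hf : DifferentiableAt ℝ f x) : pderiv i (fun y => p (f y)) x = p' * pderiv i f x := by
  have := (hp.comp_hasFDerivAt x hf.hasFDerivAt).fderiv
  rw [pderiv, pderiv]
  erw [this]
  simp

theorem frameDeriv_add (hf : DifferentiableAt ℝ f x) (hg : DifferentiableAt ℝ g x) :
    frameDeriv i (fun y => f y + g y) x = frameDeriv i f x + frameDeriv i g x := by
  simp only [frameDeriv, pderiv_add _ hf hg, mul_add, Finset.sum_add_distrib]

theorem frameDeriv_sub (hf : DifferentiableAt ℝ f x) (hg : DifferentiableAt ℝ g x) :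
    frameDeriv i (fun y => f y - g y) x = frameDeriv i f x - frameDeriv i g x := by
  simp only [frameDeriv, pderiv_sub _ hf hg, mul_sub, Finset.sum_sub_distrib]

theorem frameDeriv_mul (hf : DifferentiableAt ℝ f x) (hg : DifferentiableAt ℝ g x) :
    frameDeriv i (fun y => f y * g y) x = f x * frameDeriv i g x + frameDeriv i f x * g x := by
  simp only [frameDeriv, pderiv_mul _ hf hg, Finset.mul_sum, Finset.sum_mul,
    ← Finset.sum_add_distrib]
  exact Finset.sum_congr rfl fun _ _ => by ring

theorem frameDeriv_const (c : ℝ) : frameDeriv i (fun _ : EuclideanSpace ℝ (Fin n) => c) x = 0 := by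
  simp [frameDeriv, pderiv_const]

theorem frameDeriv_sum {ι : Type*} (s : Finset ι) {F : ι → EuclideanSpace ℝ (Fin n) → ℝ}
    (hF : ∀ k ∈ s, DifferentiableAt ℝ (F k) x) :
    frameDeriv i (fun y => ∑ k ∈ s, F k y) x = ∑ k ∈ s, frameDeriv i (F k) x := by
  simp only [frameDeriv, pderiv_sum _ s hF, Finset.mul_sum]
  exact Finset.sum_comm

theorem frameDeriv_comp {p : ℝ → ℝ} {p' : ℝ} (hp : HasDerivAt p p' (f x))
    (hf : DifferentiableAt ℝ f x) :
    frameDeriv i (fun y => p (f y)) x = p' * frameDeriv i f x := by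
  simp only [frameDeriv, pderiv_comp _ hp hf, Finset.mul_sum]
  exact Finset.sum_congr rfl fun _ _ => by ring

end rules

theorem contDiff_coord (i : Fin n) {k : WithTop ℕ∞} :
    ContDiff ℝ k (fun y : EuclideanSpace ℝ (Fin n) => y i) :=
  (EuclideanSpace.proj i : EuclideanSpace ℝ (Fin n) →L[ℝ] ℝ).contDiff

theorem contDiff_lapse {k : WithTop ℕ∞} :
    ContDiff ℝ k (fun y : EuclideanSpace ℝ (Fin n) => √(1 + ‖y‖ ^ 2)) :=
  (contDiff_const.add (contDiff_norm_sq ℝ)).sqrt fun x => by positivity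

theorem contDiff_ballFactor {k : WithTop ℕ∞} :
    ContDiff ℝ k (ballFactor : EuclideanSpace ℝ (Fin n) → ℝ) :=
  (contDiff_const.add contDiff_lapse).inv fun x => by positivity

theorem contDiff_ballCoord (a : Fin n) {k : WithTop ℕ∞} :
    ContDiff ℝ k (fun y : EuclideanSpace ℝ (Fin n) => ballCoord y a) :=
  contDiff_ballFactor.mul (contDiff_coord a)

theorem contDiff_frame (i a : Fin n) {k : WithTop ℕ∞} :
    ContDiff ℝ k (fun y : EuclideanSpace ℝ (Fin n) => frame y i a) :=
  contDiff_const.add ((contDiff_ballCoord i).mul (contDiff_coord a))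

theorem contDiff_pderiv {f : EuclideanSpace ℝ (Fin n) → ℝ} {k m : WithTop ℕ∞}
    (hf : ContDiff ℝ m f) (hk : k + 1 ≤ m) (i : Fin n) : ContDiff ℝ k (pderiv i f) :=
  (hf.fderiv_right hk).clm_apply contDiff_const

theorem contDiff_frameDeriv {f : EuclideanSpace ℝ (Fin n) → ℝ} {k m : WithTop ℕ∞}
    (hf : ContDiff ℝ m f) (hk : k + 1 ≤ m) (i : Fin n) : ContDiff ℝ k (frameDeriv i f) :=
  ContDiff.sum fun j _ => (contDiff_frame j i).mul (contDiff_pderiv hf hk j)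

theorem frameDeriv_coord (a i : Fin n) (x : EuclideanSpace ℝ (Fin n)) :
    frameDeriv a (fun y => y i) x = frame x i a := by
  simp [frameDeriv, pderiv_coord]

theorem frameDeriv_normSq (a : Fin n) (x : EuclideanSpace ℝ (Fin n)) :
    frameDeriv a (fun y => ‖y‖ ^ 2) x = 2 * (√(1 + ‖x‖ ^ 2) * x a) := by
  rw [← sum_frame_mul_coord]
  simp only [frameDeriv, pderiv_normSq, Finset.mul_sum]
  exact Finset.sum_congr rfl fun _ _ => by ring

theorem pderiv_lapse (i : Fin n) (x : EuclideanSpace ℝ (Fin n)) :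
    pderiv i (fun y => √(1 + ‖y‖ ^ 2)) x = x i / √(1 + ‖x‖ ^ 2) := by
  have hd : DifferentiableAt ℝ (fun y : EuclideanSpace ℝ (Fin n) => ‖y‖ ^ 2) x :=
    ((contDiff_norm_sq ℝ (n := 1)).differentiable one_ne_zero) x
  have h0 : √(1 + ‖x‖ ^ 2) ≠ 0 := by positivity
  have h1 : HasDerivAt (fun t => √(1 + t)) (1 / (2 * √(1 + ‖x‖ ^ 2))) (‖x‖ ^ 2) := by
    exact ((hasDerivAt_id _).const_add 1).sqrt (by positivity)
  rw [pderiv_comp i h1 hd, pderiv_normSq]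
  field_simp

theorem frameDeriv_lapse (a : Fin n) (x : EuclideanSpace ℝ (Fin n)) :
    frameDeriv a (fun y => √(1 + ‖y‖ ^ 2)) x = x a := by
  have h0 : √(1 + ‖x‖ ^ 2) ≠ 0 := by positivity
  simp only [frameDeriv, pderiv_lapse, ← mul_div_assoc]
  rw [← Finset.sum_div, sum_frame_mul_coord]
  field_simp

theorem pderiv_ballFactor (i : Fin n) (x : EuclideanSpace ℝ (Fin n)) :
    pderiv i ballFactor x = - ballFactor x ^ 2 * (x i / √(1 + ‖x‖ ^ 2)) := by
  have h1 : HasDerivAt (fun t : ℝ => (1 + t)⁻¹) (-(1 + √(1 + ‖x‖ ^ 2))⁻¹ ^ 2)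
      (√(1 + ‖x‖ ^ 2)) := by
    have h0 : (1 + id (√(1 + ‖x‖ ^ 2)) : ℝ) ≠ 0 := by rw [id]; positivity
    refine (((hasDerivAt_id (√(1 + ‖x‖ ^ 2))).const_add 1).inv h0).congr_deriv ?_
    rw [id, inv_pow, div_eq_mul_inv, neg_one_mul]
  rw [← pderiv_lapse]
  exact pderiv_comp i h1 ((contDiff_lapse (k := 1)).differentiable one_ne_zero x)

theorem frameDeriv_ballFactor (a : Fin n) (x : EuclideanSpace ℝ (Fin n)) :
    frameDeriv a ballFactor x = - ballFactor x ^ 2 * x a := by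
  rw [← frameDeriv_lapse]
  simp only [frameDeriv, pderiv_ballFactor, pderiv_lapse, Finset.mul_sum]
  exact Finset.sum_congr rfl fun _ _ => by ring

theorem frameDeriv_ballCoord (a b : Fin n) (x : EuclideanSpace ℝ (Fin n)) :
    frameDeriv a (fun y => ballCoord y b) x = if a = b then ballFactor x else 0 := by
  have := frameDeriv_mul (x := x) a ((contDiff_ballFactor (k := 1)).differentiable one_ne_zero x)
    ((contDiff_coord (k := 1) b).differentiable one_ne_zero x)
  refine this.trans ?_
  rw [frameDeriv_ballFactor, frameDeriv_coord, frame, ballCoord]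
  simp only [eq_comm (a := b)]
  split_ifs <;> ring

/-- `e_a(e_bⁱ) = y_b e_aⁱ + δ_ab y_i`: the source of both the connection coefficients and the
brackets of the frame. -/
theorem frameDeriv_frame (a i b : Fin n) (x : EuclideanSpace ℝ (Fin n)) :
    frameDeriv a (fun y => frame y i b) x =
      ballCoord x b * frame x i a + (if a = b then ballCoord x i else 0) := by
  have hd1 := (contDiff_ballCoord (k := 1) i).differentiable one_ne_zero x
  have hd2 := (contDiff_coord (k := 1) b).differentiable one_ne_zero x
  have := frameDeriv_add (x := x) a (differentiableAt_const (if i = b then (1 : ℝ) else 0))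
    (hd1.mul hd2)
  refine this.trans ?_
  rw [frameDeriv_const]
  refine (congrArg _ (frameDeriv_mul (x := x) a hd1 hd2)).trans ?_
  rw [frameDeriv_ballCoord, frameDeriv_coord]
  simp only [frame, ballCoord, eq_comm (a := b), eq_comm (a := i)]
  split_ifs <;> ring

/-! ### Connection and divergence in the frame -/

/-- The components `h(e_b, e_c)` of a `2`-tensor in the frame. -/
noncomputable def frameComp (h : Field2 n) (x : EuclideanSpace ℝ (Fin n)) (b c : Fin n) : ℝ :=
  ∑ i, ∑ j, frame x i b * (frame x j c * h x i j)

/-- The components `(∇_{e_a} h)(e_b, e_c)` of the covariant derivative in the frame. -/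
noncomputable def frameCov (h : Field2 n) (x : EuclideanSpace ℝ (Fin n)) (a b c : Fin n) : ℝ :=
  ∑ i, ∑ j, ∑ k, frame x i a * (frame x j b * (frame x k c * cov (hypMetric n) h x i j k))

theorem pderiv_hypMetric (l i j : Fin n) (x : EuclideanSpace ℝ (Fin n)) :
    pderiv l (fun y => hypMetric n y i j) x =
      -((if l = i then x j else 0) + (if l = j then x i else 0)) * (1 + ‖x‖ ^ 2)⁻¹
        + 2 * x i * x j * x l * (1 + ‖x‖ ^ 2)⁻¹ ^ 2 := by
  have hx : ∀ i : Fin n, DifferentiableAt ℝ (fun y : EuclideanSpace ℝ (Fin n) => y i) x :=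
    fun i => (contDiff_coord (k := 1) i).differentiable one_ne_zero x
  have hd : DifferentiableAt ℝ (fun y : EuclideanSpace ℝ (Fin n) => ‖y‖ ^ 2) x :=
    ((contDiff_norm_sq ℝ (n := 1)).differentiable one_ne_zero) x
  have h0 : (1 + id (‖x‖ ^ 2) : ℝ) ≠ 0 := by rw [id]; positivity
  have h1 : HasDerivAt (fun t : ℝ => (1 + t)⁻¹) (-(1 + ‖x‖ ^ 2)⁻¹ ^ 2) (‖x‖ ^ 2) := by
    refine (((hasDerivAt_id (‖x‖ ^ 2)).const_add 1).inv h0).congr_deriv ?_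
    rw [id, inv_pow, div_eq_mul_inv, neg_one_mul]
  have h2 : DifferentiableAt ℝ (fun y : EuclideanSpace ℝ (Fin n) => (1 + ‖y‖ ^ 2)⁻¹) x :=
    (hd.const_add 1).inv (by positivity)
  have h3 : pderiv l (fun y : EuclideanSpace ℝ (Fin n) => (1 + ‖y‖ ^ 2)⁻¹) x =
      -(1 + ‖x‖ ^ 2)⁻¹ ^ 2 * (2 * x l) := by
    rw [← pderiv_normSq]
    exact pderiv_comp l h1 hd
  simp only [hypMetric, Matrix.of_apply, div_eq_mul_inv]
  rw [pderiv_sub _ (differentiableAt_const _) (((hx i).fun_mul (hx j)).fun_mul h2), pderiv_const,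
    pderiv_mul _ ((hx i).fun_mul (hx j)) h2, h3, pderiv_mul _ (hx i) (hx j), pderiv_coord,
    pderiv_coord]
  split_ifs <;> ring

/-- The Christoffel symbols of the hyperbolic metric are `Γᵏᵢⱼ = -xᵏ gᵢⱼ`. -/
theorem christoffel_hypMetric (x : EuclideanSpace ℝ (Fin n)) (k i j : Fin n) :
    christoffel (hypMetric n) x k i j = - x k * hypMetric n x i j := by
  have h0 : (1 + ‖x‖ ^ 2) ≠ 0 := by positivity
  have h1 : ∀ l, pderiv i (fun y => hypMetric n y j l) x + pderiv j (fun y => hypMetric n y i l) x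
      - pderiv l (fun y => hypMetric n y i j) x =
      x l * (-2 * (1 + ‖x‖ ^ 2)⁻¹ * hypMetric n x i j) := by
    intro l
    simp only [pderiv_hypMetric]
    simp only [hypMetric, Matrix.of_apply, eq_comm (a := l), eq_comm (a := j) (b := i)]
    split_ifs <;> ring
  simp only [christoffel, h1, ← mul_assoc]
  rw [← Finset.sum_mul, ← Finset.sum_mul, ← Finset.sum_mul]
  have h2 : ∑ l, (hypMetric n x)⁻¹ k l * x l = x k * (1 + ‖x‖ ^ 2) := by
    simp only [hypMetric_inv, Matrix.of_apply, add_mul, ite_mul, one_mul, zero_mul,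
      Finset.sum_add_distrib, Finset.sum_ite_eq, Finset.mem_univ, if_true, mul_assoc,
      ← Finset.mul_sum, sum_coord_mul_self]
    ring
  rw [h2]
  field_simp

theorem cov_hypMetric (h : Field2 n) (x : EuclideanSpace ℝ (Fin n)) (i j k : Fin n) :
    cov (hypMetric n) h x i j k = pderiv i (fun y => h y j k) x
      + hypMetric n x i j * ∑ l, x l * h x l k + hypMetric n x i k * ∑ l, x l * h x j l := by
  simp only [cov, christoffel_hypMetric, Finset.mul_sum, sub_eq_add_neg, ← Finset.sum_neg_distrib]
  congr 1
  · congr 1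
    exact Finset.sum_congr rfl fun _ _ => by ring
  · exact Finset.sum_congr rfl fun _ _ => by ring

theorem pderiv_comm {f : EuclideanSpace ℝ (Fin n) → ℝ} (hf : ContDiff ℝ 2 f) (i j : Fin n)
    (x : EuclideanSpace ℝ (Fin n)) : pderiv i (pderiv j f) x = pderiv j (pderiv i f) x := by
  have hs := (hf.contDiffAt (x := x)).isSymmSndFDerivAt (by simp)
  have hd : DifferentiableAt ℝ (fderiv ℝ f) x :=
    ((hf.fderiv_right (m := 1) (by norm_num)).differentiable one_ne_zero) x
  have key : ∀ i j, pderiv i (pderiv j f) x =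
      fderiv ℝ (fderiv ℝ f) x (EuclideanSpace.single i 1) (EuclideanSpace.single j 1) := by
    intro i j
    have := fderiv_clm_apply hd (differentiableAt_const (EuclideanSpace.single j (1 : ℝ)))
    show fderiv ℝ (fun y => fderiv ℝ f y (EuclideanSpace.single j 1)) x _ = _
    rw [this]
    simp
  rw [key, key]
  exact hs _ _

/-- The bracket of the frame is `[e_a, e_b] = y_b e_a - y_a e_b`. -/
theorem frameDeriv_comm {f : EuclideanSpace ℝ (Fin n) → ℝ} (hf : ContDiff ℝ 2 f) (a b : Fin n)
    (x : EuclideanSpace ℝ (Fin n)) :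
    frameDeriv a (frameDeriv b f) x = frameDeriv b (frameDeriv a f) x
      + ballCoord x b * frameDeriv a f x - ballCoord x a * frameDeriv b f x := by
  have hp : ∀ i, DifferentiableAt ℝ (pderiv i f) x := fun i =>
    (contDiff_pderiv hf (k := 1) (by norm_num) i).differentiable one_ne_zero x
  have hS : ∀ i a, DifferentiableAt ℝ (fun y : EuclideanSpace ℝ (Fin n) => frame y i a) x :=
    fun i a => (contDiff_frame i a (k := 1)).differentiable one_ne_zero x
  have key : ∀ a b, frameDeriv a (frameDeriv b f) x =
      (∑ i, ∑ j, frame x i b * (frame x j a * pderiv j (pderiv i f) x))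
      + ballCoord x b * frameDeriv a f x
      + (if a = b then ∑ i, ballCoord x i * pderiv i f x else 0) := by
    intro a b
    have : frameDeriv b f = fun y => ∑ i, frame y i b * pderiv i f y := rfl
    rw [this, frameDeriv_sum _ _ fun i _ => (hS i b).fun_mul (hp i)]
    have h2 : ∀ i, frameDeriv a (fun y => frame y i b * pderiv i f y) x =
        (∑ j, frame x i b * (frame x j a * pderiv j (pderiv i f) x))
        + ballCoord x b * (frame x i a * pderiv i f x)
        + (if a = b then ballCoord x i * pderiv i f x else 0) := by
      intro i
      rw [frameDeriv_mul _ (hS i b) (hp i), frameDeriv_frame, ← Finset.mul_sum, ← frameDeriv]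
      split_ifs <;> ring
    simp only [h2, Finset.sum_add_distrib, ← Finset.mul_sum]
    congr 1
    split_ifs <;> simp
  have hsym : (∑ i, ∑ j, frame x i b * (frame x j a * pderiv j (pderiv i f) x)) =
      ∑ i, ∑ j, frame x i a * (frame x j b * pderiv j (pderiv i f) x) := by
    rw [Finset.sum_comm]
    refine Finset.sum_congr rfl fun i _ => Finset.sum_congr rfl fun j _ => ?_
    rw [pderiv_comm hf]; ring
  rw [key a b, key b a, hsym]
  simp only [eq_comm (a := b) (b := a)]
  ring

theorem contDiff_frameComp {h : Field2 n} {k : WithTop ℕ∞}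
    (hh : ∀ i j, ContDiff ℝ k fun x => h x i j) (b c : Fin n) :
    ContDiff ℝ k (fun x => frameComp h x b c) :=
  ContDiff.sum fun i _ => ContDiff.sum fun j _ =>
    (contDiff_frame i b).mul ((contDiff_frame j c).mul (hh i j))

theorem frameComp_symm {h : Field2 n} (hs : ∀ x i j, h x i j = h x j i)
    (x : EuclideanSpace ℝ (Fin n)) (b c : Fin n) : frameComp h x b c = frameComp h x c b := by
  rw [frameComp, frameComp, Finset.sum_comm]
  refine Finset.sum_congr rfl fun i _ => Finset.sum_congr rfl fun j _ => ?_
  rw [hs x j i]; ring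

theorem sum_ballCoord_mul_frame (x : EuclideanSpace ℝ (Fin n)) (i : Fin n) :
    ∑ d, ballCoord x d * frame x i d = √(1 + ‖x‖ ^ 2) * ballCoord x i := by
  have : ∑ d, ballCoord x d * frame x i d = ballFactor x * ∑ d, frame x d i * x d := by
    rw [Finset.mul_sum]
    exact Finset.sum_congr rfl fun d _ => by rw [ballCoord, frame_comm]; ring
  rw [this, sum_frame_mul_coord, ballCoord]; ring

/-- Contraction of a tensor with the radial field, in the frame. -/
theorem sum_ballCoord_mul_frameComp (h : Field2 n) (x : EuclideanSpace ℝ (Fin n)) (c : Fin n) :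
    ∑ d, ballCoord x d * frameComp h x d c =
      √(1 + ‖x‖ ^ 2) * ∑ i, ∑ j, ballCoord x i * (frame x j c * h x i j) := by
  have h1 : ∀ d, ballCoord x d * frameComp h x d c =
      ∑ i, (ballCoord x d * frame x i d) * ∑ j, frame x j c * h x i j := by
    intro d
    simp only [frameComp, Finset.mul_sum]
    exact Finset.sum_congr rfl fun _ _ => Finset.sum_congr rfl fun _ _ => by ring
  simp only [h1]
  rw [Finset.sum_comm]
  simp only [← Finset.sum_mul, sum_ballCoord_mul_frame]
  simp only [Finset.mul_sum, mul_assoc]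

/-- The frame components of `∇h`: the connection coefficients of the frame are
`∇_{e_a} e_b = y_b e_a - δ_ab y_c e_c`. -/
theorem frameDeriv_frameComp {h : Field2 n} (hs : ∀ x i j, h x i j = h x j i)
    (hh : ∀ i j, ContDiff ℝ 2 fun x => h x i j)
    (x : EuclideanSpace ℝ (Fin n)) (a b c : Fin n) :
    frameDeriv a (fun y => frameComp h y b c) x = frameCov h x a b c
      + ballCoord x b * frameComp h x a c + ballCoord x c * frameComp h x a b
      - (if a = b then ∑ d, ballCoord x d * frameComp h x d c else 0)
      - (if a = c then ∑ d, ballCoord x d * frameComp h x d b else 0) := by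
  have hS : ∀ i a, DifferentiableAt ℝ (fun y : EuclideanSpace ℝ (Fin n) => frame y i a) x :=
    fun i a => (contDiff_frame i a (k := 1)).differentiable one_ne_zero x
  have hD : ∀ i j, DifferentiableAt ℝ (fun y => h y i j) x :=
    fun i j => (hh i j).differentiable two_ne_zero x
  set p : Fin n → ℝ := fun c => ∑ i, ∑ j, ballCoord x i * (frame x j c * h x i j) with hp
  set A : ℝ := ∑ i, ∑ j, frame x i b * (frame x j c * frameDeriv a (fun y => h y i j) x) with hA
  have hpx : ∀ c, ∑ j, frame x j c * ∑ l, x l * h x l j = (1 + √(1 + ‖x‖ ^ 2)) * p c := by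
    intro c
    simp only [hp, Finset.mul_sum]
    rw [Finset.sum_comm]
    refine Finset.sum_congr rfl fun i _ => Finset.sum_congr rfl fun j _ => ?_
    rw [ballCoord]
    linear_combination (- x i * frame x j c * h x i j) * ballFactor_mul x
  have h1 : frameDeriv a (fun y => frameComp h y b c) x = A
      + ballCoord x b * frameComp h x a c + ballCoord x c * frameComp h x a b
      + (if a = b then p c else 0) + (if a = c then p b else 0) := by
    have e1 : frameDeriv a (fun y => frameComp h y b c) x = ∑ i, ∑ j,
        frameDeriv a (fun y => frame y i b * (frame y j c * h y i j)) x := by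
      simp only [frameComp]
      rw [frameDeriv_sum _ _ fun i _ => DifferentiableAt.fun_sum fun j _ =>
        (hS i b).fun_mul ((hS j c).fun_mul (hD i j))]
      exact Finset.sum_congr rfl fun i _ => frameDeriv_sum _ _ fun j _ =>
        (hS i b).fun_mul ((hS j c).fun_mul (hD i j))
    have e2 : ∀ i j, frameDeriv a (fun y => frame y i b * (frame y j c * h y i j)) x =
        frame x i b * (frame x j c * frameDeriv a (fun y => h y i j) x)
        + ballCoord x b * (frame x i a * (frame x j c * h x i j))
        + ballCoord x c * (frame x j a * (frame x i b * h x j i))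
        + (if a = b then 1 else 0) * (ballCoord x i * (frame x j c * h x i j))
        + (if a = c then 1 else 0) * (ballCoord x j * (frame x i b * h x j i)) := by
      intro i j
      rw [frameDeriv_mul _ (hS i b) ((hS j c).fun_mul (hD i j)), frameDeriv_mul _ (hS j c) (hD i j),
        frameDeriv_frame, frameDeriv_frame, hs x j i]
      split_ifs <;> ring
    have e3 : ∑ i, ∑ j, ballCoord x j * (frame x i b * h x j i) = p b := by
      rw [Finset.sum_comm]
    have e4 : ∑ i, ∑ j, frame x j a * (frame x i b * h x j i) = frameComp h x a b := by
      rw [Finset.sum_comm]; rfl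
    rw [e1]
    have pull : ∀ (t : ℝ) (f : Fin n → Fin n → ℝ),
        ∑ i, ∑ j, t * f i j = t * ∑ i, ∑ j, f i j := fun t f => by
      simp only [Finset.mul_sum]
    simp only [e2, Finset.sum_add_distrib]
    rw [pull, pull, pull, pull, e3, e4]
    simp only [ite_mul, one_mul, zero_mul, hA, hp, frameComp]
  have h2 : frameCov h x a b c = A
      + (if a = b then (1 + √(1 + ‖x‖ ^ 2)) * p c else 0)
      + (if a = c then (1 + √(1 + ‖x‖ ^ 2)) * p b else 0) := by
    have e2 : ∀ i j k, frame x i a * (frame x j b * (frame x k c *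
          cov (hypMetric n) h x i j k)) =
        frame x j b * (frame x k c * (frame x i a * pderiv i (fun y => h y j k) x))
        + (hypMetric n x i j * (frame x i a * frame x j b)) *
          (frame x k c * ∑ l, x l * h x l k)
        + (hypMetric n x i k * (frame x i a * frame x k c)) *
          (frame x j b * ∑ l, x l * h x l j) := by
      intro i j k
      rw [cov_hypMetric]
      have : ∑ l, x l * h x j l = ∑ l, x l * h x l j :=
        Finset.sum_congr rfl fun l _ => by rw [hs x j l]
      rw [this]; ring
    simp only [frameCov, e2, Finset.sum_add_distrib]
    congr 1
    · congr 1
      · rw [hA, Finset.sum_comm]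
        refine Finset.sum_congr rfl fun j _ => ?_
        rw [Finset.sum_comm]
        refine Finset.sum_congr rfl fun k _ => ?_
        rw [← Finset.mul_sum, ← Finset.mul_sum, ← frameDeriv]
      · simp only [← Finset.mul_sum, ← Finset.sum_mul]
        rw [frame_orthonormal, hpx]
        split_ifs <;> ring
    · simp only [← Finset.mul_sum, ← Finset.sum_mul]
      rw [frame_orthonormal, hpx]
      split_ifs <;> ring
  rw [h1, h2, sum_ballCoord_mul_frameComp, sum_ballCoord_mul_frameComp]
  simp only [hp]
  split_ifs <;> ring

theorem pderiv_frame (j i a : Fin n) (x : EuclideanSpace ℝ (Fin n)) :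
    pderiv j (fun y => frame y i a) x =
      - ballFactor x ^ 2 * (x j / √(1 + ‖x‖ ^ 2)) * x i * x a
      + (if j = i then ballCoord x a else 0) + (if j = a then ballCoord x i else 0) := by
  have hx : ∀ i : Fin n, DifferentiableAt ℝ (fun y : EuclideanSpace ℝ (Fin n) => y i) x :=
    fun i => (contDiff_coord (k := 1) i).differentiable one_ne_zero x
  have hf : DifferentiableAt ℝ (ballFactor : EuclideanSpace ℝ (Fin n) → ℝ) x :=
    (contDiff_ballFactor (k := 1)).differentiable one_ne_zero x
  simp only [frame, ballCoord]
  rw [pderiv_add _ (differentiableAt_const _) ((hf.fun_mul (hx i)).fun_mul (hx a)), pderiv_const,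
    pderiv_mul _ (hf.fun_mul (hx i)) (hx a), pderiv_mul _ hf (hx i), pderiv_ballFactor,
    pderiv_coord, pderiv_coord]
  split_ifs <;> ring

/-- The frame fields have divergence `div e_a = (n - 1) y_a`. -/
theorem sum_frame_div (x : EuclideanSpace ℝ (Fin n)) (a : Fin n) :
    ∑ j, pderiv j (fun y => frame y j a) x
      - ∑ j, ∑ k, x j * hypMetric n x j k * frame x k a = ((n : ℝ) - 1) * ballCoord x a := by
  have h0 : √(1 + ‖x‖ ^ 2) ≠ 0 := by positivity
  have e1 : ∑ j, pderiv j (fun y => frame y j a) x =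
      (- ballFactor x ^ 2 * (√(1 + ‖x‖ ^ 2))⁻¹ * x a) * ‖x‖ ^ 2 + n * ballCoord x a
        + ballCoord x a := by
    simp only [pderiv_frame, Finset.sum_add_distrib, if_true, Finset.sum_const, Finset.card_univ,
      Fintype.card_fin, nsmul_eq_mul, Finset.sum_ite_eq', Finset.mem_univ]
    congr 2
    rw [← sum_coord_mul_self, Finset.mul_sum]
    exact Finset.sum_congr rfl fun j _ => by ring
  have e2 : ∑ j, ∑ k, x j * hypMetric n x j k * frame x k a =
      x a * (1 + ‖x‖ ^ 2 * (ballFactor x - (√(1 + ‖x‖ ^ 2))⁻¹)) := by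
    simp only [mul_assoc, ← Finset.mul_sum, hypMetric_mulVec_frame, mul_add, mul_ite, mul_one,
      mul_zero, Finset.sum_add_distrib, Finset.sum_ite_eq', Finset.mem_univ, if_true]
    rw [← sum_coord_mul_self, Finset.sum_mul, Finset.mul_sum]
    congr 1
    exact Finset.sum_congr rfl fun j _ => by ring
  rw [e1, e2, ballCoord]
  have h1 := ballFactor_mul x
  have h2 := ballFactor_mul_normSq x
  have h3 := sq_lapse x
  generalize √(1 + ‖x‖ ^ 2) = t at *
  have h4 : ‖x‖ ^ 2 = t ^ 2 - 1 := by linarith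
  rw [h4] at h2 ⊢
  field_simp
  linear_combination x a * (h1 - (ballFactor x + t) * h2)

/-- Divergence of a vector field given by its frame components. -/
noncomputable def frameDiv (Z : EuclideanSpace ℝ (Fin n) → Fin n → ℝ)
    (x : EuclideanSpace ℝ (Fin n)) : ℝ :=
  ∑ a, (frameDeriv a (fun y => Z y a) x + ((n : ℝ) - 1) * ballCoord x a * Z x a)

theorem vecDiv_eq_frameDiv {Z : EuclideanSpace ℝ (Fin n) → Fin n → ℝ}
    {x : EuclideanSpace ℝ (Fin n)} (hZ : ∀ a, DifferentiableAt ℝ (fun y => Z y a) x) :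
    vecDiv (hypMetric n) (fun y j => ∑ a, frame y j a * Z y a) x = frameDiv Z x := by
  have hS : ∀ i a, DifferentiableAt ℝ (fun y : EuclideanSpace ℝ (Fin n) => frame y i a) x :=
    fun i a => (contDiff_frame i a (k := 1)).differentiable one_ne_zero x
  have e1 : ∀ j, pderiv j (fun y => ∑ a, frame y j a * Z y a) x =
      ∑ a, (frame x j a * pderiv j (fun y => Z y a) x
        + pderiv j (fun y => frame y j a) x * Z x a) := fun j => by
    rw [pderiv_sum _ _ fun a _ => (hS j a).fun_mul (hZ a)]
    exact Finset.sum_congr rfl fun a _ => pderiv_mul _ (hS j a) (hZ a)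
  have e2 : ∀ j, ∑ k, christoffel (hypMetric n) x j j k * ∑ a, frame x k a * Z x a =
      - ∑ a, (∑ k, x j * hypMetric n x j k * frame x k a) * Z x a := by
    intro j
    simp only [christoffel_hypMetric, Finset.mul_sum, Finset.sum_mul]
    rw [Finset.sum_comm, ← Finset.sum_neg_distrib]
    refine Finset.sum_congr rfl fun a _ => ?_
    rw [← Finset.sum_neg_distrib]
    exact Finset.sum_congr rfl fun k _ => by ring
  simp only [vecDiv, e1, e2, ← sub_eq_add_neg, ← Finset.sum_sub_distrib]
  rw [Finset.sum_comm]
  refine Finset.sum_congr rfl fun a _ => ?_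
  rw [← sum_frame_div x a]
  simp only [frameDeriv, Finset.sum_sub_distrib, Finset.sum_add_distrib, sub_mul, Finset.sum_mul]
  ring

/-! ### Algebra of index sums -/

section sums
variable {ι : Type*} [Fintype ι]

theorem sum3_rotate (F : ι → ι → ι → ℝ) :
    ∑ a, ∑ b, ∑ c, F c a b = ∑ a, ∑ b, ∑ c, F a b c := by
  have : ∀ a, ∑ b, ∑ c, F c a b = ∑ c, ∑ b, F c a b := fun a => Finset.sum_comm
  simp only [this]
  exact Finset.sum_comm

theorem sum3_swap_left (F : ι → ι → ι → ℝ) :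
    ∑ a, ∑ b, ∑ c, F b a c = ∑ a, ∑ b, ∑ c, F a b c := Finset.sum_comm

theorem sum3_swap_right (F : ι → ι → ι → ℝ) :
    ∑ a, ∑ b, ∑ c, F a c b = ∑ a, ∑ b, ∑ c, F a b c :=
  Finset.sum_congr rfl fun _ _ => Finset.sum_comm

variable [DecidableEq ι]

theorem sum3_ite_left (F : ι → ι → ι → ℝ) :
    ∑ a, ∑ b, ∑ c, (if a = b then F a b c else 0) = ∑ a, ∑ c, F a a c := by
  rw [← sum3_swap_right]
  simp

theorem sum3_ite_outer (F : ι → ι → ι → ℝ) :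
    ∑ a, ∑ b, ∑ c, (if a = c then F a b c else 0) = ∑ a, ∑ b, F a b a := by simp

theorem sum3_ite_right (F : ι → ι → ι → ℝ) :
    ∑ a, ∑ b, ∑ c, (if b = c then F a b c else 0) = ∑ a, ∑ b, F a b b := by simp

/-- The contraction `∑ N_abc N_bac`, where `N` consists of the derivatives `D_abc = e_a h_bc` and of
the connection terms built from `y` and `h`, and `η = h(y, ·)`. -/
theorem sum_mul_swap_eq {y η : ι → ℝ} {h : ι → ι → ℝ} {D N : ι → ι → ι → ℝ}
    (hs : ∀ a b, h a b = h b a) (ht : ∑ a, h a a = 0)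
    (hDs : ∀ a b c, D a b c = D a c b) (hDt : ∀ a, ∑ b, D a b b = 0)
    (hη : ∀ c, ∑ d, y d * h d c = η c)
    (hN : ∀ a b c, N a b c = D a b c - y b * h a c - y c * h a b
      + (if a = b then η c else 0) + (if a = c then η b else 0)) :
    ∑ a, ∑ b, ∑ c, N a b c * N b a c =
      ∑ a, ∑ b, ∑ c, D a b c * D b a c
      + 2 * ∑ c, η c * ∑ b, D b b c
      - 2 * ∑ a, ∑ b, ∑ c, y a * (h b c * D b a c)
      - 2 * ∑ a, ∑ b, ∑ c, y a * (h b c * D a b c)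
      + Fintype.card ι * ∑ c, η c * η c
      + (∑ a, y a * y a) * ∑ b, ∑ c, h b c * h b c := by
  set E := ∑ c, η c * η c with hE
  have hη' : ∀ c, ∑ d, y d * h c d = η c := fun c => by
    rw [← hη c]; exact Finset.sum_congr rfl fun d _ => by rw [hs]
  -- the terms linear in `D`
  have L1 : ∑ a, ∑ b, ∑ c, D a b c * (y a * h b c) = ∑ a, ∑ b, ∑ c, y a * (h b c * D a b c) := by
    simp only [mul_comm, mul_left_comm]
  have L2 : ∑ a, ∑ b, ∑ c, D a b c * (y c * h b a) = ∑ a, ∑ b, ∑ c, y a * (h b c * D b a c) := by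
    rw [← sum3_rotate fun a b c => y a * (h b c * D b a c)]
    refine Finset.sum_congr rfl fun a _ => Finset.sum_congr rfl fun b _ =>
      Finset.sum_congr rfl fun c _ => ?_
    rw [hDs a b c, hs b a]; ring
  have L3 : ∑ a, ∑ b, ∑ c, D a b c * (if a = b then η c else 0) = ∑ c, η c * ∑ b, D b b c := by
    simp only [mul_ite, mul_zero, Finset.mul_sum]
    rw [sum3_ite_left fun a b c => D a b c * η c, Finset.sum_comm]
    simp only [mul_comm]
  have L4 : ∑ a, ∑ b, ∑ c, D a b c * (if b = c then η a else 0) = 0 := by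
    simp only [mul_ite, mul_zero, Finset.sum_ite_eq, Finset.mem_univ, if_true, ← Finset.sum_mul,
      hDt, zero_mul, Finset.sum_const_zero]
  have hL : ∑ a, ∑ b, ∑ c, D a b c * (N b a c - D b a c) =
      - ∑ a, ∑ b, ∑ c, y a * (h b c * D a b c) - ∑ a, ∑ b, ∑ c, y a * (h b c * D b a c)
      + ∑ c, η c * ∑ b, D b b c := by
    have : ∀ a b c, D a b c * (N b a c - D b a c) = - (D a b c * (y a * h b c))
        - D a b c * (y c * h b a) + D a b c * (if a = b then η c else 0)
        + D a b c * (if b = c then η a else 0) := fun a b c => by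
      rw [hN]; simp only [eq_comm (a := b) (b := a)]; ring
    simp only [this, Finset.sum_add_distrib, Finset.sum_sub_distrib, Finset.sum_neg_distrib,
      L1, L2, L3, L4]
    ring
  have hL' : ∑ a, ∑ b, ∑ c, (N a b c - D a b c) * D b a c =
      ∑ a, ∑ b, ∑ c, D a b c * (N b a c - D b a c) := by
    rw [← sum3_swap_left]
    simp only [mul_comm]
  -- the terms quadratic in the connection
  have Q1 : ∑ a, ∑ b, ∑ c, y b * h a c * (y a * h b c) = E := by
    simp only [hE, ← hη, Finset.sum_mul_sum]
    rw [← sum3_rotate fun a b c => y b * h b a * (y c * h c a)]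
    refine Finset.sum_congr rfl fun a _ => Finset.sum_congr rfl fun b _ =>
      Finset.sum_congr rfl fun c _ => ?_
    ring
  have Q2 : ∑ a, ∑ b, ∑ c, y b * h a c * (y c * h a b) = E := by
    simp only [hE, ← hη', Finset.sum_mul_sum]
    refine Finset.sum_congr rfl fun a _ => Finset.sum_congr rfl fun b _ =>
      Finset.sum_congr rfl fun c _ => ?_
    ring
  have Q3 : ∑ a, ∑ b, ∑ c, y c * h a b * (y a * h b c) = E := by
    rw [← Q2, ← sum3_swap_left]
    refine Finset.sum_congr rfl fun a _ => Finset.sum_congr rfl fun b _ =>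
      Finset.sum_congr rfl fun c _ => ?_
    rw [hs b a]; ring
  have Q4 : ∑ a, ∑ b, ∑ c, y c * h a b * (y c * h a b) =
      (∑ a, y a * y a) * ∑ b, ∑ c, h b c * h b c := by
    simp only [Finset.sum_mul, Finset.mul_sum]
    refine Finset.sum_congr rfl fun a _ => Finset.sum_congr rfl fun b _ =>
      Finset.sum_congr rfl fun c _ => ?_
    ring
  have R1 : ∑ a, ∑ c, y a * h a c * η c = E := by
    rw [Finset.sum_comm]
    simp only [← Finset.sum_mul, hη, hE]
  have R2 : ∑ a, ∑ c, y c * h a a * η c = 0 := by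
    rw [Finset.sum_comm]
    simp only [← Finset.sum_mul, ← Finset.mul_sum, ht, mul_zero, zero_mul, Finset.sum_const_zero]
  have R3 : ∑ a, ∑ b, y b * h a b * η a = E := by
    simp only [← Finset.sum_mul, hη', hE]
  have hB : ∀ a b c, (N a b c - D a b c) * (N b a c - D b a c) =
      y b * h a c * (y a * h b c) + y b * h a c * (y c * h a b) + y c * h a b * (y a * h b c)
      + y c * h a b * (y c * h a b)
      + (if a = b then -2 * (y a * h a c * η c) - 2 * (y c * h a a * η c) + η c * η c else 0)
      + (if b = c then -2 * (y b * h a b * η a) else 0)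
      + (if a = c then -2 * (y a * h a b * η b) else 0)
      + (if a = b then (if a = c then 3 * (η a * η a) else 0) else 0) := by
    intro a b c
    rw [hN, hN, hs b a]
    by_cases hab : a = b
    · subst hab
      by_cases hac : a = c
      · subst hac; simp only [if_true]; ring
      · simp only [hac, if_true, if_false]; ring
    · have hba : ¬ b = a := fun h => hab h.symm
      by_cases hac : a = c
      · subst hac; simp only [hab, hba, if_true, if_false]; rw [hs b a]; ring
      · by_cases hbc : b = c
        · subst hbc; simp only [hab, hba, if_true, if_false]; ring
        · simp only [hab, hba, hac, hbc, if_false]; ring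
  have hQ : ∑ a, ∑ b, ∑ c, (N a b c - D a b c) * (N b a c - D b a c) =
      Fintype.card ι * E + (∑ a, y a * y a) * ∑ b, ∑ c, h b c * h b c := by
    simp only [hB, Finset.sum_add_distrib, Q1, Q2, Q3, Q4]
    rw [sum3_ite_left fun a b c => -2 * (y a * h a c * η c) - 2 * (y c * h a a * η c) + η c * η c,
      sum3_ite_right fun a b c => -2 * (y b * h a b * η a),
      sum3_ite_outer fun a b c => -2 * (y a * h a b * η b),
      sum3_ite_left fun a b c => if a = c then 3 * (η a * η a) else 0]
    simp only [Finset.sum_add_distrib, Finset.sum_sub_distrib, ← Finset.mul_sum, R1, R2, R3,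
      Finset.sum_ite_eq, Finset.mem_univ, if_true, Finset.sum_const, Finset.card_univ,
      nsmul_eq_mul, ← hE]
    ring
  have hfin : ∀ a b c, N a b c * N b a c = D a b c * D b a c + D a b c * (N b a c - D b a c)
      + (N a b c - D a b c) * D b a c + (N a b c - D a b c) * (N b a c - D b a c) :=
    fun a b c => by ring
  simp only [hfin, Finset.sum_add_distrib, hL', hL, hQ]
  ring

/-- Trace of `N` over its first two indices. -/
theorem sum_contract_eq {y η : ι → ℝ} {h : ι → ι → ℝ} {D N : ι → ι → ι → ℝ}
    (ht : ∑ a, h a a = 0) (hη : ∀ c, ∑ d, y d * h d c = η c)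
    (hN : ∀ a b c, N a b c = D a b c - y b * h a c - y c * h a b
      + (if a = b then η c else 0) + (if a = c then η b else 0)) (c : ι) :
    ∑ b, N b b c = ∑ b, D b b c + Fintype.card ι * η c := by
  simp only [hN, Finset.sum_add_distrib, Finset.sum_sub_distrib, ← Finset.mul_sum, ht, hη, if_true,
    Finset.sum_const, Finset.card_univ, nsmul_eq_mul, Finset.sum_ite_eq', Finset.mem_univ]
  ring

/-- In `h_bc N_bac - h_ac N_bbc` most of the connection terms cancel. -/
theorem sum_flux_eq {y η : ι → ℝ} {h : ι → ι → ℝ} {D N : ι → ι → ι → ℝ}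
    (hs : ∀ a b, h a b = h b a) (ht : ∑ a, h a a = 0) (hη : ∀ c, ∑ d, y d * h d c = η c)
    (hN : ∀ a b c, N a b c = D a b c - y b * h a c - y c * h a b
      + (if a = b then η c else 0) + (if a = c then η b else 0)) (a : ι) :
    ∑ b, ∑ c, (h b c * N b a c - h a c * N b b c) =
      ∑ b, ∑ c, (h b c * D b a c - h a c * D b b c) - y a * ∑ b, ∑ c, h b c * h b c
      - Fintype.card ι * ∑ c, h a c * η c := by
  have hη' : ∀ c, ∑ d, h c d * y d = η c := fun c => by
    rw [← hη c]; exact Finset.sum_congr rfl fun d _ => by rw [hs, mul_comm]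
  have e1 : ∀ F : ι → ι → ι → ℝ, ∑ b, ∑ c, h a c * F b b c = ∑ c, h a c * ∑ b, F b b c := by
    intro F
    rw [Finset.sum_comm]
    simp only [Finset.mul_sum]
  have e2 : ∑ b, ∑ c, h b c * N b a c = ∑ b, ∑ c, h b c * D b a c
      - y a * ∑ b, ∑ c, h b c * h b c := by
    have : ∀ b c, h b c * N b a c = h b c * D b a c - y a * (h b c * h b c)
        - h b c * y c * h a b + (if b = a then h b c * η c else 0)
        + (if b = c then h b c * η a else 0) := fun b c => by
      rw [hN, hs b a]; split_ifs <;> ring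
    have e3 : ∑ b, ∑ c, (if b = a then h b c * η c else 0) = ∑ c, h a c * η c := by
      rw [Finset.sum_comm]; simp
    simp only [this, Finset.sum_add_distrib, Finset.sum_sub_distrib, ← Finset.mul_sum, e3,
      ← Finset.sum_mul, hη', Finset.sum_ite_eq, Finset.mem_univ, if_true, ht]
    simp only [mul_comm (η _)]
    ring
  simp only [Finset.sum_sub_distrib, e1, e2, sum_contract_eq ht hη hN, mul_add,
    Finset.sum_add_distrib, Finset.mul_sum]
  simp only [← Finset.mul_sum, mul_left_comm (h a _)]
  ring

/-- The algebra behind the Bochner formula. Here `D` and `DD` stand for the first and second frame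
derivatives of `h`, `φ` for the factor in `e_a y_b = φ δ_ab`, and the first bracket in the sum over
`a` is the derivative `e_a U_a` of the field `U`. The hypothesis `hDD` is the bracket relation of
the frame; it is the only place where second derivatives matter. -/
theorem sum_bochner_eq {y η U : ι → ℝ} {φ : ℝ} {h : ι → ι → ℝ} {D N : ι → ι → ι → ℝ}
    {DD : ι → ι → ι → ι → ℝ}
    (hs : ∀ a b, h a b = h b a) (ht : ∑ a, h a a = 0)
    (hDs : ∀ a b c, D a b c = D a c b) (hDt : ∀ a, ∑ b, D a b b = 0)
    (hη : ∀ c, ∑ d, y d * h d c = η c)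
    (hN : ∀ a b c, N a b c = D a b c - y b * h a c - y c * h a b
      + (if a = b then η c else 0) + (if a = c then η b else 0))
    (hDD : ∀ a b c d, DD a b c d = DD b a c d + y b * D a c d - y a * D b c d)
    (hy : ∑ a, y a * y a = 1 - 2 * φ)
    (hU : ∀ a, U a = ∑ b, ∑ c, (h b c * D b a c - h a c * D b b c)
      - y a * ∑ b, ∑ c, h b c * h b c - Fintype.card ι * ∑ c, h a c * η c) :
    ∑ a, ((∑ b, ∑ c, ((h b c * DD a b a c + D a b c * D b a c)
          - (h a c * DD a b b c + D a a c * D b b c))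
        - (y a * ∑ b, ∑ c, (h b c * D a b c + D a b c * h b c) + φ * ∑ b, ∑ c, h b c * h b c)
        - Fintype.card ι * ∑ c, (h a c * (∑ d, y d * D a d c + φ * h a c) + D a a c * η c))
      + ((Fintype.card ι : ℝ) - 1) * y a * U a) =
    ∑ a, ∑ b, ∑ c, N a b c * N b a c - ∑ c, (∑ b, N b b c) * ∑ b, N b b c
      - Fintype.card ι * ∑ b, ∑ c, h b c * h b c := by
  set m := ∑ b, ∑ c, h b c * h b c with hm
  set E := ∑ c, η c * η c with hE
  set s1 := ∑ c, η c * ∑ b, D b b c with hs1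
  set s2 := ∑ a, ∑ b, ∑ c, y a * (h b c * D b a c) with hs2
  set s3 := ∑ a, ∑ b, ∑ c, y a * (h b c * D a b c) with hs3
  set q1 := ∑ a, ∑ b, ∑ c, D a b c * D b a c with hq1
  set q2 := ∑ c, (∑ b, D b b c) * ∑ b, D b b c with hq2
  have hη' : ∀ c, ∑ d, y d * h c d = η c := fun c => by
    rw [← hη c]; exact Finset.sum_congr rfl fun d _ => by rw [hs]
  have hT := sum_mul_swap_eq hs ht hDs hDt hη hN
  have hdiv : ∑ c, (∑ b, N b b c) * ∑ b, N b b c =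
      q2 + 2 * Fintype.card ι * s1 + Fintype.card ι ^ 2 * E := by
    simp only [sum_contract_eq ht hη hN, hq2, hs1, hE]
    rw [Finset.mul_sum, Finset.mul_sum, ← Finset.sum_add_distrib, ← Finset.sum_add_distrib]
    exact Finset.sum_congr rfl fun c _ => by ring
  -- after exchanging `a` and `b` in the second term only a commutator of derivatives is left
  have hcomm : ∑ a, ∑ b, ∑ c, (h b c * DD a b a c - h a c * DD a b b c) = s1 - s2 := by
    have e1 : ∑ a, ∑ b, ∑ c, h a c * DD a b b c = ∑ a, ∑ b, ∑ c, h b c * DD b a a c :=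
      (sum3_swap_left fun a b c => h a c * DD a b b c).symm
    have e2 : ∀ a b c, h b c * DD a b a c = h b c * DD b a a c + y b * h b c * D a a c
        - y a * (h b c * D b a c) := fun a b c => by rw [hDD]; ring
    have e3 : ∑ a, ∑ b, ∑ c, y b * h b c * D a a c = s1 := by
      rw [hs1]
      simp only [Finset.mul_sum, ← hη, Finset.sum_mul]
      rw [← sum3_rotate fun a b c => y c * h c a * D b b a]
    simp only [Finset.sum_sub_distrib, e1, e2, Finset.sum_add_distrib, e3, ← hs2]
    ring
  have hq2' : ∑ a, ∑ b, ∑ c, D a a c * D b b c = q2 := by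
    simp only [hq2, Finset.sum_mul_sum]
    rw [← sum3_rotate fun c a b => D a a c * D b b c]
  have h5 : ∑ a, ∑ c, h a c * ∑ d, y d * D a d c = s2 := by
    rw [hs2, ← sum3_swap_left]
    simp only [Finset.mul_sum]
    rw [← sum3_swap_right]
    simp only [mul_left_comm]
  have h6 : ∑ a, ∑ c, D a a c * η c = s1 := by
    rw [Finset.sum_comm, hs1]
    simp only [← Finset.sum_mul, mul_comm (η _)]
  have h7 : ∑ a, ∑ b, ∑ c, y a * (h b c * D b a c - h a c * D b b c) = s2 - s1 := by
    have e3 : ∑ a, ∑ b, ∑ c, y a * (h a c * D b b c) = s1 := by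
      rw [hs1]
      simp only [Finset.mul_sum, ← hη, Finset.sum_mul]
      rw [← sum3_rotate fun a b c => y c * h c a * D b b a, ← sum3_swap_left]
      simp only [mul_assoc]
    simp only [mul_sub, Finset.sum_sub_distrib, e3, ← hs2]
  have h8 : ∑ a, y a * ∑ c, h a c * η c = E := by
    simp only [hE, Finset.mul_sum]
    rw [Finset.sum_comm]
    simp only [← mul_assoc, ← Finset.sum_mul, hη]
  have h9 : ∑ a, y a * U a = s2 - s1 - (1 - 2 * φ) * m - Fintype.card ι * E := by
    have : ∀ a, y a * U a = ∑ b, ∑ c, y a * (h b c * D b a c - h a c * D b b c)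
        - (y a * y a) * m - Fintype.card ι * (y a * ∑ c, h a c * η c) := fun a => by
      rw [hU]; simp only [← Finset.mul_sum]; ring
    rw [Finset.sum_congr rfl fun a _ => this a, Finset.sum_sub_distrib, Finset.sum_sub_distrib,
      ← Finset.sum_mul, ← Finset.mul_sum, h7, h8, hy]
  have hsum : ∀ a, ((∑ b, ∑ c, ((h b c * DD a b a c + D a b c * D b a c)
          - (h a c * DD a b b c + D a a c * D b b c))
        - (y a * ∑ b, ∑ c, (h b c * D a b c + D a b c * h b c) + φ * m)
        - Fintype.card ι * ∑ c, (h a c * (∑ d, y d * D a d c + φ * h a c) + D a a c * η c))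
      + ((Fintype.card ι : ℝ) - 1) * y a * U a) =
      ∑ b, ∑ c, (h b c * DD a b a c - h a c * DD a b b c) + ∑ b, ∑ c, D a b c * D b a c
      - ∑ b, ∑ c, D a a c * D b b c - 2 * ∑ b, ∑ c, y a * (h b c * D a b c) - φ * m
      - Fintype.card ι * (∑ c, h a c * ∑ d, y d * D a d c + φ * ∑ c, h a c * h a c
        + ∑ c, D a a c * η c)
      + ((Fintype.card ι : ℝ) - 1) * (y a * U a) := by
    intro a
    have e1 : ∀ b c, (h b c * DD a b a c + D a b c * D b a c)
          - (h a c * DD a b b c + D a a c * D b b c) =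
        (h b c * DD a b a c - h a c * DD a b b c) + D a b c * D b a c - D a a c * D b b c :=
      fun b c => by ring
    have e2 : ∀ b c, h b c * D a b c + D a b c * h b c = 2 * (h b c * D a b c) :=
      fun b c => by ring
    have e3 : ∀ c, h a c * (∑ d, y d * D a d c + φ * h a c) + D a a c * η c =
        h a c * ∑ d, y d * D a d c + φ * (h a c * h a c) + D a a c * η c := fun c => by ring
    simp only [e1, e2, e3, Finset.sum_add_distrib, Finset.sum_sub_distrib (f := fun _ => _ + _),
      ← Finset.mul_sum]
    ring
  have split : ∀ (f₁ f₂ f₃ f₄ f₅ f₆ f₇ f₈ : ι → ℝ) (k l : ℝ),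
      ∑ a, (f₁ a + f₂ a - f₃ a - 2 * f₄ a - φ * m - k * (f₅ a + φ * f₆ a + f₇ a) + l * f₈ a) =
        ∑ a, f₁ a + ∑ a, f₂ a - ∑ a, f₃ a - 2 * ∑ a, f₄ a - Fintype.card ι * (φ * m)
        - k * (∑ a, f₅ a + φ * ∑ a, f₆ a + ∑ a, f₇ a) + l * ∑ a, f₈ a := by
    intro f₁ f₂ f₃ f₄ f₅ f₆ f₇ f₈ k l
    simp only [Finset.sum_add_distrib, Finset.sum_sub_distrib, ← Finset.mul_sum, Finset.sum_const,
      Finset.card_univ, nsmul_eq_mul]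
    ring
  rw [Finset.sum_congr rfl fun a _ => hsum a, split, hcomm, hq2', h5, h6, h9, hT, hdiv, hy]
  ring
/-- The algebra behind the divergence of the flux `X_d = κ_b h_bd`, `κ = h(∇V, ·)`. Here `V₁` and `DV`
stand for the first and second frame derivatives of `V`; the hypothesis `hDV` is `Hess V = V g`. -/
theorem sum_flux_div_eq {y η κ V₁ : ι → ℝ} {V₀ : ℝ} {h DV : ι → ι → ℝ} {D N : ι → ι → ι → ℝ}
    (hs : ∀ a b, h a b = h b a) (ht : ∑ a, h a a = 0) (hDs : ∀ a b c, D a b c = D a c b)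
    (hη : ∀ c, ∑ d, y d * h d c = η c)
    (hN : ∀ a b c, N a b c = D a b c - y b * h a c - y c * h a b
      + (if a = b then η c else 0) + (if a = c then η b else 0))
    (hDV : ∀ a b, DV a b = y b * V₁ a + if a = b then V₀ - ∑ c, y c * V₁ c else 0)
    (hκ : ∀ b, ∑ a, h b a * V₁ a = κ b) :
    ∑ d, (∑ b, (κ b * D d b d + (∑ a, (h b a * DV d a + D d b a * V₁ a)) * h b d)
      + ((Fintype.card ι : ℝ) - 1) * y d * ∑ b, κ b * h b d) =
    ∑ d, ∑ b, ∑ a, V₁ a * h b d * N d b a + ∑ b, κ b * ∑ d, N d d b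
      + V₀ * ∑ b, ∑ c, h b c * h b c := by
  have hη' : ∀ c, ∑ d, h c d * y d = η c := fun c => by
    rw [← hη c]; exact Finset.sum_congr rfl fun d _ => by rw [hs, mul_comm]
  have e1 : ∀ d b, ∑ a, h b a * DV d a = η b * V₁ d + h b d * (V₀ - ∑ c, y c * V₁ c) := by
    intro d b
    simp only [hDV, mul_add, ← mul_assoc, Finset.sum_add_distrib, ← Finset.sum_mul, hη', mul_ite,
      mul_zero, Finset.sum_ite_eq, Finset.mem_univ, if_true]
  have e2 : ∀ d b, ∑ a, D d b a * V₁ a = ∑ a, V₁ a * N d b a + y b * κ d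
      + (∑ c, y c * V₁ c) * h b d - (if d = b then ∑ a, η a * V₁ a else 0) - η b * V₁ d := by
    intro d b
    have : ∀ a, D d b a * V₁ a = V₁ a * N d b a + y b * (h d a * V₁ a) + (y a * V₁ a) * h b d
        - (if d = b then η a * V₁ a else 0) - (if d = a then η b * V₁ a else 0) := fun a => by
      rw [hN, hs b d]; split_ifs <;> ring
    simp only [this, Finset.sum_add_distrib, Finset.sum_sub_distrib, ← Finset.mul_sum, hκ,
      ← Finset.sum_mul, Finset.sum_ite_eq, Finset.mem_univ, if_true]
    congr 2
    split_ifs <;> simp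
  have e3 : ∀ d b, (∑ a, (h b a * DV d a + D d b a * V₁ a)) * h b d =
      ∑ a, V₁ a * h b d * N d b a + V₀ * (h b d * h b d) + κ d * (y b * h b d)
      - (if d = b then (∑ a, η a * V₁ a) * h d d else 0) := by
    intro d b
    rw [Finset.sum_add_distrib, e1, e2]
    have : ∑ a, V₁ a * h b d * N d b a = (∑ a, V₁ a * N d b a) * h b d := by
      rw [Finset.sum_mul]; exact Finset.sum_congr rfl fun a _ => by ring
    rw [this]
    split_ifs with hdb
    · subst hdb; ring
    · ring
  have e4 : ∑ d, ∑ b, κ b * D d b d = ∑ b, κ b * ∑ d, N d d b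
      - Fintype.card ι * ∑ b, κ b * η b := by
    simp only [sum_contract_eq ht hη hN, mul_add, Finset.sum_add_distrib]
    rw [Finset.sum_comm]
    have : ∀ b, κ b * (Fintype.card ι * η b) = Fintype.card ι * (κ b * η b) := fun b => by ring
    simp only [this, ← Finset.mul_sum, hDs _ _ _]
    have : ∀ b, ∑ d, D d b d = ∑ d, D d d b := fun b => Finset.sum_congr rfl fun d _ => hDs _ _ _
    simp only [this]
    ring
  have e5 : ∑ d, y d * ∑ b, κ b * h b d = ∑ b, κ b * η b := by
    simp only [Finset.mul_sum, ← hη']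
    rw [Finset.sum_comm]
    exact Finset.sum_congr rfl fun b _ => Finset.sum_congr rfl fun d _ => by ring
  have e6 : ∑ d, ∑ b, h b d * h b d = ∑ b, ∑ c, h b c * h b c := Finset.sum_comm
  simp only [e3]
  simp only [Finset.sum_add_distrib, Finset.sum_sub_distrib, ← Finset.mul_sum, hη,
    Finset.sum_ite_eq, Finset.mem_univ, if_true, ht, e4, e6, mul_assoc ((Fintype.card ι : ℝ) - 1),
    e5]
  ring
end sums

/-! ### The static potential and the norms in the frame -/

theorem sum_ballCoord_sq (x : EuclideanSpace ℝ (Fin n)) :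
    ∑ a, ballCoord x a * ballCoord x a = 1 - 2 * ballFactor x := by
  have : ∀ a, ballCoord x a * ballCoord x a = ballFactor x ^ 2 * (x a * x a) := fun a => by
    rw [ballCoord]; ring
  simp only [this, ← Finset.mul_sum, sum_coord_mul_self]
  linear_combination ballFactor x * ballFactor_mul_normSq x + ballFactor_mul x

theorem contDiff_staticKID (A0 : ℝ) (A : EuclideanSpace ℝ (Fin n)) {k : WithTop ℕ∞} :
    ContDiff ℝ k (staticKID A0 A) :=
  (contDiff_const.mul contDiff_lapse).add
    (ContDiff.sum fun i _ => contDiff_const.mul (contDiff_coord i))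

theorem frameDeriv_staticKID (A0 : ℝ) (A : EuclideanSpace ℝ (Fin n)) (a : Fin n)
    (x : EuclideanSpace ℝ (Fin n)) :
    frameDeriv a (staticKID A0 A) x = A0 * x a + A a + (∑ i, A i * x i) * ballCoord x a := by
  have h1 : ∀ i, DifferentiableAt ℝ (fun y : EuclideanSpace ℝ (Fin n) => A i * y i) x := fun i =>
    (contDiff_const.mul (contDiff_coord (k := 1) i)).differentiable one_ne_zero x
  have h2 : DifferentiableAt ℝ (fun y : EuclideanSpace ℝ (Fin n) => √(1 + ‖y‖ ^ 2)) x :=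
    contDiff_lapse.differentiable (one_ne_zero) x
  have e : staticKID A0 A = fun y => A0 * √(1 + ‖y‖ ^ 2) + ∑ i, A i * y i := rfl
  rw [e, frameDeriv_add _ (h2.const_mul A0) (DifferentiableAt.fun_sum fun i _ => h1 i),
    frameDeriv_mul _ (differentiableAt_const _) h2, frameDeriv_const, frameDeriv_lapse,
    frameDeriv_sum _ _ fun i _ => h1 i]
  have h3 : ∀ i, frameDeriv a (fun y : EuclideanSpace ℝ (Fin n) => A i * y i) x =
      A i * frame x i a := fun i => by
    rw [frameDeriv_mul _ (differentiableAt_const _)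
      ((contDiff_coord (k := 1) i).differentiable one_ne_zero x), frameDeriv_const,
      frameDeriv_coord]
    ring
  simp only [h3, frame, mul_add, mul_ite, mul_one, mul_zero, Finset.sum_add_distrib,
    Finset.sum_ite_eq', Finset.mem_univ, if_true, Finset.sum_mul, zero_mul, add_zero, ballCoord]
  rw [add_assoc]
  congr 2
  exact Finset.sum_congr rfl fun i _ => by ring

theorem sum_ballCoord_mul_coord (x : EuclideanSpace ℝ (Fin n)) :
    ∑ a, ballCoord x a * x a = √(1 + ‖x‖ ^ 2) - 1 := by
  simp only [ballCoord, mul_assoc, ← Finset.mul_sum, sum_coord_mul_self, ballFactor_mul_normSq]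

theorem sum_ballCoord_mul_eq (A x : EuclideanSpace ℝ (Fin n)) :
    ∑ a, ballCoord x a * A a = ballFactor x * ∑ a, A a * x a := by
  rw [Finset.mul_sum]; exact Finset.sum_congr rfl fun a _ => by rw [ballCoord]; ring

/-- `Hess V = V g`, written in the frame. -/
theorem frameDeriv_frameDeriv_staticKID (A0 : ℝ) (A : EuclideanSpace ℝ (Fin n)) (a b : Fin n)
    (x : EuclideanSpace ℝ (Fin n)) :
    frameDeriv a (frameDeriv b (staticKID A0 A)) x =
      ballCoord x b * frameDeriv a (staticKID A0 A) x
      + if a = b then staticKID A0 A x - ∑ c, ballCoord x c * frameDeriv c (staticKID A0 A) x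
        else 0 := by
  have h0 : ∀ i, DifferentiableAt ℝ (fun y : EuclideanSpace ℝ (Fin n) => y i) x := fun i =>
    (contDiff_coord (k := 1) i).differentiable one_ne_zero x
  have h1 : DifferentiableAt ℝ (fun y : EuclideanSpace ℝ (Fin n) => ∑ i, A i * y i) x :=
    DifferentiableAt.fun_sum fun i _ => (h0 i).const_mul _
  have h2 : DifferentiableAt ℝ (fun y : EuclideanSpace ℝ (Fin n) => ballCoord y b) x :=
    (contDiff_ballCoord (k := 1) b).differentiable one_ne_zero x
  have h3 : frameDeriv a (fun y : EuclideanSpace ℝ (Fin n) => ∑ i, A i * y i) x =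
      A a + (∑ i, A i * x i) * ballCoord x a := by
    have := frameDeriv_staticKID 0 A a x
    rwa [show staticKID 0 A = fun y => ∑ i, A i * y i from funext fun y => by simp [staticKID],
      zero_mul, zero_add] at this
  have e : frameDeriv b (staticKID A0 A) = fun y => A0 * y b + A b
      + (∑ i, A i * y i) * ballCoord y b := funext fun y => frameDeriv_staticKID A0 A b y
  have h4 : ∑ c, ballCoord x c * frameDeriv c (staticKID A0 A) x =
      A0 * (√(1 + ‖x‖ ^ 2) - 1) + ballFactor x * (∑ i, A i * x i)
      + (∑ i, A i * x i) * (1 - 2 * ballFactor x) := by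
    have : ∀ c, ballCoord x c * frameDeriv c (staticKID A0 A) x = A0 * (ballCoord x c * x c)
        + ballCoord x c * A c + (∑ i, A i * x i) * (ballCoord x c * ballCoord x c) := fun c => by
      rw [frameDeriv_staticKID]; ring
    simp only [this, Finset.sum_add_distrib, ← Finset.mul_sum, sum_ballCoord_mul_coord,
      sum_ballCoord_mul_eq, sum_ballCoord_sq]
  rw [h4, frameDeriv_staticKID, e, frameDeriv_add _ (((h0 b).const_mul _).add_const _) (h1.fun_mul h2),
    frameDeriv_add _ ((h0 b).const_mul _) (differentiableAt_const _), frameDeriv_const,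
    frameDeriv_mul _ (differentiableAt_const _) (h0 b), frameDeriv_const, frameDeriv_coord,
    frameDeriv_mul _ h1 h2, frameDeriv_ballCoord, h3]
  simp only [frame, staticKID, ballCoord, eq_comm (a := b)]
  split_ifs <;> ring

/-- `|∇V|² = V² - ((A⁰)² - |A|²)`. -/
theorem sum_frameDeriv_staticKID_sq (A0 : ℝ) (A : EuclideanSpace ℝ (Fin n))
    (x : EuclideanSpace ℝ (Fin n)) :
    ∑ a, frameDeriv a (staticKID A0 A) x * frameDeriv a (staticKID A0 A) x =
      staticKID A0 A x ^ 2 - (A0 ^ 2 - ‖A‖ ^ 2) := by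
  set s := ∑ i, A i * x i with hs
  have h1 : ∀ a, frameDeriv a (staticKID A0 A) x * frameDeriv a (staticKID A0 A) x =
      A0 ^ 2 * (x a * x a) + A a * A a + s ^ 2 * (ballCoord x a * ballCoord x a)
      + 2 * A0 * (A a * x a) + 2 * A0 * s * (ballCoord x a * x a)
      + 2 * s * (ballCoord x a * A a) := fun a => by
    rw [frameDeriv_staticKID]; ring
  simp only [h1, Finset.sum_add_distrib, ← Finset.mul_sum, sum_coord_mul_self, sum_ballCoord_sq,
    sum_ballCoord_mul_coord, sum_ballCoord_mul_eq, ← hs, staticKID]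
  linear_combination (-A0 ^ 2) * sq_lapse x

theorem abs_sum_mul_le (A x : EuclideanSpace ℝ (Fin n)) : |∑ i, A i * x i| ≤ ‖A‖ * ‖x‖ := by
  have := abs_real_inner_le_norm A x
  simpa [PiLp.inner_apply, mul_comm] using this

theorem norm_lt_lapse (x : EuclideanSpace ℝ (Fin n)) : ‖x‖ < √(1 + ‖x‖ ^ 2) :=
  Real.lt_sqrt_of_sq_lt (by linarith)

theorem staticKID_pos {A0 : ℝ} {A : EuclideanSpace ℝ (Fin n)} (hA : ‖A‖ ≤ A0) (h0 : 0 < A0)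
    (x : EuclideanSpace ℝ (Fin n)) : 0 < staticKID A0 A x := by
  have h1 := abs_le.1 (abs_sum_mul_le A x)
  have h2 := norm_lt_lapse x
  have h3 : ‖A‖ * ‖x‖ ≤ A0 * ‖x‖ := by gcongr
  have h4 : A0 * ‖x‖ < A0 * √(1 + ‖x‖ ^ 2) := by gcongr
  rw [staticKID]
  linarith

theorem staticKID_le {A0 : ℝ} {A : EuclideanSpace ℝ (Fin n)} (hA : ‖A‖ ≤ A0)
    (x : EuclideanSpace ℝ (Fin n)) : staticKID A0 A x ≤ 2 * A0 * √(1 + ‖x‖ ^ 2) := by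
  have h1 := abs_le.1 (abs_sum_mul_le A x)
  have h2 := (norm_lt_lapse x).le
  have h5 := (norm_nonneg A).trans hA
  have h3 : ‖A‖ * ‖x‖ ≤ A0 * √(1 + ‖x‖ ^ 2) := by gcongr
  rw [staticKID]
  linarith

section norms

theorem sum_metric_inv_mul (x : EuclideanSpace ℝ (Fin n)) (u v : Fin n → ℝ) :
    ∑ i, ∑ j, (hypMetric n x)⁻¹ i j * (u i * v j) =
      ∑ a, (∑ i, frame x i a * u i) * ∑ j, frame x j a * v j := by
  simp only [Finset.sum_mul_sum]
  rw [← sum3_rotate fun a i j => frame x i a * u i * (frame x j a * v j)]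
  simp only [hypMetric_inv_eq_frame, Finset.sum_mul]
  exact Finset.sum_congr rfl fun i _ => Finset.sum_congr rfl fun j _ =>
    Finset.sum_congr rfl fun a _ => by ring

/-- Contracting `2`-tensors with the inverse metric is summing over their frame components. -/
theorem sum_metric_inv_mul₂ (x : EuclideanSpace ℝ (Fin n)) (u v : Fin n → Fin n → ℝ) :
    ∑ i, ∑ j, ∑ a, ∑ b, (hypMetric n x)⁻¹ i a * (hypMetric n x)⁻¹ j b * (u i j * v a b) =
      ∑ b, ∑ c, (∑ i, ∑ j, frame x i b * (frame x j c * u i j)) *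
        ∑ i, ∑ j, frame x i b * (frame x j c * v i j) := by
  have e1 : ∀ i, ∑ j, ∑ a, ∑ b, (hypMetric n x)⁻¹ i a * (hypMetric n x)⁻¹ j b * (u i j * v a b) =
      ∑ a, ∑ c, (hypMetric n x)⁻¹ i a *
        ((∑ j, frame x j c * u i j) * ∑ j, frame x j c * v a j) := by
    intro i
    rw [Finset.sum_comm]
    refine Finset.sum_congr rfl fun a _ => ?_
    simp only [mul_assoc, ← Finset.mul_sum, sum_metric_inv_mul]
  simp only [e1]
  rw [sum3_rotate fun c i a => (hypMetric n x)⁻¹ i a *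
        ((∑ j, frame x j c * u i j) * ∑ j, frame x j c * v a j)]
  simp only [sum_metric_inv_mul x (fun i => ∑ j, frame x j _ * u i j)
    fun a => ∑ j, frame x j _ * v a j]
  rw [Finset.sum_comm]
  simp only [Finset.mul_sum]

theorem normSq1_eq (x : EuclideanSpace ℝ (Fin n)) (α : Fin n → ℝ) :
    normSq1 (hypMetric n x) α = ∑ a, (∑ i, frame x i a * α i) ^ 2 := by
  simp only [normSq1, sq, mul_assoc, sum_metric_inv_mul]

theorem normSq2_eq (x : EuclideanSpace ℝ (Fin n)) (h : Field2 n) :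
    normSq2 (hypMetric n x) (h x) = ∑ b, ∑ c, frameComp h x b c ^ 2 := by
  simp only [normSq2, mul_assoc _ (h x _ _), frameComp, sq]
  exact sum_metric_inv_mul₂ x (fun i j => h x i j) fun i j => h x i j

theorem normSq3_eq (x : EuclideanSpace ℝ (Fin n)) (T : Fin n → Fin n → Fin n → ℝ) :
    normSq3 (hypMetric n x) T = ∑ a, ∑ b, ∑ c,
      (∑ i, ∑ j, ∑ k, frame x i a * (frame x j b * (frame x k c * T i j k))) ^ 2 := by
  have e1 : ∀ i, ∑ j, ∑ k, ∑ a, ∑ b, ∑ c, (hypMetric n x)⁻¹ i a * (hypMetric n x)⁻¹ j b *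
        (hypMetric n x)⁻¹ k c * T i j k * T a b c =
      ∑ a, ∑ p, ∑ q, (hypMetric n x)⁻¹ i a *
        ((∑ j, ∑ k, frame x j p * (frame x k q * T i j k)) *
          ∑ j, ∑ k, frame x j p * (frame x k q * T a j k)) := by
    intro i
    rw [sum3_rotate fun a j k => ∑ b, ∑ c, (hypMetric n x)⁻¹ i a * (hypMetric n x)⁻¹ j b *
        (hypMetric n x)⁻¹ k c * T i j k * T a b c]
    refine Finset.sum_congr rfl fun a _ => ?_
    have e0 := congrArg ((hypMetric n x)⁻¹ i a * ·) (sum_metric_inv_mul₂ x (T i) (T a))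
    simp only [Finset.mul_sum (a := (hypMetric n x)⁻¹ i a)] at e0
    refine Eq.trans ?_ e0
    exact Finset.sum_congr rfl fun j _ => Finset.sum_congr rfl fun k _ =>
      Finset.sum_congr rfl fun b _ => Finset.sum_congr rfl fun c _ => by ring
  have e2 : ∀ p q, ∑ i, ∑ a, (hypMetric n x)⁻¹ i a *
        ((∑ j, ∑ k, frame x j p * (frame x k q * T i j k)) *
          ∑ j, ∑ k, frame x j p * (frame x k q * T a j k)) =
      ∑ a, (∑ i, ∑ j, ∑ k, frame x i a * (frame x j p * (frame x k q * T i j k))) ^ 2 := by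
    intro p q
    rw [sum_metric_inv_mul x (fun i => ∑ j, ∑ k, frame x j p * (frame x k q * T i j k))
      fun i => ∑ j, ∑ k, frame x j p * (frame x k q * T i j k)]
    simp only [sq, Finset.mul_sum]
  simp only [normSq3, e1]
  rw [← sum3_rotate fun a b c =>
      (∑ i, ∑ j, ∑ k, frame x i a * (frame x j b * (frame x k c * T i j k))) ^ 2]
  simp only [← e2]
  have e3 : ∀ i, ∑ a, ∑ p, ∑ q, (hypMetric n x)⁻¹ i a *
        ((∑ j, ∑ k, frame x j p * (frame x k q * T i j k)) *
          ∑ j, ∑ k, frame x j p * (frame x k q * T a j k)) =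
      ∑ p, ∑ q, ∑ a, (hypMetric n x)⁻¹ i a *
        ((∑ j, ∑ k, frame x j p * (frame x k q * T i j k)) *
          ∑ j, ∑ k, frame x j p * (frame x k q * T a j k)) :=
    fun i => (sum3_rotate fun a p q => (hypMetric n x)⁻¹ i a *
        ((∑ j, ∑ k, frame x j p * (frame x k q * T i j k)) *
          ∑ j, ∑ k, frame x j p * (frame x k q * T a j k))).symm
  simp only [e3]
  exact (sum3_rotate fun i p q => ∑ a, (hypMetric n x)⁻¹ i a *
        ((∑ j, ∑ k, frame x j p * (frame x k q * T i j k)) *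
          ∑ j, ∑ k, frame x j p * (frame x k q * T a j k))).symm

end norms

/-! ### Frame components of the operators, and the two divergence formulas -/

/-- The vector field `hᵇᶜ ∇_b h_ac - h_aᶜ ∇ᵇ h_bc`, in the frame. -/
noncomputable def bochnerField (h : Field2 n) (x : EuclideanSpace ℝ (Fin n)) (a : Fin n) : ℝ :=
  ∑ b, ∑ c, (frameComp h x b c * frameCov h x b a c - frameComp h x a c * frameCov h x b b c)

/-- The covector `h(∇V, ·)`, in the frame. -/
noncomputable def contractGrad (h : Field2 n) (V : EuclideanSpace ℝ (Fin n) → ℝ)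
    (x : EuclideanSpace ℝ (Fin n)) (b : Fin n) : ℝ :=
  ∑ a, frameComp h x b a * frameDeriv a V x

/-- The frame components of `fluxField`. -/
noncomputable def frameFlux (h : Field2 n) (V : EuclideanSpace ℝ (Fin n) → ℝ)
    (x : EuclideanSpace ℝ (Fin n)) (d : Fin n) : ℝ :=
  ∑ b, contractGrad h V x b * frameComp h x b d

theorem frameComp_trace {h : Field2 n} {x : EuclideanSpace ℝ (Fin n)}
    (ht : ∑ i, ∑ j, (hypMetric n x)⁻¹ i j * h x i j = 0) : ∑ a, frameComp h x a a = 0 := by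
  rw [← ht]
  simp only [frameComp, hypMetric_inv_eq_frame, Finset.sum_mul]
  rw [← sum3_rotate fun a i j => frame x i a * (frame x j a * h x i j)]
  simp only [mul_assoc]

theorem grad_eq (f : EuclideanSpace ℝ (Fin n) → ℝ) (x : EuclideanSpace ℝ (Fin n)) (i : Fin n) :
    grad (hypMetric n) f x i = ∑ a, frame x i a * frameDeriv a f x := by
  simp only [grad, hypMetric_inv_eq_frame, Finset.sum_mul, frameDeriv, Finset.mul_sum]
  rw [Finset.sum_comm]
  simp only [mul_assoc]

theorem sum_frame_contractGrad {h : Field2 n} (V : EuclideanSpace ℝ (Fin n) → ℝ)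
    (x : EuclideanSpace ℝ (Fin n)) (b : Fin n) :
    ∑ i, frame x i b * ∑ j, h x i j * grad (hypMetric n) V x j = contractGrad h V x b := by
  simp only [grad_eq, contractGrad, frameComp, Finset.mul_sum, Finset.sum_mul]
  rw [← sum3_rotate fun a i j =>
    frame x i b * (frame x j a * h x i j) * frameDeriv a V x]
  exact Finset.sum_congr rfl fun i _ => Finset.sum_congr rfl fun j _ =>
    Finset.sum_congr rfl fun a _ => by ring

theorem fluxField_eq {h : Field2 n} (hs : ∀ x i j, h x i j = h x j i)
    (V : EuclideanSpace ℝ (Fin n) → ℝ) (x : EuclideanSpace ℝ (Fin n)) (j : Fin n) :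
    fluxField (hypMetric n) h V x j = ∑ d, frame x j d * frameFlux h V x d := by
  set u : Fin n → ℝ := fun k => ∑ i, h x k i * grad (hypMetric n) V x i with hu
  have e1 : fluxField (hypMetric n) h V x j =
      ∑ a, (hypMetric n x)⁻¹ j a * ∑ k, ∑ b, (hypMetric n x)⁻¹ k b * (u k * h x a b) := by
    simp only [fluxField]
    rw [Finset.sum_comm]
    have : ∀ k, ∑ i, h x i k * grad (hypMetric n) V x i *
        ∑ a, ∑ b, (hypMetric n x)⁻¹ j a * (hypMetric n x)⁻¹ k b * h x a b =
        ∑ a, ∑ b, (hypMetric n x)⁻¹ j a * ((hypMetric n x)⁻¹ k b * (u k * h x a b)) := by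
      intro k
      have e : ∑ i, h x i k * grad (hypMetric n) V x i = u k :=
        Finset.sum_congr rfl fun i _ => by rw [hs]
      rw [← Finset.sum_mul, e, Finset.mul_sum]
      refine Finset.sum_congr rfl fun a _ => ?_
      rw [Finset.mul_sum]
      exact Finset.sum_congr rfl fun b _ => by ring
    simp only [this]
    rw [Finset.sum_comm]
    simp only [Finset.mul_sum]
  have e2 : ∀ a, ∑ k, ∑ b, (hypMetric n x)⁻¹ k b * (u k * h x a b) =
      ∑ c, contractGrad h V x c * ∑ b, frame x b c * h x a b := fun a => by
    rw [sum_metric_inv_mul x u fun b => h x a b]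
    simp only [hu, sum_frame_contractGrad]
  have e3 : ∀ d, frameFlux h V x d =
      ∑ a, frame x a d * ∑ c, contractGrad h V x c * ∑ b, frame x b c * h x a b := by
    intro d
    simp only [frameFlux, frameComp_symm hs x _ d]
    simp only [frameComp, Finset.mul_sum]
    rw [Finset.sum_comm]
    exact Finset.sum_congr rfl fun i _ => Finset.sum_congr rfl fun j _ =>
      Finset.sum_congr rfl fun a _ => by ring
  simp only [e1, e2, e3]
  simp only [hypMetric_inv_eq_frame, Finset.sum_mul]
  rw [Finset.sum_comm]
  refine Finset.sum_congr rfl fun d _ => ?_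
  rw [Finset.mul_sum]
  exact Finset.sum_congr rfl fun a _ => by ring

theorem sum_frame_tensorDiv (h : Field2 n) (x : EuclideanSpace ℝ (Fin n)) (a : Fin n) :
    ∑ i, frame x i a * tensorDiv (hypMetric n) h x i = - ∑ b, frameCov h x b b a := by
  simp only [tensorDiv, frameCov, hypMetric_inv_eq_frame, mul_neg, Finset.sum_neg_distrib,
    Finset.sum_mul, Finset.mul_sum]
  congr 1
  have e1 : ∀ b, ∑ i, ∑ j, ∑ k, frame x i b * (frame x j b * (frame x k a *
      cov (hypMetric n) h x i j k)) = ∑ k, ∑ i, ∑ j, frame x i b * (frame x j b * (frame x k a *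
      cov (hypMetric n) h x i j k)) := fun b => by
    rw [← sum3_rotate fun k i j => frame x i b * (frame x j b * (frame x k a *
      cov (hypMetric n) h x i j k))]
  simp only [e1]
  conv_rhs => rw [Finset.sum_comm]
  refine Finset.sum_congr rfl fun k _ => ?_
  rw [← sum3_rotate fun b i j => frame x i b * (frame x j b * (frame x k a *
      cov (hypMetric n) h x i j k))]
  exact Finset.sum_congr rfl fun i _ => Finset.sum_congr rfl fun j _ =>
    Finset.sum_congr rfl fun b _ => by ring

theorem sum_frame_contractDV (h : Field2 n) (V : EuclideanSpace ℝ (Fin n) → ℝ)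
    (x : EuclideanSpace ℝ (Fin n)) (a : Fin n) :
    ∑ i, frame x i a * contractDV (hypMetric n) h V x i = (V x)⁻¹ * contractGrad h V x a := by
  simp only [contractDV, mul_left_comm _ (V x)⁻¹, ← Finset.mul_sum, sum_frame_contractGrad]

theorem sum_frame_curlOp (h : Field2 n) (x : EuclideanSpace ℝ (Fin n)) (a b c : Fin n) :
    ∑ i, ∑ j, ∑ k, frame x i a * (frame x j b * (frame x k c *
      curlOp (hypMetric n) h x i j k)) =
      1 / √2 * (frameCov h x a b c - frameCov h x b a c) := by
  have : frameCov h x b a c = ∑ i, ∑ j, ∑ k, frame x j b * (frame x i a * (frame x k c *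
      cov (hypMetric n) h x j i k)) := Finset.sum_comm
  rw [this, frameCov, ← Finset.sum_sub_distrib, Finset.mul_sum]
  refine Finset.sum_congr rfl fun i _ => ?_
  rw [← Finset.sum_sub_distrib, Finset.mul_sum]
  refine Finset.sum_congr rfl fun j _ => ?_
  rw [← Finset.sum_sub_distrib, Finset.mul_sum]
  exact Finset.sum_congr rfl fun k _ => by rw [curlOp]; ring

theorem normSq3_cov (h : Field2 n) (x : EuclideanSpace ℝ (Fin n)) :
    normSq3 (hypMetric n x) (cov (hypMetric n) h x) = ∑ a, ∑ b, ∑ c, frameCov h x a b c ^ 2 := by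
  simp only [normSq3_eq, frameCov]

/-- `|𝒟h|² = |∇h|² - ∇ᵢhⱼₖ ∇ʲhⁱᵏ`. -/
theorem normSq3_curlOp (h : Field2 n) (x : EuclideanSpace ℝ (Fin n)) :
    normSq3 (hypMetric n x) (curlOp (hypMetric n) h x) =
      normSq3 (hypMetric n x) (cov (hypMetric n) h x)
      - ∑ a, ∑ b, ∑ c, frameCov h x a b c * frameCov h x b a c := by
  have e1 : ∀ a b c, (1 / √2 * (frameCov h x a b c - frameCov h x b a c)) ^ 2 =
      1 / 2 * (frameCov h x a b c ^ 2 + frameCov h x b a c ^ 2)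
        - frameCov h x a b c * frameCov h x b a c := fun a b c => by
    rw [mul_pow, div_pow, Real.sq_sqrt (by norm_num)]; ring
  rw [normSq3_eq, normSq3_cov]
  simp only [sum_frame_curlOp, e1]
  simp only [Finset.sum_sub_distrib, ← Finset.mul_sum, Finset.sum_add_distrib]
  rw [sum3_swap_left fun a b c => frameCov h x a b c ^ 2]
  ring

theorem normSq1_div_sub (h : Field2 n) (V : EuclideanSpace ℝ (Fin n) → ℝ)
    (x : EuclideanSpace ℝ (Fin n)) :
    normSq1 (hypMetric n x)
      (fun i => tensorDiv (hypMetric n) h x i - contractDV (hypMetric n) h V x i) =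
      ∑ a, (∑ b, frameCov h x b b a + (V x)⁻¹ * contractGrad h V x a) ^ 2 := by
  simp only [normSq1_eq, mul_sub, Finset.sum_sub_distrib, sum_frame_tensorDiv,
    sum_frame_contractDV]
  exact Finset.sum_congr rfl fun a _ => by ring

section calculus

variable {h : Field2 n} (hs : ∀ x i j, h x i j = h x j i)
  (hh : ∀ i j, ContDiff ℝ 2 fun x => h x i j)
include hs hh

theorem frameCov_eq (x : EuclideanSpace ℝ (Fin n)) (a b c : Fin n) :
    frameCov h x a b c = frameDeriv a (fun y => frameComp h y b c) x
      - ballCoord x b * frameComp h x a c - ballCoord x c * frameComp h x a b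
      + (if a = b then ∑ d, ballCoord x d * frameComp h x d c else 0)
      + (if a = c then ∑ d, ballCoord x d * frameComp h x d b else 0) := by
  rw [frameDeriv_frameComp hs hh]; ring

theorem contDiff_frameCov (a b c : Fin n) : ContDiff ℝ 1 (fun x => frameCov h x a b c) := by
  have h1 : ∀ b c, ContDiff ℝ 1 (fun x => frameComp h x b c) := fun b c =>
    (contDiff_frameComp hh b c).of_le (by norm_num)
  have h2 : ∀ c, ContDiff ℝ 1 (fun x => ∑ d, ballCoord x d * frameComp h x d c) := fun c =>
    ContDiff.sum fun d _ => (contDiff_ballCoord d).mul (h1 d c)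
  have h3 := contDiff_frameDeriv (contDiff_frameComp hh b c) (k := 1) (by norm_num) a
  rw [funext fun x => frameCov_eq hs hh x a b c]
  refine ContDiff.add (ContDiff.add ((h3.sub ((contDiff_ballCoord b).mul (h1 a c))).sub
    ((contDiff_ballCoord c).mul (h1 a b))) ?_) ?_
  · split_ifs
    · exact h2 c
    · exact contDiff_const
  · split_ifs
    · exact h2 b
    · exact contDiff_const

theorem contDiff_bochnerField (a : Fin n) : ContDiff ℝ 1 (fun x => bochnerField h x a) := by
  have h1 : ∀ b c, ContDiff ℝ 1 (fun x => frameComp h x b c) := fun b c =>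
    (contDiff_frameComp hh b c).of_le (by norm_num)
  exact ContDiff.sum fun b _ => ContDiff.sum fun c _ =>
    ((h1 b c).mul (contDiff_frameCov hs hh b a c)).sub
      ((h1 a c).mul (contDiff_frameCov hs hh b b c))

omit hs in
theorem contDiff_contractGrad {V : EuclideanSpace ℝ (Fin n) → ℝ} (hV : ContDiff ℝ 2 V)
    (b : Fin n) : ContDiff ℝ 1 (fun x => contractGrad h V x b) :=
  ContDiff.sum fun a _ => ((contDiff_frameComp hh b a).of_le (by norm_num)).mul
    (contDiff_frameDeriv hV (by norm_num) a)

omit hs in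
theorem contDiff_frameFlux {V : EuclideanSpace ℝ (Fin n) → ℝ} (hV : ContDiff ℝ 2 V)
    (d : Fin n) : ContDiff ℝ 1 (fun x => frameFlux h V x d) :=
  ContDiff.sum fun b _ => (contDiff_contractGrad hh hV b).mul
    ((contDiff_frameComp hh b d).of_le (by norm_num))

variable (ht : ∀ x, ∑ a, frameComp h x a a = 0)
include ht

omit hs in
theorem sum_frameDeriv_frameComp_trace (a : Fin n) (x : EuclideanSpace ℝ (Fin n)) :
    ∑ b, frameDeriv a (fun y => frameComp h y b b) x = 0 := by
  rw [← frameDeriv_sum _ _ fun b _ => (contDiff_frameComp hh b b).differentiable two_ne_zero x]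
  simp only [ht, frameDeriv_const]

/-- The Bochner formula `div U = ∇ᵢhⱼₖ ∇ʲhⁱᵏ - |div h|² - n |h|²` for traceless `h`; the last term is the
curvature term. -/
theorem frameDiv_bochnerField (x : EuclideanSpace ℝ (Fin n)) :
    frameDiv (bochnerField h) x =
      ∑ a, ∑ b, ∑ c, frameCov h x a b c * frameCov h x b a c
      - ∑ c, (∑ b, frameCov h x b b c) * ∑ b, frameCov h x b b c
      - n * ∑ b, ∑ c, frameComp h x b c * frameComp h x b c := by
  set D : Fin n → Fin n → Fin n → EuclideanSpace ℝ (Fin n) → ℝ := fun a b c =>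
    frameDeriv a (fun y => frameComp h y b c) with hD
  have d1 : ∀ b c, DifferentiableAt ℝ (fun x => frameComp h x b c) x := fun b c =>
    (contDiff_frameComp hh b c).differentiable two_ne_zero x
  have d2 : ∀ a b c, DifferentiableAt ℝ (D a b c) x := fun a b c =>
    (contDiff_frameDeriv (contDiff_frameComp hh b c) (k := 1)
      (by norm_num) a).differentiable one_ne_zero x
  have d3 : ∀ a, DifferentiableAt ℝ (fun x : EuclideanSpace ℝ (Fin n) => ballCoord x a) x :=
    fun a => (contDiff_ballCoord (k := 1) a).differentiable one_ne_zero x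
  have hU : ∀ z a, bochnerField h z a = ∑ b, ∑ c, (frameComp h z b c * D b a c z
        - frameComp h z a c * D b b c z)
      - ballCoord z a * ∑ b, ∑ c, frameComp h z b c * frameComp h z b c
      - n * ∑ c, frameComp h z a c * ∑ d, ballCoord z d * frameComp h z d c := by
    intro z a
    have := sum_flux_eq (y := ballCoord z) (h := frameComp h z) (N := frameCov h z)
      (D := fun a b c => D a b c z) (frameComp_symm hs z) (ht z) (fun c => rfl)
      (frameCov_eq hs hh z) a
    rw [Fintype.card_fin] at this
    exact this
  have hm : ∀ b c, DifferentiableAt ℝ (fun x => frameComp h x b c * frameComp h x b c) x :=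
    fun b c => (d1 b c).fun_mul (d1 b c)
  have hη : ∀ c, DifferentiableAt ℝ (fun x => ∑ d, ballCoord x d * frameComp h x d c) x :=
    fun c => DifferentiableAt.fun_sum fun d _ => (d3 d).fun_mul (d1 d c)
  have hdη : ∀ a c, frameDeriv a (fun x => ∑ d, ballCoord x d * frameComp h x d c) x =
      ∑ d, ballCoord x d * D a d c x + ballFactor x * frameComp h x a c := by
    intro a c
    rw [frameDeriv_sum _ _ fun d _ => (d3 d).fun_mul (d1 d c)]
    simp only [fun d => frameDeriv_mul a (d3 d) (d1 d c), frameDeriv_ballCoord,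
      Finset.sum_add_distrib, ite_mul, zero_mul, Finset.sum_ite_eq, Finset.mem_univ, if_true, hD]
  have hdU : ∀ a, frameDeriv a (fun z => bochnerField h z a) x =
      (∑ b, ∑ c, ((frameComp h x b c * frameDeriv a (D b a c) x + D a b c x * D b a c x)
          - (frameComp h x a c * frameDeriv a (D b b c) x + D a a c x * D b b c x))
        - (ballCoord x a * ∑ b, ∑ c, (frameComp h x b c * D a b c x + D a b c x * frameComp h x b c)
            + ballFactor x * ∑ b, ∑ c, frameComp h x b c * frameComp h x b c)
        - n * ∑ c, (frameComp h x a c * (∑ d, ballCoord x d * D a d c x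
            + ballFactor x * frameComp h x a c)
          + D a a c x * ∑ d, ballCoord x d * frameComp h x d c)) := by
    intro a
    have t1 : ∀ b c, DifferentiableAt ℝ (fun z => frameComp h z b c * D b a c z
        - frameComp h z a c * D b b c z) x := fun b c =>
      ((d1 b c).fun_mul (d2 b a c)).fun_sub ((d1 a c).fun_mul (d2 b b c))
    have t2 : DifferentiableAt ℝ (fun z => ∑ b, ∑ c, (frameComp h z b c * D b a c z
        - frameComp h z a c * D b b c z)) x :=
      DifferentiableAt.fun_sum fun b _ => DifferentiableAt.fun_sum fun c _ => t1 b c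
    have t3 : DifferentiableAt ℝ (fun z => ∑ b, ∑ c, frameComp h z b c * frameComp h z b c) x :=
      DifferentiableAt.fun_sum fun b _ => DifferentiableAt.fun_sum fun c _ => hm b c
    have t4 : DifferentiableAt ℝ (fun z => ∑ c, frameComp h z a c *
        ∑ d, ballCoord z d * frameComp h z d c) x :=
      DifferentiableAt.fun_sum fun c _ => (d1 a c).fun_mul (hη c)
    rw [funext fun z => hU z a, frameDeriv_sub _ (t2.fun_sub ((d3 a).fun_mul t3)) (t4.const_mul _),
      frameDeriv_sub _ t2 ((d3 a).fun_mul t3), frameDeriv_mul _ (differentiableAt_const _) t4,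
      frameDeriv_const, frameDeriv_mul _ (d3 a) t3, frameDeriv_ballCoord,
      frameDeriv_sum _ _ fun b _ => DifferentiableAt.fun_sum fun c _ => t1 b c,
      frameDeriv_sum _ _ fun b _ => DifferentiableAt.fun_sum fun c _ => hm b c,
      frameDeriv_sum _ _ fun c _ => (d1 a c).fun_mul (hη c)]
    simp only [if_true, zero_mul, add_zero, fun b => frameDeriv_sum a Finset.univ fun c _ => t1 b c,
      fun b => frameDeriv_sum a Finset.univ fun c _ => hm b c,
      fun b c => frameDeriv_sub a ((d1 b c).fun_mul (d2 b a c)) ((d1 a c).fun_mul (d2 b b c)),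
      fun b c => frameDeriv_mul a (d1 b c) (d2 b a c),
      fun b c => frameDeriv_mul a (d1 a c) (d2 b b c),
      fun b c => frameDeriv_mul a (d1 b c) (d1 b c),
      fun c => frameDeriv_mul a (d1 a c) (hη c), hdη]
    rfl
  have key := sum_bochner_eq (y := ballCoord x) (h := frameComp h x) (N := frameCov h x)
      (D := fun a b c => D a b c x) (η := fun c => ∑ d, ballCoord x d * frameComp h x d c)
      (DD := fun a b c d => frameDeriv a (D b c d) x) (φ := ballFactor x) (U := bochnerField h x)
      (frameComp_symm hs x) (ht x)
      (fun a b c => by simp only [hD, frameComp_symm hs _ b c])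
      (fun a => sum_frameDeriv_frameComp_trace hh ht a x) (fun c => rfl) (frameCov_eq hs hh x)
      (fun a b c d => frameDeriv_comm (contDiff_frameComp hh c d) a b x)
      (sum_ballCoord_sq x) (fun a => by rw [Fintype.card_fin]; exact hU x a)
  rw [Fintype.card_fin] at key
  rw [← key, frameDiv]
  simp only [hdU]

/-- The divergence of the flux; the term `V |h|²` comes from `Hess V = V g`. -/
theorem frameDiv_frameFlux (A0 : ℝ) (A x : EuclideanSpace ℝ (Fin n)) :
    frameDiv (frameFlux h (staticKID A0 A)) x =
      ∑ d, ∑ b, ∑ a, frameDeriv a (staticKID A0 A) x * frameComp h x b d * frameCov h x d b a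
      + ∑ b, contractGrad h (staticKID A0 A) x b * ∑ d, frameCov h x d d b
      + staticKID A0 A x * ∑ b, ∑ c, frameComp h x b c * frameComp h x b c := by
  have d1 : ∀ b c, DifferentiableAt ℝ (fun x => frameComp h x b c) x := fun b c =>
    (contDiff_frameComp hh b c).differentiable two_ne_zero x
  have hV : ContDiff ℝ 2 (staticKID A0 A) := contDiff_staticKID A0 A
  have d2 : ∀ a, DifferentiableAt ℝ (frameDeriv a (staticKID A0 A)) x := fun a =>
    (contDiff_frameDeriv hV (k := 1) (by norm_num) a).differentiable one_ne_zero x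
  have d3 : ∀ b, DifferentiableAt ℝ (fun x => contractGrad h (staticKID A0 A) x b) x := fun b =>
    (contDiff_contractGrad hh hV b).differentiable one_ne_zero x
  have key := sum_flux_div_eq (y := ballCoord x) (h := frameComp h x) (N := frameCov h x)
      (D := fun a b c => frameDeriv a (fun y => frameComp h y b c) x)
      (η := fun c => ∑ d, ballCoord x d * frameComp h x d c)
      (V₁ := fun a => frameDeriv a (staticKID A0 A) x) (V₀ := staticKID A0 A x)
      (DV := fun a b => frameDeriv a (frameDeriv b (staticKID A0 A)) x)
      (κ := contractGrad h (staticKID A0 A) x)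
      (frameComp_symm hs x) (ht x)
      (fun a b c => by simp only [frameComp_symm hs _ b c]) (fun c => rfl) (frameCov_eq hs hh x)
      (fun a b => frameDeriv_frameDeriv_staticKID A0 A a b x) (fun b => rfl)
  rw [← key, frameDiv, Fintype.card_fin]
  refine Finset.sum_congr rfl fun d _ => ?_
  congr 1
  simp only [frameFlux]
  rw [frameDeriv_sum _ _ fun b _ => (d3 b).fun_mul (d1 b d)]
  refine Finset.sum_congr rfl fun b _ => ?_
  rw [frameDeriv_mul _ (d3 b) (d1 b d)]
  congr 2
  simp only [contractGrad]
  rw [frameDeriv_sum _ _ fun a _ => (d1 b a).fun_mul (d2 a)]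
  exact Finset.sum_congr rfl fun a _ => frameDeriv_mul _ (d1 b a) (d2 a)

end calculus

/-! ### The boundary field and pointwise bounds -/

theorem frameDiv_sub {Y Z : EuclideanSpace ℝ (Fin n) → Fin n → ℝ} {x : EuclideanSpace ℝ (Fin n)}
    (hY : ∀ a, DifferentiableAt ℝ (fun y => Y y a) x)
    (hZ : ∀ a, DifferentiableAt ℝ (fun y => Z y a) x) :
    frameDiv (fun y a => Y y a - Z y a) x = frameDiv Y x - frameDiv Z x := by
  simp only [frameDiv, fun a => frameDeriv_sub a (hY a) (hZ a), ← Finset.sum_sub_distrib]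
  exact Finset.sum_congr rfl fun a _ => by ring

theorem frameDiv_mul {f : EuclideanSpace ℝ (Fin n) → ℝ}
    {Z : EuclideanSpace ℝ (Fin n) → Fin n → ℝ} {x : EuclideanSpace ℝ (Fin n)}
    (hf : DifferentiableAt ℝ f x) (hZ : ∀ a, DifferentiableAt ℝ (fun y => Z y a) x) :
    frameDiv (fun y a => f y * Z y a) x = f x * frameDiv Z x + ∑ a, frameDeriv a f x * Z x a := by
  simp only [frameDiv, fun a => frameDeriv_mul a hf (hZ a), Finset.mul_sum,
    ← Finset.sum_add_distrib]
  exact Finset.sum_congr rfl fun a _ => by ring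

section
variable {h : Field2 n} (hs : ∀ x i j, h x i j = h x j i)
  (hh : ∀ i j, ContDiff ℝ 2 fun x => h x i j)
include hs hh

theorem frameCov_symm (x : EuclideanSpace ℝ (Fin n)) (a b c : Fin n) :
    frameCov h x a b c = frameCov h x a c b := by
  rw [frameCov_eq hs hh, frameCov_eq hs hh]
  simp only [frameComp_symm hs _ b c]
  ring

theorem sum_frameDeriv_mul_bochnerField (V : EuclideanSpace ℝ (Fin n) → ℝ)
    (x : EuclideanSpace ℝ (Fin n)) :
    ∑ a, frameDeriv a V x * bochnerField h x a =
      ∑ d, ∑ b, ∑ a, frameDeriv a V x * frameComp h x b d * frameCov h x d b a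
      - ∑ b, contractGrad h V x b * ∑ d, frameCov h x d d b := by
  have e1 : ∑ a, ∑ b, ∑ c, frameDeriv a V x * (frameComp h x b c * frameCov h x b a c) =
      ∑ d, ∑ b, ∑ a, frameDeriv a V x * frameComp h x b d * frameCov h x d b a := by
    rw [← sum3_rotate fun a b c => frameDeriv a V x * (frameComp h x b c * frameCov h x b a c)]
    refine Finset.sum_congr rfl fun b _ => Finset.sum_congr rfl fun c _ =>
      Finset.sum_congr rfl fun a _ => ?_
    rw [frameComp_symm hs x b c, frameCov_symm hs hh x b a c]; ring
  have e2 : ∑ a, ∑ b, ∑ c, frameDeriv a V x * (frameComp h x a c * frameCov h x b b c) =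
      ∑ b, contractGrad h V x b * ∑ d, frameCov h x d d b := by
    simp only [contractGrad, Finset.sum_mul_sum]
    rw [← sum3_rotate fun a b c => frameDeriv a V x * (frameComp h x a c * frameCov h x b b c),
      sum3_rotate fun a b c => frameDeriv a V x * (frameComp h x a c * frameCov h x b b c),
      ← sum3_rotate fun c a b =>
        frameComp h x c a * frameDeriv a V x * frameCov h x b b c]
    refine Finset.sum_congr rfl fun a _ => Finset.sum_congr rfl fun b _ =>
      Finset.sum_congr rfl fun c _ => ?_
    rw [frameComp_symm hs x a c]; ring
  rw [← e1, ← e2, ← Finset.sum_sub_distrib]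
  refine Finset.sum_congr rfl fun a _ => ?_
  simp only [bochnerField, Finset.mul_sum, ← Finset.sum_sub_distrib, mul_sub]

end

/-- The field `Z = X - V U`, where `X` is the flux and `U` the Bochner field. -/
noncomputable def boundaryField (h : Field2 n) (V : EuclideanSpace ℝ (Fin n) → ℝ)
    (x : EuclideanSpace ℝ (Fin n)) (a : Fin n) : ℝ :=
  frameFlux h V x a - V x * bochnerField h x a

section
variable {h : Field2 n} (hs : ∀ x i j, h x i j = h x j i)
  (hh : ∀ i j, ContDiff ℝ 2 fun x => h x i j) (ht : ∀ x, ∑ a, frameComp h x a a = 0)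
include hs hh

theorem contDiff_boundaryField {V : EuclideanSpace ℝ (Fin n) → ℝ} (hV : ContDiff ℝ 2 V)
    (a : Fin n) : ContDiff ℝ 1 (fun x => boundaryField h V x a) :=
  (contDiff_frameFlux hh hV a).sub ((hV.of_le (by norm_num)).mul (contDiff_bochnerField hs hh a))

include ht

theorem frameDiv_boundaryField {A0 : ℝ} {A x : EuclideanSpace ℝ (Fin n)}
    (hpos : staticKID A0 A x ≠ 0) :
    frameDiv (boundaryField h (staticKID A0 A)) x =
      (n + 1) * (normSq2 (hypMetric n x) (h x) * staticKID A0 A x)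
      - (∑ b, contractGrad h (staticKID A0 A) x b ^ 2) * (staticKID A0 A x)⁻¹
      + normSq1 (hypMetric n x) (fun i => tensorDiv (hypMetric n) h x i
          - contractDV (hypMetric n) h (staticKID A0 A) x i) * staticKID A0 A x
      - (normSq3 (hypMetric n x) (cov (hypMetric n) h x)
          - normSq3 (hypMetric n x) (curlOp (hypMetric n) h x)) * staticKID A0 A x := by
  have hV : ContDiff ℝ 2 (staticKID A0 A) := contDiff_staticKID A0 A
  have d1 := fun a => (contDiff_frameFlux hh hV a).differentiable one_ne_zero x
  have d2 := hV.differentiable two_ne_zero x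
  have d3 := fun a => (contDiff_bochnerField hs hh a).differentiable one_ne_zero x
  have e1 : frameDiv (boundaryField h (staticKID A0 A)) x = _ :=
    frameDiv_sub d1 fun a => d2.fun_mul (d3 a)
  rw [e1, frameDiv_mul d2 d3, frameDiv_bochnerField hs hh ht, frameDiv_frameFlux hs hh ht,
    sum_frameDeriv_mul_bochnerField hs hh, normSq3_curlOp, normSq1_div_sub, normSq2_eq]
  have e2 : ∑ a, (∑ b, frameCov h x b b a
      + (staticKID A0 A x)⁻¹ * contractGrad h (staticKID A0 A) x a) ^ 2 =
      ∑ a, (∑ b, frameCov h x b b a) * ∑ b, frameCov h x b b a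
      + 2 * (staticKID A0 A x)⁻¹ * ∑ a, contractGrad h (staticKID A0 A) x a *
          ∑ b, frameCov h x b b a
      + (staticKID A0 A x)⁻¹ ^ 2 * ∑ a, contractGrad h (staticKID A0 A) x a ^ 2 := by
    rw [Finset.mul_sum, Finset.mul_sum, ← Finset.sum_add_distrib, ← Finset.sum_add_distrib]
    exact Finset.sum_congr rfl fun a _ => by ring
  rw [e2]
  simp only [sq (frameComp h x _ _)]
  generalize staticKID A0 A x = v at *
  field_simp
  ring

end

section bounds

theorem sq_frameComp_le (h : Field2 n) (x : EuclideanSpace ℝ (Fin n)) (b c : Fin n) :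
    frameComp h x b c ^ 2 ≤ normSq2 (hypMetric n x) (h x) := by
  rw [normSq2_eq]
  exact (Finset.single_le_sum (f := fun c => frameComp h x b c ^ 2) (fun _ _ => sq_nonneg _)
    (Finset.mem_univ c)).trans (Finset.single_le_sum (f := fun b => ∑ c, frameComp h x b c ^ 2)
      (fun _ _ => Finset.sum_nonneg fun _ _ => sq_nonneg _) (Finset.mem_univ b))

theorem sq_frameCov_le (h : Field2 n) (x : EuclideanSpace ℝ (Fin n)) (a b c : Fin n) :
    frameCov h x a b c ^ 2 ≤ normSq3 (hypMetric n x) (cov (hypMetric n) h x) := by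
  rw [normSq3_cov]
  exact (Finset.single_le_sum (f := fun c => frameCov h x a b c ^ 2) (fun _ _ => sq_nonneg _)
    (Finset.mem_univ c)).trans ((Finset.single_le_sum (f := fun b => ∑ c, frameCov h x a b c ^ 2)
      (fun _ _ => Finset.sum_nonneg fun _ _ => sq_nonneg _) (Finset.mem_univ b)).trans
      (Finset.single_le_sum (f := fun a => ∑ b, ∑ c, frameCov h x a b c ^ 2)
      (fun _ _ => Finset.sum_nonneg fun _ _ => Finset.sum_nonneg fun _ _ => sq_nonneg _)
      (Finset.mem_univ a)))

theorem normSq2_nonneg (h : Field2 n) (x : EuclideanSpace ℝ (Fin n)) :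
    0 ≤ normSq2 (hypMetric n x) (h x) := by
  rw [normSq2_eq]; positivity

theorem normSq3_nonneg (x : EuclideanSpace ℝ (Fin n)) (T : Fin n → Fin n → Fin n → ℝ) :
    0 ≤ normSq3 (hypMetric n x) T := by
  rw [normSq3_eq]; positivity

theorem normSq1_nonneg (x : EuclideanSpace ℝ (Fin n)) (α : Fin n → ℝ) :
    0 ≤ normSq1 (hypMetric n x) α := by
  rw [normSq1_eq]; positivity

theorem abs_mul_le_add {s t m M : ℝ} (hs : s ^ 2 ≤ m) (ht : t ^ 2 ≤ M) : |s * t| ≤ m + M := by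
  have h1 := sq_nonneg s
  have h2 := sq_nonneg t
  refine abs_le.2 ⟨?_, ?_⟩
  · nlinarith [sq_nonneg (s + t)]
  · nlinarith [sq_nonneg (s - t)]

theorem abs_sum_le_card_mul {ι : Type*} [Fintype ι] (f : ι → ℝ) {B : ℝ} (hB : ∀ i, |f i| ≤ B) :
    |∑ i, f i| ≤ Fintype.card ι * B := by
  refine (Finset.abs_sum_le_sum_abs _ _).trans ?_
  simpa using Finset.sum_le_card_nsmul Finset.univ (fun i => |f i|) B fun i _ => hB i

variable {A0 : ℝ} {A : EuclideanSpace ℝ (Fin n)} (hA : ‖A‖ ≤ A0)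
include hA

theorem sum_frameDeriv_sq_le (x : EuclideanSpace ℝ (Fin n)) :
    ∑ a, frameDeriv a (staticKID A0 A) x ^ 2 ≤ staticKID A0 A x ^ 2 := by
  have h1 := sum_frameDeriv_staticKID_sq A0 A x
  simp only [← sq] at h1
  have : ‖A‖ ^ 2 ≤ A0 ^ 2 := by gcongr
  linarith

/-- `|h(∇V)|² ≤ |h|² V²`, since `|∇V|² ≤ V²`. -/
theorem sum_contractGrad_sq_le (h : Field2 n) (x : EuclideanSpace ℝ (Fin n)) :
    ∑ b, contractGrad h (staticKID A0 A) x b ^ 2 ≤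
      normSq2 (hypMetric n x) (h x) * staticKID A0 A x ^ 2 := by
  rw [normSq2_eq, Finset.sum_mul]
  refine Finset.sum_le_sum fun b _ => (Finset.sum_mul_sq_le_sq_mul_sq _ _ _).trans ?_
  exact mul_le_mul_of_nonneg_left (sum_frameDeriv_sq_le hA x) (by positivity)

variable (h : Field2 n) {x : EuclideanSpace ℝ (Fin n)} (hV : 0 ≤ staticKID A0 A x)
include hV

theorem abs_frameDeriv_le (a : Fin n) : |frameDeriv a (staticKID A0 A) x| ≤ staticKID A0 A x :=
  abs_le_of_sq_le_sq ((Finset.single_le_sum (f := fun a => frameDeriv a (staticKID A0 A) x ^ 2)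
    (fun _ _ => sq_nonneg _) (Finset.mem_univ a)).trans (sum_frameDeriv_sq_le hA x)) hV

theorem abs_frameFlux_le (d : Fin n) : |frameFlux h (staticKID A0 A) x d| ≤
    n * (n * (2 * normSq2 (hypMetric n x) (h x) * staticKID A0 A x)) := by
  simp only [frameFlux, contractGrad, Finset.sum_mul]
  have := abs_sum_le_card_mul (ι := Fin n) (fun b => ∑ a, frameComp h x b a *
    frameDeriv a (staticKID A0 A) x * frameComp h x b d) fun b => abs_sum_le_card_mul _
    (B := 2 * normSq2 (hypMetric n x) (h x) * staticKID A0 A x) fun a => by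
      rw [mul_right_comm, abs_mul]
      refine mul_le_mul ?_ (abs_frameDeriv_le hA hV a) (abs_nonneg _)
        (mul_nonneg zero_le_two (normSq2_nonneg h x))
      rw [two_mul]
      exact abs_mul_le_add (sq_frameComp_le h x b a) (sq_frameComp_le h x b d)
  simpa using this

theorem abs_boundaryField_le (a : Fin n) : |boundaryField h (staticKID A0 A) x a| ≤
    4 * n ^ 2 * ((normSq2 (hypMetric n x) (h x) +
      normSq3 (hypMetric n x) (cov (hypMetric n) h x)) * staticKID A0 A x) := by
  set m := normSq2 (hypMetric n x) (h x)
  set M := normSq3 (hypMetric n x) (cov (hypMetric n) h x)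
  have hM : 0 ≤ M := normSq3_nonneg _ _
  have h1 := abs_frameFlux_le hA h hV a
  have h2 : |bochnerField h x a| ≤ n * (n * ((m + M) + (m + M))) := by
    have := abs_sum_le_card_mul (ι := Fin n) (fun b => ∑ c, (frameComp h x b c * frameCov h x b a c
      - frameComp h x a c * frameCov h x b b c)) fun b => abs_sum_le_card_mul _
      (B := (m + M) + (m + M)) fun c => (abs_sub _ _).trans (add_le_add
        (abs_mul_le_add (sq_frameComp_le h x b c) (sq_frameCov_le h x b a c))
        (abs_mul_le_add (sq_frameComp_le h x a c) (sq_frameCov_le h x b b c)))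
    rwa [Fintype.card_fin] at this
  rw [boundaryField]
  refine (abs_sub _ _).trans ?_
  rw [abs_mul, abs_of_nonneg hV]
  have h3 := mul_le_mul_of_nonneg_left h2 hV
  have h4 : (0 : ℝ) ≤ n ^ 2 * (M * staticKID A0 A x) := by positivity
  linarith

theorem normSq1_mul_le (hpos : 0 < staticKID A0 A x) :
    normSq1 (hypMetric n x) (fun i => tensorDiv (hypMetric n) h x i
          - contractDV (hypMetric n) h (staticKID A0 A) x i) * staticKID A0 A x ≤
    2 * (n ^ 3 + 1) * ((normSq2 (hypMetric n x) (h x) +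
      normSq3 (hypMetric n x) (cov (hypMetric n) h x)) * staticKID A0 A x) := by
  have hm : 0 ≤ normSq2 (hypMetric n x) (h x) := normSq2_nonneg _ _
  have h0 := sum_contractGrad_sq_le hA h x
  set m := normSq2 (hypMetric n x) (h x)
  set M := normSq3 (hypMetric n x) (cov (hypMetric n) h x)
  set v := staticKID A0 A x
  have hM : 0 ≤ M := normSq3_nonneg _ _
  have h1 : ∀ a, (∑ b, frameCov h x b b a + v⁻¹ * contractGrad h (staticKID A0 A) x a) ^ 2 ≤
      2 * (n * (n * M)) + 2 * v⁻¹ ^ 2 * contractGrad h (staticKID A0 A) x a ^ 2 := by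
    intro a
    have e1 : (∑ b, frameCov h x b b a) ^ 2 ≤ n * (n * M) := by
      refine sq_sum_le_card_mul_sum_sq.trans ?_
      rw [Finset.card_univ, Fintype.card_fin]
      refine mul_le_mul_of_nonneg_left ?_ (Nat.cast_nonneg n)
      simpa using Finset.sum_le_card_nsmul Finset.univ (fun b => frameCov h x b b a ^ 2) M
        fun b _ => sq_frameCov_le h x b b a
    nlinarith [sq_nonneg (∑ b, frameCov h x b b a - v⁻¹ * contractGrad h (staticKID A0 A) x a)]
  have h2 : normSq1 (hypMetric n x) (fun i => tensorDiv (hypMetric n) h x i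
          - contractDV (hypMetric n) h (staticKID A0 A) x i) ≤ 2 * n ^ 3 * M + 2 * m := by
    rw [normSq1_div_sub]
    refine (Finset.sum_le_sum fun a _ => h1 a).trans ?_
    simp only [Finset.sum_add_distrib, Finset.sum_const, Finset.card_univ, Fintype.card_fin,
      nsmul_eq_mul]
    rw [← Finset.mul_sum]
    have : v⁻¹ ^ 2 * ∑ a, contractGrad h (staticKID A0 A) x a ^ 2 ≤ m := by
      refine (mul_le_mul_of_nonneg_left h0 (by positivity)).trans_eq ?_
      field_simp
    linarith
  have h3 := mul_le_mul_of_nonneg_right h2 hV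
  have h4 : (0 : ℝ) ≤ n ^ 3 * (m * v) + M * v := by positivity
  linarith

variable {h} in
theorem abs_frameDiv_frameFlux_le (hs : ∀ x i j, h x i j = h x j i)
    (hh : ∀ i j, ContDiff ℝ 2 fun x => h x i j) (ht : ∀ x, ∑ a, frameComp h x a a = 0) :
    |frameDiv (frameFlux h (staticKID A0 A)) x| ≤
    2 * (n ^ 3 + 1) * ((normSq2 (hypMetric n x) (h x) +
      normSq3 (hypMetric n x) (cov (hypMetric n) h x)) * staticKID A0 A x) := by
  have hm : 0 ≤ normSq2 (hypMetric n x) (h x) := normSq2_nonneg _ _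
  set m := normSq2 (hypMetric n x) (h x) with hmdef
  set M := normSq3 (hypMetric n x) (cov (hypMetric n) h x)
  set v := staticKID A0 A x with hv
  have hM : 0 ≤ M := normSq3_nonneg _ _
  have hb : ∀ a s t, |s| ≤ m + M → t = frameDeriv a (staticKID A0 A) x * s →
      |t| ≤ (m + M) * v := by
    intro a s t hs ht
    rw [ht, abs_mul, mul_comm]
    exact mul_le_mul hs (abs_frameDeriv_le hA hV a) (abs_nonneg _) (by positivity)
  have h1 : |∑ d, ∑ b, ∑ a, frameDeriv a (staticKID A0 A) x * frameComp h x b d *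
      frameCov h x d b a| ≤ n * (n * (n * ((m + M) * v))) := by
    have := abs_sum_le_card_mul (ι := Fin n) (fun d => ∑ b, ∑ a, frameDeriv a (staticKID A0 A) x *
      frameComp h x b d * frameCov h x d b a) fun d => abs_sum_le_card_mul _ fun b =>
      abs_sum_le_card_mul _ fun a => hb a _ _
        (abs_mul_le_add (sq_frameComp_le h x b d) (sq_frameCov_le h x d b a)) (mul_assoc _ _ _)
    simpa using this
  have h2 : |∑ b, contractGrad h (staticKID A0 A) x b * ∑ d, frameCov h x d d b| ≤
      n * (n * (n * ((m + M) * v))) := by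
    simp only [contractGrad, Finset.sum_mul_sum]
    have := abs_sum_le_card_mul (ι := Fin n) (fun b => ∑ a, ∑ d, frameComp h x b a *
      frameDeriv a (staticKID A0 A) x * frameCov h x d d b) fun d => abs_sum_le_card_mul _ fun b =>
      abs_sum_le_card_mul _ fun a => hb b _ _
        (abs_mul_le_add (sq_frameComp_le h x d b) (sq_frameCov_le h x a a d)) (by ring)
    simpa using this
  have h3 : ∑ b, ∑ c, frameComp h x b c * frameComp h x b c = m := by
    simp only [hmdef, normSq2_eq, sq]
  rw [frameDiv_frameFlux hs hh ht, h3, ← hv]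
  refine (abs_add_le _ _).trans ((add_le_add_left (abs_add_le _ _) _).trans ?_)
  rw [abs_of_nonneg (by positivity : 0 ≤ v * m)]
  have h4 : (0 : ℝ) ≤ m * v + 2 * (M * v) := by positivity
  linarith

end bounds

/-! ### Integration by parts, cutoffs, and the divergence theorem -/

section measure

theorem riemVol_hypMetric : riemVol (hypMetric n) =
    volume.withDensity fun x => ENNReal.ofReal (√(1 + ‖x‖ ^ 2))⁻¹ := by
  simp only [riemVol, hypMetric_det, Real.sqrt_inv]

theorem continuous_density :
    Continuous fun x : EuclideanSpace ℝ (Fin n) => (√(1 + ‖x‖ ^ 2))⁻¹ :=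
  (contDiff_lapse (k := 0)).continuous.inv₀ fun x => by positivity

theorem integrable_riemVol_iff {f : EuclideanSpace ℝ (Fin n) → ℝ} :
    Integrable f (riemVol (hypMetric n)) ↔
      Integrable (fun x => (√(1 + ‖x‖ ^ 2))⁻¹ * f x) volume := by
  rw [riemVol_hypMetric, integrable_withDensity_iff_integrable_smul'
    continuous_density.measurable.ennreal_ofReal (by simp)]
  refine integrable_congr (Eventually.of_forall fun x => ?_)
  simp only [smul_eq_mul]
  rw [ENNReal.toReal_ofReal (by positivity)]

theorem integral_riemVol (f : EuclideanSpace ℝ (Fin n) → ℝ) :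
    ∫ x, f x ∂(riemVol (hypMetric n)) = ∫ x, (√(1 + ‖x‖ ^ 2))⁻¹ * f x := by
  rw [riemVol_hypMetric, integral_withDensity_eq_integral_toReal_smul
    continuous_density.measurable.ennreal_ofReal (by simp)]
  refine integral_congr_ae (Eventually.of_forall fun x => ?_)
  simp only [smul_eq_mul]
  rw [ENNReal.toReal_ofReal (by positivity)]

theorem integrable_riemVol_of_hasCompactSupport {f : EuclideanSpace ℝ (Fin n) → ℝ}
    (hf : Continuous f) (hc : HasCompactSupport f) : Integrable f (riemVol (hypMetric n)) :=
  integrable_riemVol_iff.2 ((continuous_density.mul hf).integrable_of_hasCompactSupport hc.mul_left)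

theorem aestronglyMeasurable_riemVol {f : EuclideanSpace ℝ (Fin n) → ℝ} (hf : Continuous f) :
    AEStronglyMeasurable f (riemVol (hypMetric n)) :=
  hf.aestronglyMeasurable

end measure

section parts

theorem pderiv_density (j : Fin n) (x : EuclideanSpace ℝ (Fin n)) :
    pderiv j (fun y => (√(1 + ‖y‖ ^ 2))⁻¹) x = - (√(1 + ‖x‖ ^ 2))⁻¹ ^ 3 * x j := by
  have h1 : HasDerivAt (fun t : ℝ => t⁻¹) (-((√(1 + ‖x‖ ^ 2)) ^ 2)⁻¹) (√(1 + ‖x‖ ^ 2)) :=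
    hasDerivAt_inv (by positivity)
  rw [pderiv_comp j h1 ((contDiff_lapse (k := 1)).differentiable one_ne_zero x), pderiv_lapse]
  ring

theorem sum_coord_mul_hypMetric (x : EuclideanSpace ℝ (Fin n)) (k : Fin n) :
    ∑ j, x j * hypMetric n x j k = (√(1 + ‖x‖ ^ 2))⁻¹ ^ 2 * x k := by
  have h0 : (1 + ‖x‖ ^ 2) ≠ 0 := by positivity
  have h1 : ∀ j, x j * hypMetric n x j k = (if j = k then x j else 0)
      - x k / (1 + ‖x‖ ^ 2) * (x j * x j) := fun j => by
    simp only [hypMetric, Matrix.of_apply]; split_ifs <;> ring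
  simp only [h1, Finset.sum_sub_distrib, ← Finset.mul_sum, sum_coord_mul_self, Finset.sum_ite_eq',
    Finset.mem_univ, if_true]
  rw [inv_pow, sq_lapse]
  field_simp
  ring

/-- The Riemannian divergence is the Euclidean divergence of the density times the field. -/
theorem density_mul_frameDiv {Z : EuclideanSpace ℝ (Fin n) → Fin n → ℝ}
    {x : EuclideanSpace ℝ (Fin n)} (hZ : ∀ a, DifferentiableAt ℝ (fun y => Z y a) x) :
    (√(1 + ‖x‖ ^ 2))⁻¹ * frameDiv Z x =
      ∑ j, pderiv j (fun y => (√(1 + ‖y‖ ^ 2))⁻¹ * ∑ a, frame y j a * Z y a) x := by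
  have d1 : DifferentiableAt ℝ (fun y : EuclideanSpace ℝ (Fin n) => (√(1 + ‖y‖ ^ 2))⁻¹) x :=
    ((contDiff_lapse (k := 1)).differentiable one_ne_zero x).inv (by positivity)
  have d2 : ∀ j, DifferentiableAt ℝ (fun y => ∑ a, frame y j a * Z y a) x := fun j =>
    DifferentiableAt.fun_sum fun a _ =>
      ((contDiff_frame (k := 1) j a).differentiable one_ne_zero x).fun_mul (hZ a)
  rw [← vecDiv_eq_frameDiv hZ]
  simp only [fun j => pderiv_mul j d1 (d2 j), pderiv_density, vecDiv, christoffel_hypMetric]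
  set W : Fin n → ℝ := fun k => ∑ a, frame x k a * Z x a
  have e1 : ∑ j, ∑ k, - x j * hypMetric n x j k * W k =
      - ((√(1 + ‖x‖ ^ 2))⁻¹ ^ 2 * ∑ k, x k * W k) := by
    rw [Finset.sum_comm, Finset.mul_sum, ← Finset.sum_neg_distrib]
    refine Finset.sum_congr rfl fun k _ => ?_
    rw [← mul_assoc, ← sum_coord_mul_hypMetric, Finset.sum_mul, ← Finset.sum_neg_distrib]
    exact Finset.sum_congr rfl fun j _ => by ring
  rw [Finset.sum_add_distrib, e1, Finset.sum_add_distrib, mul_add, Finset.mul_sum]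
  congr 1
  rw [Finset.mul_sum, ← Finset.sum_neg_distrib, Finset.mul_sum]
  exact Finset.sum_congr rfl fun j _ => by ring

theorem continuous_frameDeriv {f : EuclideanSpace ℝ (Fin n) → ℝ} (hf : ContDiff ℝ 1 f)
    (a : Fin n) : Continuous (frameDeriv a f) :=
  (contDiff_frameDeriv (k := 0) hf (by norm_num) a).continuous

theorem continuous_frameDiv {Z : EuclideanSpace ℝ (Fin n) → Fin n → ℝ}
    (hZ : ∀ a, ContDiff ℝ 1 (fun x => Z x a)) : Continuous (frameDiv Z) :=
  continuous_finsetSum _ fun a _ => (continuous_frameDeriv (hZ a) a).add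
    ((continuous_const.mul (contDiff_ballCoord (k := 0) a).continuous).mul (hZ a).continuous)

theorem integral_mul_frameDiv {χ : EuclideanSpace ℝ (Fin n) → ℝ} (hχ : ContDiff ℝ 1 χ)
    (hc : HasCompactSupport χ) {Z : EuclideanSpace ℝ (Fin n) → Fin n → ℝ}
    (hZ : ∀ a, ContDiff ℝ 1 (fun x => Z x a)) :
    ∫ x, χ x * frameDiv Z x ∂(riemVol (hypMetric n)) =
      - ∫ x, ∑ a, frameDeriv a χ x * Z x a ∂(riemVol (hypMetric n)) := by
  set Y : Fin n → EuclideanSpace ℝ (Fin n) → ℝ := fun j y =>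
    (√(1 + ‖y‖ ^ 2))⁻¹ * ∑ a, frame y j a * Z y a with hY
  have hYd : ∀ j, ContDiff ℝ 1 (Y j) := fun j =>
    (contDiff_lapse.inv fun x => by positivity).mul
      (ContDiff.sum fun a _ => (contDiff_frame j a).mul (hZ a))
  have hpχ : ∀ j, Continuous (pderiv j χ) := fun j =>
    (contDiff_pderiv (k := 0) hχ (by norm_num) j).continuous
  have hpY : ∀ j, Continuous (pderiv j (Y j)) := fun j =>
    (contDiff_pderiv (k := 0) (hYd j) (by norm_num) j).continuous
  have hpc : ∀ j, HasCompactSupport (pderiv j χ) := fun j =>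
    hc.fderiv_apply (𝕜 := ℝ) (EuclideanSpace.single j 1)
  have i1 : ∀ j, Integrable (fun x => pderiv j χ x * Y j x) volume := fun j =>
    ((hpχ j).mul (hYd j).continuous).integrable_of_hasCompactSupport (hpc j).mul_right
  have i2 : ∀ j, Integrable (fun x => χ x * pderiv j (Y j) x) volume := fun j =>
    (hχ.continuous.mul (hpY j)).integrable_of_hasCompactSupport hc.mul_right
  have i3 : ∀ j, Integrable (fun x => χ x * Y j x) volume := fun j =>
    (hχ.continuous.mul (hYd j).continuous).integrable_of_hasCompactSupport hc.mul_right
  have key : ∀ j, ∫ x, χ x * pderiv j (Y j) x = - ∫ x, pderiv j χ x * Y j x := fun j =>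
    integral_mul_fderiv_eq_neg_fderiv_mul_of_integrable (i1 j) (i2 j) (i3 j)
      (fun x _ => hχ.differentiable one_ne_zero x)
      (fun x _ => (hYd j).differentiable one_ne_zero x)
  have e1 : ∀ x, (√(1 + ‖x‖ ^ 2))⁻¹ * (χ x * frameDiv Z x) = ∑ j, χ x * pderiv j (Y j) x := by
    intro x
    rw [mul_left_comm, density_mul_frameDiv fun a => (hZ a).differentiable one_ne_zero x,
      Finset.mul_sum]
  have e2 : ∀ x, (√(1 + ‖x‖ ^ 2))⁻¹ * ∑ a, frameDeriv a χ x * Z x a =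
      ∑ j, pderiv j χ x * Y j x := by
    intro x
    simp only [hY, frameDeriv, Finset.mul_sum, Finset.sum_mul]
    rw [Finset.sum_comm]
    exact Finset.sum_congr rfl fun j _ => Finset.sum_congr rfl fun a _ => by ring
  rw [integral_riemVol, integral_riemVol]
  simp only [e1, e2]
  rw [integral_finsetSum _ fun j _ => i2 j, integral_finsetSum _ fun j _ => i1 j,
    ← Finset.sum_neg_distrib]
  exact Finset.sum_congr rfl fun j _ => key j

end parts

section cutoff

/-- A cutoff equal to `1` for `r ≤ R` and to `0` for `r ≥ √2 R`. The estimates use only that it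
vanishes for `r ≥ 2R`. -/
noncomputable def cutoff (R : ℝ) (x : EuclideanSpace ℝ (Fin n)) : ℝ :=
  Real.smoothTransition (2 - ‖x‖ ^ 2 / R ^ 2)

theorem contDiff_cutoff (R : ℝ) : ContDiff ℝ 1 (cutoff R : EuclideanSpace ℝ (Fin n) → ℝ) :=
  (Real.smoothTransition.contDiff (n := 1)).comp
    (contDiff_const.sub ((contDiff_norm_sq ℝ).div_const _))

theorem cutoff_nonneg (R : ℝ) (x : EuclideanSpace ℝ (Fin n)) : 0 ≤ cutoff R x :=
  Real.smoothTransition.nonneg _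

theorem cutoff_le_one (R : ℝ) (x : EuclideanSpace ℝ (Fin n)) : cutoff R x ≤ 1 :=
  Real.smoothTransition.le_one _

theorem cutoff_eq_one {R : ℝ} (hR : 0 < R) {x : EuclideanSpace ℝ (Fin n)} (hx : ‖x‖ ≤ R) :
    cutoff R x = 1 := by
  refine Real.smoothTransition.one_of_one_le ?_
  have : ‖x‖ ^ 2 / R ^ 2 ≤ 1 := div_le_one_of_le₀ (by gcongr) (by positivity)
  linarith

theorem cutoff_eq_zero {R : ℝ} (hR : 0 < R) {x : EuclideanSpace ℝ (Fin n)} (hx : 2 * R ≤ ‖x‖) :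
    cutoff R x = 0 := by
  refine Real.smoothTransition.zero_of_nonpos ?_
  have : 2 ≤ ‖x‖ ^ 2 / R ^ 2 := by
    rw [le_div_iff₀ (by positivity)]
    nlinarith
  linarith

theorem hasCompactSupport_cutoff {R : ℝ} (hR : 0 < R) :
    HasCompactSupport (cutoff R : EuclideanSpace ℝ (Fin n) → ℝ) := by
  refine HasCompactSupport.intro (isCompact_closedBall (0 : EuclideanSpace ℝ (Fin n)) (2 * R))
    fun x hx => cutoff_eq_zero hR ?_
  rw [mem_closedBall_zero_iff, not_le] at hx
  exact hx.le

theorem frameDeriv_eq_zero_of_eventuallyEq {f : EuclideanSpace ℝ (Fin n) → ℝ} {c : ℝ}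
    {x : EuclideanSpace ℝ (Fin n)} (hf : f =ᶠ[nhds x] fun _ => c) (a : Fin n) :
    frameDeriv a f x = 0 := by
  simp [frameDeriv, pderiv, hf.fderiv_eq]

theorem frameDeriv_cutoff_of_norm_lt {R : ℝ} (hR : 0 < R) {x : EuclideanSpace ℝ (Fin n)}
    (hx : ‖x‖ < R) (a : Fin n) : frameDeriv a (cutoff R) x = 0 := by
  refine frameDeriv_eq_zero_of_eventuallyEq (c := 1) ?_ a
  filter_upwards [(isOpen_lt continuous_norm continuous_const).mem_nhds hx] with y hy
  exact cutoff_eq_one hR (le_of_lt hy)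

theorem frameDeriv_cutoff_of_lt_norm {R : ℝ} (hR : 0 < R) {x : EuclideanSpace ℝ (Fin n)}
    (hx : 2 * R < ‖x‖) (a : Fin n) : frameDeriv a (cutoff R) x = 0 := by
  refine frameDeriv_eq_zero_of_eventuallyEq (c := 0) ?_ a
  filter_upwards [(isOpen_lt continuous_const continuous_norm).mem_nhds hx] with y hy
  exact cutoff_eq_zero hR (le_of_lt hy)

/-- The hyperbolic gradients of the cutoffs are bounded uniformly in the radius: the cutoff varies
over a region of bounded hyperbolic width. -/
theorem exists_frameDeriv_cutoff_le : ∃ K : ℝ, 0 ≤ K ∧ ∀ R : ℝ, 1 ≤ R → ∀ (a : Fin n)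
    (x : EuclideanSpace ℝ (Fin n)), |frameDeriv a (cutoff R) x| ≤ K := by
  have hc : ContDiff ℝ 1 Real.smoothTransition := Real.smoothTransition.contDiff (n := 1)
  obtain ⟨K, hK⟩ := (isCompact_Icc (a := (-2 : ℝ)) (b := 2)).exists_bound_of_continuousOn
    (hc.continuous_deriv (le_refl _)).continuousOn
  have hK0 : 0 ≤ K := (norm_nonneg _).trans (hK 0 (by norm_num))
  refine ⟨12 * K, by positivity, fun R hR a x => ?_⟩
  have hR0 : 0 < R := by linarith
  rcases lt_or_ge (2 * R) ‖x‖ with hx | hx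
  · rw [frameDeriv_cutoff_of_lt_norm hR0 hx, abs_zero]; positivity
  have hd : DifferentiableAt ℝ (fun y : EuclideanSpace ℝ (Fin n) => ‖y‖ ^ 2) x :=
    ((contDiff_norm_sq ℝ (n := 1)).differentiable one_ne_zero) x
  set s := 2 - ‖x‖ ^ 2 / R ^ 2 with hs
  have hp : HasDerivAt (fun t => Real.smoothTransition (2 - t / R ^ 2))
      (deriv Real.smoothTransition s * (-(1 / R ^ 2))) (‖x‖ ^ 2) := by
    have hq : HasDerivAt (fun t : ℝ => 2 - t / R ^ 2) (-(1 / R ^ 2)) (‖x‖ ^ 2) :=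
      ((hasDerivAt_id' (‖x‖ ^ 2)).div_const (R ^ 2)).const_sub 2
    have hS : HasDerivAt Real.smoothTransition (deriv Real.smoothTransition s)
        (2 - ‖x‖ ^ 2 / R ^ 2) := (hc.differentiable one_ne_zero s).hasDerivAt
    exact hS.comp (‖x‖ ^ 2) hq
  have e : frameDeriv a (cutoff R) x = deriv Real.smoothTransition s * (-(1 / R ^ 2)) *
      (2 * (√(1 + ‖x‖ ^ 2) * x a)) := by
    rw [← frameDeriv_normSq]
    exact frameDeriv_comp a hp hd
  have h1 : ‖x‖ ^ 2 / R ^ 2 ≤ 4 := by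
    rw [div_le_iff₀ (by positivity)]
    nlinarith [norm_nonneg x]
  have h2 : 0 ≤ ‖x‖ ^ 2 / R ^ 2 := by positivity
  have h3 := hK s ⟨by linarith, by linarith⟩
  rw [Real.norm_eq_abs] at h3
  have h4 : √(1 + ‖x‖ ^ 2) ≤ 3 * R :=
    Real.sqrt_le_iff.2 ⟨by positivity, by nlinarith [norm_nonneg x]⟩
  have h5 : |x a| ≤ 2 * R := (PiLp.norm_apply_le x a).trans hx
  rw [e, abs_mul, abs_mul, abs_mul, abs_mul, abs_neg, abs_of_pos (by positivity : 0 < 1 / R ^ 2),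
    abs_two, abs_of_nonneg (Real.sqrt_nonneg _)]
  calc |deriv Real.smoothTransition s| * (1 / R ^ 2) * (2 * (√(1 + ‖x‖ ^ 2) * |x a|))
      ≤ K * (1 / R ^ 2) * (2 * (3 * R * (2 * R))) := by gcongr
    _ = 12 * K := by field_simp; ring

end cutoff

theorem tendsto_cutoff (x : EuclideanSpace ℝ (Fin n)) :
    Tendsto (fun k : ℕ => cutoff ((k : ℝ) + 1) x) atTop (nhds 1) := by
  refine tendsto_const_nhds.congr' ?_
  filter_upwards [eventually_ge_atTop ⌈‖x‖⌉₊] with k hk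
  refine (cutoff_eq_one (by positivity) ?_).symm
  have := Nat.ceil_le.1 hk
  linarith

theorem tendsto_frameDeriv_cutoff (a : Fin n) (x : EuclideanSpace ℝ (Fin n)) :
    Tendsto (fun k : ℕ => frameDeriv a (cutoff ((k : ℝ) + 1)) x) atTop (nhds 0) := by
  refine tendsto_const_nhds.congr' ?_
  filter_upwards [eventually_ge_atTop ⌈‖x‖⌉₊] with k hk
  refine (frameDeriv_cutoff_of_norm_lt (by positivity) ?_ a).symm
  have := Nat.ceil_le.1 hk
  linarith

/-- Gaffney's divergence theorem: an integrable `C¹` field on the complete space `ℍⁿ` whose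
divergence is integrable has divergence of integral zero. -/
theorem integral_frameDiv_eq_zero {Z : EuclideanSpace ℝ (Fin n) → Fin n → ℝ}
    (hZ : ∀ a, ContDiff ℝ 1 (fun x => Z x a)) {F : EuclideanSpace ℝ (Fin n) → ℝ}
    (hF : Integrable F (riemVol (hypMetric n))) (hZF : ∀ x a, |Z x a| ≤ F x)
    (hdiv : Integrable (frameDiv Z) (riemVol (hypMetric n))) :
    ∫ x, frameDiv Z x ∂(riemVol (hypMetric n)) = 0 := by
  obtain ⟨K, hK0, hK⟩ := exists_frameDeriv_cutoff_le (n := n)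
  have hk : ∀ k : ℕ, (1 : ℝ) ≤ k + 1 := fun k => by linarith [Nat.cast_nonneg (α := ℝ) k]
  have hk0 : ∀ k : ℕ, (0 : ℝ) < k + 1 := fun k => by positivity
  have t1 : Tendsto (fun k : ℕ => ∫ x, cutoff ((k : ℝ) + 1) x * frameDiv Z x
      ∂(riemVol (hypMetric n))) atTop (nhds (∫ x, frameDiv Z x ∂(riemVol (hypMetric n)))) := by
    refine tendsto_integral_of_dominated_convergence (fun x => ‖frameDiv Z x‖)
      (fun k => aestronglyMeasurable_riemVol
        ((contDiff_cutoff _).continuous.mul (continuous_frameDiv hZ))) hdiv.norm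
      (fun k => Eventually.of_forall fun x => ?_) (Eventually.of_forall fun x => ?_)
    · rw [norm_mul, Real.norm_of_nonneg (cutoff_nonneg _ _)]
      exact mul_le_of_le_one_left (norm_nonneg _) (cutoff_le_one _ _)
    · simpa using (tendsto_cutoff x).mul_const (frameDiv Z x)
  have t2 : Tendsto (fun k : ℕ => ∫ x, ∑ a, frameDeriv a (cutoff ((k : ℝ) + 1)) x * Z x a
      ∂(riemVol (hypMetric n))) atTop (nhds (∫ _, 0 ∂(riemVol (hypMetric n)))) := by
    refine tendsto_integral_of_dominated_convergence (fun x => n * (K * F x))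
      (fun k => aestronglyMeasurable_riemVol (continuous_finsetSum _ fun a _ =>
        (continuous_frameDeriv (contDiff_cutoff _) a).mul (hZ a).continuous))
      ((hF.const_mul K).const_mul n)
      (fun k => Eventually.of_forall fun x => ?_) (Eventually.of_forall fun x => ?_)
    · have := abs_sum_le_card_mul (fun a => frameDeriv a (cutoff ((k : ℝ) + 1)) x * Z x a)
        (B := K * F x) fun a => by
          rw [abs_mul]
          exact mul_le_mul (hK _ (hk k) a x) (hZF x a) (abs_nonneg _) hK0
      rwa [Fintype.card_fin] at this
    · have := tendsto_finsetSum (Finset.univ : Finset (Fin n)) fun a _ =>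
        (tendsto_frameDeriv_cutoff a x).mul_const (Z x a)
      simpa using this
  simp only [fun k => integral_mul_frameDiv (contDiff_cutoff _) (hasCompactSupport_cutoff (hk0 k))
    hZ] at t1
  rw [integral_zero] at t2
  have := tendsto_nhds_unique t1 t2.neg
  simpa using this

/-! ### Integrability of `|h|² V` and the inequality -/

theorem continuous_normSq2 {h : Field2 n} (hh : ∀ i j, ContDiff ℝ 2 fun x => h x i j) :
    Continuous fun x => normSq2 (hypMetric n x) (h x) := by
  simp only [normSq2_eq]
  exact continuous_finsetSum _ fun b _ => continuous_finsetSum _ fun c _ =>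
    (contDiff_frameComp hh b c).continuous.pow 2

theorem continuous_staticKID (A0 : ℝ) (A : EuclideanSpace ℝ (Fin n)) :
    Continuous (staticKID A0 A) := (contDiff_staticKID A0 A (k := 0)).continuous

theorem staticKID_zero : staticKID 0 (0 : EuclideanSpace ℝ (Fin n)) = fun _ => 0 := by
  funext x; simp [staticKID]

theorem vecDiv_fluxField {h : Field2 n} (hs : ∀ x i j, h x i j = h x j i)
    (hh : ∀ i j, ContDiff ℝ 2 fun x => h x i j) {V : EuclideanSpace ℝ (Fin n) → ℝ}
    (hV : ContDiff ℝ 2 V) (x : EuclideanSpace ℝ (Fin n)) :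
    vecDiv (hypMetric n) (fluxField (hypMetric n) h V) x = frameDiv (frameFlux h V) x := by
  have : fluxField (hypMetric n) h V = fun y j => ∑ d, frame y j d * frameFlux h V y d :=
    funext fun y => funext fun j => fluxField_eq hs V y j
  rw [this]
  exact vecDiv_eq_frameDiv fun a => (contDiff_frameFlux hh hV a).differentiable one_ne_zero x

section curl
variable {h : Field2 n}

theorem normSq3_curlOp_le (h : Field2 n) (x : EuclideanSpace ℝ (Fin n)) :
    normSq3 (hypMetric n x) (curlOp (hypMetric n) h x) ≤
      (1 + 2 * n ^ 3) * normSq3 (hypMetric n x) (cov (hypMetric n) h x) := by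
  rw [normSq3_curlOp]
  set M := normSq3 (hypMetric n x) (cov (hypMetric n) h x)
  have := abs_sum_le_card_mul (ι := Fin n) (fun a => ∑ b, ∑ c, frameCov h x a b c *
    frameCov h x b a c) fun a => abs_sum_le_card_mul _ fun b => abs_sum_le_card_mul _
    (B := M + M) fun c => abs_mul_le_add (sq_frameCov_le h x a b c) (sq_frameCov_le h x b a c)
  rw [Fintype.card_fin] at this
  have := (abs_le.1 this).1
  linarith

variable (hs : ∀ x i j, h x i j = h x j i) (hh : ∀ i j, ContDiff ℝ 2 fun x => h x i j)
include hs hh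

theorem continuous_normSq3_cov :
    Continuous fun x => normSq3 (hypMetric n x) (cov (hypMetric n) h x) := by
  simp only [normSq3_cov]
  exact continuous_finsetSum _ fun a _ => continuous_finsetSum _ fun b _ =>
    continuous_finsetSum _ fun c _ => (contDiff_frameCov hs hh a b c).continuous.pow 2

theorem continuous_normSq3_curlOp :
    Continuous fun x => normSq3 (hypMetric n x) (curlOp (hypMetric n) h x) := by
  simp only [normSq3_curlOp]
  exact (continuous_normSq3_cov hs hh).sub (continuous_finsetSum _ fun a _ =>
    continuous_finsetSum _ fun b _ => continuous_finsetSum _ fun c _ =>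
      (contDiff_frameCov hs hh a b c).continuous.mul (contDiff_frameCov hs hh b a c).continuous)

theorem continuous_normSq1_div_sub {V : EuclideanSpace ℝ (Fin n) → ℝ} (hV : ContDiff ℝ 2 V)
    (h0 : ∀ x, V x ≠ 0) : Continuous fun x => normSq1 (hypMetric n x)
      (fun i => tensorDiv (hypMetric n) h x i - contractDV (hypMetric n) h V x i) := by
  simp only [normSq1_div_sub]
  exact continuous_finsetSum _ fun a _ => ((continuous_finsetSum _ fun b _ =>
    (contDiff_frameCov hs hh b b a).continuous).add
      ((hV.continuous.inv₀ h0).mul (contDiff_contractGrad hh hV a).continuous)).pow 2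

end curl

/-- The decay hypothesis, squared. -/
theorem exists_normSq2_le_of_isBigO {h : Field2 n}
    (h_decay : (fun x => √(normSq2 (hypMetric n x) (h x)))
      =O[cocompact (EuclideanSpace ℝ (Fin n))] fun x => ‖x‖ ^ (-(n : ℝ) / 2)) :
    ∃ C R₀ : ℝ, 0 ≤ C ∧ ∀ x : EuclideanSpace ℝ (Fin n), R₀ ≤ ‖x‖ →
      normSq2 (hypMetric n x) (h x) ≤ C * (‖x‖ ^ n)⁻¹ := by
  obtain ⟨c, hc⟩ := h_decay.bound
  rw [← Metric.cobounded_eq_cocompact, hasBasis_cobounded_norm.eventually_iff] at hc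
  obtain ⟨R₀, -, hR⟩ := hc
  refine ⟨c ^ 2, R₀, sq_nonneg _, fun x hx => ?_⟩
  have h1 := hR hx
  rw [Real.norm_of_nonneg (Real.sqrt_nonneg _), Real.norm_of_nonneg (by positivity)] at h1
  have h2 : (‖x‖ ^ (-(n : ℝ) / 2)) ^ 2 = (‖x‖ ^ n)⁻¹ := by
    rw [← Real.rpow_natCast, ← Real.rpow_mul (norm_nonneg x), ← Real.rpow_natCast,
      ← Real.rpow_neg (norm_nonneg x)]
    congr 1
    push_cast
    ring
  rw [← Real.sq_sqrt (normSq2_nonneg h x), ← h2, ← mul_pow]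
  gcongr

section main

variable {h : Field2 n} {A0 : ℝ} {A : EuclideanSpace ℝ (Fin n)}

/-- Over the annuli `R ≤ r ≤ 2R` the integral of `|h|² V` stays bounded: the decay rate is the
borderline one. -/
theorem exists_setIntegral_annulus_le (hA : ‖A‖ ≤ A0)
    (h_decay : (fun x => √(normSq2 (hypMetric n x) (h x)))
      =O[cocompact (EuclideanSpace ℝ (Fin n))] fun x => ‖x‖ ^ (-(n : ℝ) / 2))
    (hV : ∀ x, 0 ≤ staticKID A0 A x) :
    ∃ B R₀ : ℝ, ∀ R, 1 ≤ R → R₀ ≤ R →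
      ∫ x, Set.indicator {x | R ≤ ‖x‖ ∧ ‖x‖ ≤ 2 * R}
        (fun x => normSq2 (hypMetric n x) (h x) * staticKID A0 A x) x ∂(riemVol (hypMetric n))
      ≤ B := by
  obtain ⟨C, R₀, hC, hCR⟩ := exists_normSq2_le_of_isBigO h_decay
  have hA0 : 0 ≤ A0 := (norm_nonneg A).trans hA
  refine ⟨2 * A0 * C * 2 ^ n *
    (volume : Measure (EuclideanSpace ℝ (Fin n))).real (Metric.ball 0 1), R₀,
    fun R hR hR₀ => ?_⟩
  have hRp : 0 < R := by linarith
  set S : Set (EuclideanSpace ℝ (Fin n)) := {x | R ≤ ‖x‖ ∧ ‖x‖ ≤ 2 * R} with hS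
  have hSm : MeasurableSet S :=
    (measurableSet_le measurable_const measurable_norm).inter
      (measurableSet_le measurable_norm measurable_const)
  have hSB : S ⊆ Metric.closedBall 0 (2 * R) := fun x hx => mem_closedBall_zero_iff.2 hx.2
  have hfin : volume (Metric.closedBall (0 : EuclideanSpace ℝ (Fin n)) (2 * R)) < ⊤ :=
    measure_closedBall_lt_top
  rw [integral_riemVol]
  have e1 : ∀ x, (√(1 + ‖x‖ ^ 2))⁻¹ * S.indicator
      (fun x => normSq2 (hypMetric n x) (h x) * staticKID A0 A x) x = S.indicator
      (fun x => (√(1 + ‖x‖ ^ 2))⁻¹ * (normSq2 (hypMetric n x) (h x) * staticKID A0 A x)) x :=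
    fun x => by by_cases hx : x ∈ S <;> simp [hx]
  simp only [e1]
  rw [integral_indicator hSm]
  refine (Real.le_norm_self _).trans ((norm_setIntegral_le_of_norm_le_const
    (C := 2 * A0 * (C * (R ^ n)⁻¹)) ((measure_mono hSB).trans_lt hfin) fun x hx => ?_).trans ?_)
  · -- the growth `V ≤ 2 A⁰ √(1 + r²)` is cancelled by the volume density
    have hm := normSq2_nonneg h x
    have h1 : normSq2 (hypMetric n x) (h x) ≤ C * (R ^ n)⁻¹ :=
      (hCR x (hR₀.trans hx.1)).trans (by gcongr; exact hx.1)
    have h2 : (√(1 + ‖x‖ ^ 2))⁻¹ * staticKID A0 A x ≤ 2 * A0 := by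
      rw [inv_mul_le_iff₀ (by positivity)]
      linarith [staticKID_le hA x]
    have h3 : 0 ≤ (√(1 + ‖x‖ ^ 2))⁻¹ * staticKID A0 A x := mul_nonneg (by positivity) (hV x)
    rw [mul_left_comm, mul_comm, Real.norm_of_nonneg (mul_nonneg h3 hm)]
    exact mul_le_mul h2 h1 hm (by positivity)
  · have h4 : volume.real S ≤ (2 * R) ^ n *
        (volume : Measure (EuclideanSpace ℝ (Fin n))).real (Metric.ball 0 1) := by
      refine (measureReal_mono hSB hfin.ne).trans_eq ?_
      rw [Measure.addHaar_real_closedBall _ _ (by positivity), finrank_euclideanSpace_fin]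
    refine (mul_le_mul_of_nonneg_left h4 (by positivity)).trans_eq ?_
    rw [mul_pow]
    field_simp

variable (hA : ‖A‖ ≤ A0) (hpos : ∀ x, 0 < staticKID A0 A x)
  (hs : ∀ x i j, h x i j = h x j i) (hh : ∀ i j, ContDiff ℝ 2 fun x => h x i j)
  (ht : ∀ x, ∑ a, frameComp h x a a = 0)
include hA hpos hs hh ht

/-- The pointwise estimate behind the inequality: `frameDiv_boundaryField` together with
`|h(∇V)|² ≤ |h|² V²`. -/
theorem mul_normSq2_le (x : EuclideanSpace ℝ (Fin n)) :
    n * (normSq2 (hypMetric n x) (h x) * staticKID A0 A x) ≤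
      (normSq3 (hypMetric n x) (cov (hypMetric n) h x)
        - normSq3 (hypMetric n x) (curlOp (hypMetric n) h x)
        - normSq1 (hypMetric n x) (fun i => tensorDiv (hypMetric n) h x i
          - contractDV (hypMetric n) h (staticKID A0 A) x i)) * staticKID A0 A x
      + frameDiv (boundaryField h (staticKID A0 A)) x := by
  have h1 : (∑ b, contractGrad h (staticKID A0 A) x b ^ 2) * (staticKID A0 A x)⁻¹ ≤
      normSq2 (hypMetric n x) (h x) * staticKID A0 A x := by
    rw [mul_inv_le_iff₀ (hpos x), mul_assoc, ← sq]
    exact sum_contractGrad_sq_le hA h x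
  rw [frameDiv_boundaryField hs hh ht (hpos x).ne']
  linarith

/-- Testing `mul_normSq2_le` against the cutoffs bounds the integrals of `|h|² V` over balls: the
boundary terms live on annuli, where they are controlled by `|∇h|² V ∈ L¹` and by the decay of `h`. -/
theorem integrable_normSq2_mul (hn : 0 < n)
    (h_decay : (fun x => √(normSq2 (hypMetric n x) (h x)))
      =O[cocompact (EuclideanSpace ℝ (Fin n))] fun x => ‖x‖ ^ (-(n : ℝ) / 2))
    (h_grad : Integrable (fun x => normSq3 (hypMetric n x) (cov (hypMetric n) h x) *
      staticKID A0 A x) (riemVol (hypMetric n))) :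
    Integrable (fun x => normSq2 (hypMetric n x) (h x) * staticKID A0 A x)
      (riemVol (hypMetric n)) := by
  set F : EuclideanSpace ℝ (Fin n) → ℝ := fun x =>
    normSq2 (hypMetric n x) (h x) * staticKID A0 A x with hF
  set G : EuclideanSpace ℝ (Fin n) → ℝ := fun x =>
    normSq3 (hypMetric n x) (cov (hypMetric n) h x) * staticKID A0 A x with hG
  set Z := boundaryField h (staticKID A0 A) with hZdef
  have hVc := continuous_staticKID A0 A
  have hFc : Continuous F := (continuous_normSq2 hh).mul hVc
  have hGc : Continuous G := (continuous_normSq3_cov hs hh).mul hVc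
  have hF0 : ∀ x, 0 ≤ F x := fun x => mul_nonneg (normSq2_nonneg h x) (hpos x).le
  have hG0 : ∀ x, 0 ≤ G x := fun x => mul_nonneg (normSq3_nonneg x _) (hpos x).le
  have hZ : ∀ a, ContDiff ℝ 1 (fun x => Z x a) :=
    contDiff_boundaryField hs hh (contDiff_staticKID A0 A)
  obtain ⟨B, R₀, hB⟩ := exists_setIntegral_annulus_le hA h_decay fun x => (hpos x).le
  obtain ⟨K, hK0, hK⟩ := exists_frameDeriv_cutoff_le (n := n)
  set c : ℝ := n * (K * (4 * n ^ 2)) with hc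
  have hc0 : 0 ≤ c := by positivity
  have hχF : ∀ R : ℝ, 0 < R → Integrable (fun x => cutoff R x * F x) (riemVol (hypMetric n)) :=
    fun R hR => integrable_riemVol_of_hasCompactSupport
      ((contDiff_cutoff R).continuous.mul hFc) (hasCompactSupport_cutoff hR).mul_right
  -- the right-hand side does not depend on `R`
  have key : ∀ R : ℝ, 1 ≤ R → R₀ ≤ R → n * ∫ x, cutoff R x * F x ∂(riemVol (hypMetric n)) ≤
      ∫ x, G x ∂(riemVol (hypMetric n)) + c * (B + ∫ x, G x ∂(riemVol (hypMetric n))) := by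
    intro R hR hR₀
    have hRp : 0 < R := by linarith
    set S : Set (EuclideanSpace ℝ (Fin n)) := {x | R ≤ ‖x‖ ∧ ‖x‖ ≤ 2 * R} with hS
    have hSm : MeasurableSet S :=
      (measurableSet_le measurable_const measurable_norm).inter
        (measurableSet_le measurable_norm measurable_const)
    have i1 : Integrable (fun x => cutoff R x * frameDiv Z x) (riemVol (hypMetric n)) :=
      integrable_riemVol_of_hasCompactSupport
        ((contDiff_cutoff R).continuous.mul (continuous_frameDiv hZ))
        (hasCompactSupport_cutoff hRp).mul_right
    -- on the annulus `F` agrees with the compactly supported `cutoff (2R) * F`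
    have iS : Integrable (S.indicator F) (riemVol (hypMetric n)) := by
      refine (integrable_indicator_iff hSm).2 (((hχF (2 * R) (by linarith)).integrableOn
        (s := S)).congr_fun (fun x hx => ?_) hSm)
      simp only [cutoff_eq_one (by linarith : 0 < 2 * R) hx.2, one_mul]
    have s1 : ∀ x, n * (cutoff R x * F x) ≤ G x + cutoff R x * frameDiv Z x := by
      intro x
      have h1 := mul_normSq2_le hA hpos hs hh ht x
      have h2 := mul_nonneg (normSq3_nonneg x (curlOp (hypMetric n) h x)) (hpos x).le
      have h3 := mul_nonneg (normSq1_nonneg x (fun i => tensorDiv (hypMetric n) h x i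
          - contractDV (hypMetric n) h (staticKID A0 A) x i)) (hpos x).le
      have h4 : n * F x ≤ G x + frameDiv Z x := by simp only [hF, hG]; linarith
      have h5 := mul_le_mul_of_nonneg_left h4 (cutoff_nonneg R x)
      have h6 := mul_le_mul_of_nonneg_right (cutoff_le_one R x) (hG0 x)
      linarith
    have s2 : ∀ x, - ∑ a, frameDeriv a (cutoff R) x * Z x a ≤ c * (S.indicator F x + G x) := by
      intro x
      by_cases hx : x ∈ S
      · rw [Set.indicator_of_mem hx]
        have := abs_sum_le_card_mul (fun a => frameDeriv a (cutoff R) x * Z x a)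
          (B := K * (4 * n ^ 2 * (F x + G x))) fun a => by
            rw [abs_mul]
            refine mul_le_mul (hK R hR a x) ?_ (abs_nonneg _) hK0
            rw [hF, hG]
            simp only [← add_mul]
            exact abs_boundaryField_le hA h (hpos x).le a
        rw [Fintype.card_fin] at this
        have := (abs_le.1 this).1
        rw [hc]
        linarith
      · have : ∀ a, frameDeriv a (cutoff R) x = 0 := fun a => by
          rcases lt_or_ge ‖x‖ R with h1 | h1
          · exact frameDeriv_cutoff_of_norm_lt hRp h1 a
          · exact frameDeriv_cutoff_of_lt_norm hRp (not_le.1 fun h2 => hx ⟨h1, h2⟩) a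
        simp only [this, zero_mul, Finset.sum_const_zero, neg_zero, Set.indicator_of_notMem hx,
          zero_add]
        exact mul_nonneg hc0 (hG0 x)
    have i2 : Integrable (fun x => - ∑ a, frameDeriv a (cutoff R) x * Z x a)
        (riemVol (hypMetric n)) := by
      refine (integrable_riemVol_of_hasCompactSupport (continuous_finsetSum _ fun a _ =>
        (continuous_frameDeriv (contDiff_cutoff R) a).mul (hZ a).continuous) ?_).neg
      refine HasCompactSupport.intro (isCompact_closedBall 0 (2 * R)) fun x hx => ?_
      rw [mem_closedBall_zero_iff, not_le] at hx
      simp [frameDeriv_cutoff_of_lt_norm hRp hx]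
    have t1 := integral_mono ((hχF R hRp).const_mul n) (h_grad.add i1) s1
    have t2 := integral_mono i2 ((iS.add h_grad).const_mul c) s2
    have t3 : ∫ x, (G x + cutoff R x * frameDiv Z x) ∂(riemVol (hypMetric n)) = _ :=
      integral_add h_grad i1
    have t4 : ∫ x, c * (S.indicator F x + G x) ∂(riemVol (hypMetric n)) =
        c * (∫ x, S.indicator F x ∂(riemVol (hypMetric n))
          + ∫ x, G x ∂(riemVol (hypMetric n))) := by
      rw [integral_const_mul, integral_add iS h_grad]
    rw [integral_const_mul] at t1
    simp only [Pi.add_apply] at t1 t2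
    rw [t3, integral_mul_frameDiv (contDiff_cutoff R) (hasCompactSupport_cutoff hRp) hZ] at t1
    rw [t4, integral_neg] at t2
    have t5 := mul_le_mul_of_nonneg_left (hB R hR hR₀) hc0
    linarith
  set I : ℝ := (∫ x, G x ∂(riemVol (hypMetric n))
    + c * (B + ∫ x, G x ∂(riemVol (hypMetric n)))) / n with hI
  have hkt : Tendsto (fun k : ℕ => (k : ℝ) + 1) atTop atTop :=
    tendsto_atTop_add_const_right _ _ tendsto_natCast_atTop_atTop
  refine (aecover_closedBall (x := (0 : EuclideanSpace ℝ (Fin n)))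
    hkt).integrable_of_integral_bounded_of_nonneg_ae I (fun k => ?_)
    (Eventually.of_forall hF0) ?_
  · refine ((hχF ((k : ℝ) + 1) (by positivity)).integrableOn
      (s := Metric.closedBall 0 ((k : ℝ) + 1))).congr_fun (fun x hx => ?_)
      Metric.isClosed_closedBall.measurableSet
    simp only [cutoff_eq_one (by positivity : (0 : ℝ) < k + 1) (mem_closedBall_zero_iff.1 hx),
      one_mul]
  · filter_upwards [hkt.eventually_ge_atTop R₀] with k hk
    have h1 := key (k + 1) (by linarith [Nat.cast_nonneg (α := ℝ) k]) hk
    rw [hI, le_div_iff₀ (by positivity), mul_comm]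
    refine le_trans (mul_le_mul_of_nonneg_left ?_ (Nat.cast_nonneg n)) h1
    rw [← integral_indicator Metric.isClosed_closedBall.measurableSet]
    refine integral_mono_of_nonneg
      (Eventually.of_forall fun x => Set.indicator_nonneg (fun x _ => hF0 x) x)
      (hχF _ (by positivity)) (Eventually.of_forall fun x => ?_)
    by_cases hx : x ∈ Metric.closedBall (0 : EuclideanSpace ℝ (Fin n)) ((k : ℝ) + 1)
    · simp only [Set.indicator_of_mem hx,
        cutoff_eq_one (by positivity : (0 : ℝ) < k + 1) (mem_closedBall_zero_iff.1 hx), one_mul,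
        le_refl]
    · simp only [Set.indicator_of_notMem hx]
      exact mul_nonneg (cutoff_nonneg _ _) (hF0 x)

end main

end HypPoincare

open HypPoincare in
theorem mainTheorem3 (n : ℕ) (hn : 2 ≤ n) (A0 : ℝ) (A : EuclideanSpace ℝ (Fin n))
    (hA : ‖A‖ ≤ A0)
    (g : Field2 n) (hg : g = hypMetric n)
    (V : EuclideanSpace ℝ (Fin n) → ℝ) (hV : V = staticKID A0 A)
    (h : Field2 n)
    (h_smooth : ∀ i j, ContDiff ℝ 2 fun x => h x i j)
    (h_symm : ∀ x i j, h x i j = h x j i)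
    (h_traceless : ∀ x, ∑ i, ∑ j, (g x)⁻¹ i j * h x i j = 0)
    (h_decay : (fun x => Real.sqrt (normSq2 (g x) (h x))) =O[cocompact (EuclideanSpace ℝ (Fin n))]
      fun x => ‖x‖ ^ (-(n : ℝ) / 2))
    (h_grad : Integrable (fun x => normSq3 (g x) (cov g h x) * V x) (riemVol g)) :
    Integrable (fun x => normSq2 (g x) (h x) * V x) (riemVol g) ∧
    Integrable (fun x => normSq3 (g x) (curlOp g h x) * V x) (riemVol g) ∧
    Integrable (fun x => normSq1 (g x) (fun i => tensorDiv g h x i - contractDV g h V x i) * V x)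
      (riemVol g) ∧
    Integrable (fun x => vecDiv g (fluxField g h V) x) (riemVol g) ∧
    (∫ x, normSq2 (g x) (h x) * V x ∂(riemVol g) ≤
      1 / (n : ℝ) * ∫ x, ((normSq3 (g x) (cov g h x) - normSq3 (g x) (curlOp g h x)
          - normSq1 (g x) (fun i => tensorDiv g h x i - contractDV g h V x i)) * V x
        + vecDiv g (fluxField g h V) x) ∂(riemVol g)) ∧
    ∫ x, vecDiv g (fluxField g h V) x ∂(riemVol g) = 0 ∧
    (∫ x, normSq2 (g x) (h x) * V x ∂(riemVol g) ≤
      1 / (n : ℝ) * ∫ x, normSq3 (g x) (cov g h x) * V x ∂(riemVol g)) := by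
  subst hg hV
  rcases ((norm_nonneg A).trans hA).eq_or_lt with h0 | h0
  · -- the degenerate case: `V` vanishes identically, and so does every term
    subst h0
    obtain rfl : A = 0 := norm_le_zero_iff.1 hA
    have hf : ∀ x, vecDiv (hypMetric n) (fluxField (hypMetric n) h fun _ => 0) x = 0 := by
      intro x
      simp [vecDiv, fluxField, grad, pderiv]
    simp only [staticKID_zero, hf, mul_zero, add_zero, integral_zero, le_refl, and_true]
    exact ⟨integrable_zero _ _ _, integrable_zero _ _ _, integrable_zero _ _ _,
      integrable_zero _ _ _⟩
  have hpos : ∀ x, 0 < staticKID A0 A x := staticKID_pos hA h0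
  have ht : ∀ x, ∑ a, frameComp h x a a = 0 := fun x => frameComp_trace (h_traceless x)
  have hV2 : ContDiff ℝ 2 (staticKID A0 A) := contDiff_staticKID A0 A
  have hVc := continuous_staticKID A0 A
  have hn0 : (0 : ℝ) < n := by exact_mod_cast (by omega : 0 < n)
  have iF := integrable_normSq2_mul hA hpos h_symm h_smooth ht (by omega) h_decay h_grad
  have iFG : Integrable (fun x => (normSq2 (hypMetric n x) (h x) +
      normSq3 (hypMetric n x) (cov (hypMetric n) h x)) * staticKID A0 A x)
      (riemVol (hypMetric n)) := by
    simp only [add_mul]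
    exact iF.add h_grad
  have iC : Integrable (fun x => normSq3 (hypMetric n x) (curlOp (hypMetric n) h x) *
      staticKID A0 A x) (riemVol (hypMetric n)) := by
    refine (h_grad.const_mul (1 + 2 * n ^ 3)).mono' (aestronglyMeasurable_riemVol
      ((continuous_normSq3_curlOp h_symm h_smooth).mul hVc)) (Eventually.of_forall fun x => ?_)
    rw [Real.norm_of_nonneg (mul_nonneg (normSq3_nonneg _ _) (hpos x).le), ← mul_assoc]
    exact mul_le_mul_of_nonneg_right (normSq3_curlOp_le h x) (hpos x).le
  have iD : Integrable (fun x => normSq1 (hypMetric n x) (fun i => tensorDiv (hypMetric n) h x i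
      - contractDV (hypMetric n) h (staticKID A0 A) x i) * staticKID A0 A x)
      (riemVol (hypMetric n)) := by
    refine (iFG.const_mul (2 * (n ^ 3 + 1))).mono' (aestronglyMeasurable_riemVol
      ((continuous_normSq1_div_sub h_symm h_smooth hV2 fun x => (hpos x).ne').mul hVc))
      (Eventually.of_forall fun x => ?_)
    rw [Real.norm_of_nonneg (mul_nonneg (normSq1_nonneg _ _) (hpos x).le)]
    exact normSq1_mul_le hA h (hpos x).le (hpos x)
  have iX : Integrable (frameDiv (frameFlux h (staticKID A0 A))) (riemVol (hypMetric n)) :=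
    (iFG.const_mul (2 * (n ^ 3 + 1))).mono' (aestronglyMeasurable_riemVol
      (continuous_frameDiv (contDiff_frameFlux h_smooth hV2)))
      (Eventually.of_forall fun x =>
        abs_frameDiv_frameFlux_le hA (hpos x).le h_symm h_smooth ht)
  have hX0 : ∫ x, frameDiv (frameFlux h (staticKID A0 A)) x ∂(riemVol (hypMetric n)) = 0 := by
    refine integral_frameDiv_eq_zero (contDiff_frameFlux h_smooth hV2)
      ((iF.const_mul (2 : ℝ)).const_mul (n : ℝ) |>.const_mul (n : ℝ)) (fun x a => ?_) iX
    rw [← mul_assoc 2]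
    exact abs_frameFlux_le hA h (hpos x).le a
  have hZc := contDiff_boundaryField h_symm h_smooth hV2
  have iZ : Integrable (frameDiv (boundaryField h (staticKID A0 A))) (riemVol (hypMetric n)) := by
    refine ((((iF.const_mul (n + 1 : ℝ)).add iF).add iD).add (h_grad.add iC)).mono'
      (aestronglyMeasurable_riemVol (continuous_frameDiv hZc)) (Eventually.of_forall fun x => ?_)
    have h1 := mul_nonneg (normSq2_nonneg h x) (hpos x).le
    have h2 := mul_nonneg (normSq3_nonneg x (cov (hypMetric n) h x)) (hpos x).le
    have h3 := mul_nonneg (normSq3_nonneg x (curlOp (hypMetric n) h x)) (hpos x).le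
    have h4 := mul_nonneg (normSq1_nonneg x (fun i => tensorDiv (hypMetric n) h x i
          - contractDV (hypMetric n) h (staticKID A0 A) x i)) (hpos x).le
    have h5 : (∑ b, contractGrad h (staticKID A0 A) x b ^ 2) * (staticKID A0 A x)⁻¹ ≤
        normSq2 (hypMetric n x) (h x) * staticKID A0 A x := by
      rw [mul_inv_le_iff₀ (hpos x), mul_assoc, ← sq]
      exact sum_contractGrad_sq_le hA h x
    have h6 : 0 ≤ (∑ b, contractGrad h (staticKID A0 A) x b ^ 2) * (staticKID A0 A x)⁻¹ :=
      mul_nonneg (Finset.sum_nonneg fun _ _ => sq_nonneg _) (inv_nonneg.2 (hpos x).le)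
    have h7 := mul_nonneg hn0.le h1
    rw [frameDiv_boundaryField h_symm h_smooth ht (hpos x).ne', Real.norm_eq_abs, abs_le]
    simp only [Pi.add_apply]
    constructor <;> linarith
  have hZ0 : ∫ x, frameDiv (boundaryField h (staticKID A0 A)) x ∂(riemVol (hypMetric n)) = 0 :=
    integral_frameDiv_eq_zero hZc (iFG.const_mul (4 * n ^ 2))
      (fun x a => abs_boundaryField_le hA h (hpos x).le a) iZ
  have iI : Integrable (fun x => (normSq3 (hypMetric n x) (cov (hypMetric n) h x)
      - normSq3 (hypMetric n x) (curlOp (hypMetric n) h x)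
      - normSq1 (hypMetric n x) (fun i => tensorDiv (hypMetric n) h x i
          - contractDV (hypMetric n) h (staticKID A0 A) x i)) * staticKID A0 A x)
      (riemVol (hypMetric n)) := by
    simp only [sub_mul]
    exact (h_grad.sub iC).sub iD
  have hmain := integral_mono (iF.const_mul (n : ℝ)) (iI.add iZ)
    (mul_normSq2_le hA hpos h_symm h_smooth ht)
  have hdrop := integral_mono iI h_grad fun x => by
    have h3 := mul_nonneg (normSq3_nonneg x (curlOp (hypMetric n) h x)) (hpos x).le
    have h4 := mul_nonneg (normSq1_nonneg x (fun i => tensorDiv (hypMetric n) h x i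
          - contractDV (hypMetric n) h (staticKID A0 A) x i)) (hpos x).le
    simp only [sub_mul]
    linarith
  simp only [Pi.add_apply] at hmain
  rw [integral_const_mul, integral_add iI iZ, hZ0, add_zero] at hmain
  simp only [vecDiv_fluxField h_symm h_smooth hV2]
  rw [integral_add iI iX, hX0, add_zero, one_div, le_inv_mul_iff₀ hn0, le_inv_mul_iff₀ hn0]
  exact ⟨iF, iC, iD, iX, hmain, rfl, hmain.trans hdrop⟩
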